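/- **Conventions.** Manifolds $\mathcal M,\mathcal N$ are finite-dimensional smooth $\mathbb Z$-graded manifolds. A vector field is *cohomological* if it has degree $1$ and squares to zero. For a symplectic form $\omega$ and a function $f$, the Hamiltonian vector field $\{f,\cdot\}_\omega$ is the vector field $V$ with $\iota_V\omega=\delta f$. A *Hamiltonian $Q$-manifold of degree $n$* is a tuple $(\mathcal M,Q,\omega=\delta\alpha,\Theta)$ with $Q$ a cohomological vector field, $\omega$ an exact symplectic form of degree $n$ with chosen primitive $\alpha$, and $\Theta$ a function of degree $n+1$ with $Q=\{\Theta,\cdot\}_\omega$ and $\{\Theta,\Theta\}_\omega=0$. A *trivial Hamiltonian $Q$-bundle of degree $n'$* over $(\mathcal M,Q)$ with fibre $\mathcal N$ consists of a vertical vector field $\mathcal A$ on $\mathcal E=\mathcal M\times\mathcal N$ such that $Q+\mathcal A$ is cohomological, an exact symplectic form $\omega'=\delta\alpha'$ of degree $n'$ on $\mathcal N$, and a function $\Theta'$ of degree $n'+1$ on $\mathcal E$ with $\mathcal A=\{\Theta',\cdot\}_{\omega'}$ and $Q\Theta'+\tfrac12\{\Theta',\Theta'\}_{\omega'}=0$.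 A *classical BV theory* is a Hamiltonian $Q$-manifold of degree $-1$. A *classical pre-observable* for a classical BV theory $(\mathcal F,Q,\Omega,S)$ is a Hamiltonian $Q$-bundle of degree $-1$ over $(\mathcal F,Q)$; here it is a trivial one. On (infinite-dimensional) mapping spaces, symplectic forms are required to be weakly non-degenerate, i.e. $\iota_v\Omega=0$ implies $v=0$. For a closed oriented manifold $X$ and a graded manifold $\mathcal Y$, the transgression $\tau_X:\Omega^\bullet(\mathcal Y)\to\Omega^\bullet(\mathrm{Map}(T[1]X,\mathcal Y))$ is pull-back along the evaluation map $T[1]X\times\mathrm{Map}(T[1]X,\mathcal Y)\to\mathcal Y$ followed by integration over $T[1]X$. The de Rham differential $d_X$ and a vector field $V$ on $\mathcal Y$ induce vector fields $d_X^{\mathrm{lifted}}$, $V^{\mathrm{lifted}}$ on $\mathrm{Map}(T[1]X,\mathcal Y)$. **Proposition.** Let $(\mathcal M,Q,\omega=\delta\alpha,\Theta)$ be a Hamiltonian $Q$-manifold of degree $n$, and let $(\mathcal N,\mathcal A,\omega'=\delta\alpha',\Theta')$ be the fibre data of a trivial Hamiltonian $Q$-bundle of degree $n'$ over $\mathcal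 M$. Let $\Sigma$ and $\gamma$ be closed oriented smooth manifolds with $\dim\Sigma=n+1$ and $\dim\gamma=n'+1$, and let $i:\gamma\to\Sigma$ be a smooth map. Set $$\mathcal F_\Sigma=\mathrm{Map}(T[1]\Sigma,\mathcal M),\quad Q_\Sigma=d_\Sigma^{\mathrm{lifted}}+Q^{\mathrm{lifted}},\quad \Omega_\Sigma=(-1)^{\dim\Sigma}\tau_\Sigma(\omega),\quad S_\Sigma=\iota_{d_\Sigma^{\mathrm{lifted}}}\tau_\Sigma(\alpha)+\tau_\Sigma(\Theta),$$ $$\mathcal F_\gamma=\mathrm{Map}(T[1]\gamma,\mathcal N),\quad \mathcal A_\gamma=d_\gamma^{\mathrm{lifted}}+p^*\mathcal A^{\mathrm{lifted}},\quad \Omega_\gamma=(-1)^{\dim\gamma}\tau_\gamma(\omega'),\quad S_\gamma=\iota_{d_\gamma^{\mathrm{lifted}}}\tau_\gamma(\alpha')+p^*\tau^{\mathrm{tot}}_\gamma(\Theta'),$$ where $\tau_\gamma^{\mathrm{tot}}$ is the transgression for the target $\mathcal E=\mathcal M\times\mathcal N$ and $p=i^*\times\mathrm{id}:\mathcal F_\Sigma\times\mathcal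 F_\gamma\to\mathrm{Map}(T[1]\gamma,\mathcal E)$ is the pull-back of ambient fields along $i$. Then $(\mathcal F_\Sigma,Q_\Sigma,\Omega_\Sigma,S_\Sigma)$ is a classical BV theory and the data $(\mathcal F_\gamma,\mathcal A_\gamma,\Omega_\gamma,S_\gamma)$ form a classical pre-observable for it. That is: $\Omega_\Sigma=\delta\tau_\Sigma(\alpha)$ and $\Omega_\gamma=\delta\tau_\gamma(\alpha')$ are symplectic of degree $-1$; $S_\Sigma$ and $S_\gamma$ have degree $0$; $Q_\Sigma$ is cohomological, $Q_\Sigma=\{S_\Sigma,\cdot\}_{\Omega_\Sigma}$ and $\{S_\Sigma,S_\Sigma\}_{\Omega_\Sigma}=0$; the vector field $Q_\Sigma+\mathcal A_\gamma$ on $\mathcal F_\Sigma\times\mathcal F_\gamma$ is cohomological; $\mathcal A_\gamma=\{S_\gamma,\cdot\}_{\Omega_\gamma}$ is the Hamiltonian vector field of $S_\gamma$; and $$Q_\Sigma S_\gamma+\tfrac12\{S_\gamma,S_\gamma\}_{\Omega_\gamma}=0 .$$ -/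

import Mathlib

open TopologicalSpace
open scoped TensorProduct DirectSum Manifold ContDiff

noncomputable section

/-- A graded-commutative `ℤ`-graded associative unital `ℝ`-algebra. -/
structure GAlg where
  carrier : Type
  [ring : Ring carrier]
  [algebra : Algebra ℝ carrier]
  gr : ℤ → Submodule ℝ carrier
  [graded : GradedAlgebra gr]
  comm : ∀ {i j : ℤ} {a b : carrier}, a ∈ gr i → b ∈ gr j → a * b = (i * j).negOnePow • (b * a)

namespace GAlg

instance : CoeSort GAlg Type := ⟨GAlg.carrier⟩

attribute [instance] GAlg.ring GAlg.algebra GAlg.graded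

/-- Degree-preserving morphisms of graded algebras. -/
structure Hom (A B : GAlg) where
  toAlgHom : A →ₐ[ℝ] B
  map_gr : ∀ {k : ℤ} {a : A}, a ∈ A.gr k → toAlgHom a ∈ B.gr k

instance (A B : GAlg) : CoeFun (Hom A B) (fun _ => A → B) := ⟨fun f => f.toAlgHom⟩

/-- The identity morphism. -/
def Hom.id (A : GAlg) : Hom A A := ⟨AlgHom.id ℝ A, fun h => h⟩

/-- Composition of morphisms. -/
def Hom.comp {A B C : GAlg} (g : Hom B C) (f : Hom A B) : Hom A C :=
  ⟨g.toAlgHom.comp f.toAlgHom, fun h => g.map_gr (f.map_gr h)⟩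

/-! ### Graded tensor products -/

/-- The degree `k` part of a tensor product of graded algebras. -/
def tensorGr (A B : GAlg) (k : ℤ) : Submodule ℝ (A.gr ᵍ⊗[ℝ] B.gr) :=
  Submodule.span ℝ {x | ∃ (i j : ℤ) (a : A) (b : B), i + j = k ∧ a ∈ A.gr i ∧ b ∈ B.gr j ∧
    x = a ᵍ⊗ₜ[ℝ] b}

theorem tmul_mem (A B : GAlg) {i j : ℤ} {a : A} {b : B} (ha : a ∈ A.gr i) (hb : b ∈ B.gr j) :
    (a ᵍ⊗ₜ[ℝ] b : A.gr ᵍ⊗[ℝ] B.gr) ∈ tensorGr A B (i + j) :=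
  Submodule.subset_span ⟨i, j, a, b, rfl, ha, hb, rfl⟩

theorem tmul_mul_tmul (A B : GAlg) {j₁ i₂ : ℤ} (a₁ : A) {b₁ : B} {a₂ : A} (b₂ : B)
    (hb : b₁ ∈ B.gr j₁) (ha : a₂ ∈ A.gr i₂) :
    (a₁ ᵍ⊗ₜ[ℝ] b₁ * a₂ ᵍ⊗ₜ[ℝ] b₂ : A.gr ᵍ⊗[ℝ] B.gr) =
      (j₁ * i₂).negOnePow • ((a₁ * a₂) ᵍ⊗ₜ[ℝ] (b₁ * b₂)) :=
  GradedTensorProduct.tmul_coe_mul_coe_tmul A.gr B.gr a₁ ⟨b₁, hb⟩ ⟨a₂, ha⟩ b₂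

theorem units_smul_mem {M : Type} [AddCommGroup M] [Module ℝ M] (S : Submodule ℝ M) (u : ℤˣ)
    {x : M} (hx : x ∈ S) : u • x ∈ S := by
  rcases Int.units_eq_one_or u with rfl | rfl
  · simpa using hx
  · simpa using hx

theorem tensor_smul_mul (A B : GAlg) (r : ℝ) (x y : A.gr ᵍ⊗[ℝ] B.gr) :
    (r • x) * y = r • (x * y) :=
  LinearMap.map_smul₂ (GradedTensorProduct.mulHom A.gr B.gr) r x y

theorem tensor_mul_smul (A B : GAlg) (r : ℝ) (x y : A.gr ᵍ⊗[ℝ] B.gr) :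
    x * (r • y) = r • (x * y) :=
  map_smul (GradedTensorProduct.mulHom A.gr B.gr x) r y

theorem tensor_units (A B : GAlg) (u v : ℤˣ) (p : A) (q : B) :
    ((u • p) ᵍ⊗ₜ[ℝ] (v • q) : A.gr ᵍ⊗[ℝ] B.gr) = (u * v) • (p ᵍ⊗ₜ[ℝ] q) := by
  have h1 : ((-p) ᵍ⊗ₜ[ℝ] q : A.gr ᵍ⊗[ℝ] B.gr) = -(p ᵍ⊗ₜ[ℝ] q) :=
    (congrArg (GradedTensorProduct.of ℝ A.gr B.gr) (TensorProduct.neg_tmul p q)).trans (map_neg _ _)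
  have h2 : ∀ p : A, (p ᵍ⊗ₜ[ℝ] (-q) : A.gr ᵍ⊗[ℝ] B.gr) = -(p ᵍ⊗ₜ[ℝ] q) := fun p =>
    (congrArg (GradedTensorProduct.of ℝ A.gr B.gr) (TensorProduct.tmul_neg p q)).trans (map_neg _ _)
  rcases Int.units_eq_one_or u with rfl | rfl <;>
  rcases Int.units_eq_one_or v with rfl | rfl <;>
  simp only [Units.neg_smul, one_smul, mul_one, neg_neg, mul_neg, h1, h2]

instance (A B : GAlg) : SetLike.GradedMonoid (tensorGr A B) where
  one_mem := by
    have h := tmul_mem A B (SetLike.GradedOne.one_mem (A := A.gr))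
      (SetLike.GradedOne.one_mem (A := B.gr))
    rw [add_zero] at h
    exact h
  mul_mem := by
    intro k l x y hx hy
    induction hx using Submodule.span_induction with
    | zero => simp
    | add x x' _ _ h h' => rw [add_mul]; exact Submodule.add_mem _ h h'
    | smul r x _ h => rw [tensor_smul_mul]; exact Submodule.smul_mem _ _ h
    | mem x hx =>
      obtain ⟨i, j, a, b, rfl, ha, hb, rfl⟩ := hx
      induction hy using Submodule.span_induction with
      | zero => simp
      | add x x' _ _ h h' => rw [mul_add]; exact Submodule.add_mem _ h h'
      | smul r x _ h => rw [tensor_mul_smul]; exact Submodule.smul_mem _ _ h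
      | mem y hy =>
        obtain ⟨i', j', a', b', rfl, ha', hb', rfl⟩ := hy
        rw [tmul_mul_tmul A B a b' hb ha']
        apply units_smul_mem
        have := tmul_mem A B (SetLike.GradedMul.mul_mem ha ha') (SetLike.GradedMul.mul_mem hb hb')
        rwa [add_add_add_comm] at this

/-- The decomposition of a pair of homogeneous elements. -/
def decAux (A B : GAlg) (i j : ℤ) : A.gr i →ₗ[ℝ] B.gr j →ₗ[ℝ] ⨁ k, tensorGr A B k :=
  LinearMap.mk₂ ℝ (fun a b => DirectSum.lof ℝ ℤ (fun k => tensorGr A B k) (i + j)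
      ⟨(a : A) ᵍ⊗ₜ[ℝ] (b : B), tmul_mem A B a.2 b.2⟩)
    (fun a a' b => by
      rw [← map_add]
      exact congrArg _ (Subtype.ext (TensorProduct.add_tmul (a : A) (a' : A) (b : B))))
    (fun c a b => by
      rw [← map_smul]
      exact congrArg _ (Subtype.ext (TensorProduct.smul_tmul' c (a : A) (b : B)).symm))
    (fun a b b' => by
      rw [← map_add]
      exact congrArg _ (Subtype.ext (TensorProduct.tmul_add (a : A) (b : B) (b' : B))))
    (fun c a b => by
      rw [← map_smul]
      exact congrArg _ (Subtype.ext (TensorProduct.tmul_smul c (a : A) (b : B))))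

/-- The decomposition of a tensor product into homogeneous parts. -/
def dec (A B : GAlg) : (A.gr ᵍ⊗[ℝ] B.gr) →ₗ[ℝ] ⨁ k, tensorGr A B k :=
  (TensorProduct.lift ((DirectSum.toModule ℝ ℤ _ fun i =>
      ((DirectSum.toModule ℝ ℤ _ fun j => (decAux A B i j).flip) ∘ₗ
        (DirectSum.decomposeLinearEquiv B.gr).toLinearMap).flip) ∘ₗ
      (DirectSum.decomposeLinearEquiv A.gr).toLinearMap)) ∘ₗ
    (GradedTensorProduct.of ℝ A.gr B.gr).symm.toLinearMap

theorem dec_tmul (A B : GAlg) {i j : ℤ} {a : A} {b : B} (ha : a ∈ A.gr i) (hb : b ∈ B.gr j) :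
    dec A B (a ᵍ⊗ₜ[ℝ] b) = DirectSum.lof ℝ ℤ (fun k => tensorGr A B k) (i + j)
      ⟨a ᵍ⊗ₜ[ℝ] b, tmul_mem A B ha hb⟩ := by
  have h1 := DirectSum.decomposeLinearEquiv_apply_coe (R := ℝ) A.gr i ⟨a, ha⟩
  have h2 := DirectSum.decomposeLinearEquiv_apply_coe (R := ℝ) B.gr j ⟨b, hb⟩
  simp only at h1 h2
  simp [dec, h1, h2, DirectSum.toModule_lof, decAux]

theorem tensor_ext {A B : GAlg} {M : Type} [AddCommGroup M] [Module ℝ M]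
    {f g : (A.gr ᵍ⊗[ℝ] B.gr) →ₗ[ℝ] M}
    (h : ∀ (i j : ℤ) (a : A) (b : B), a ∈ A.gr i → b ∈ B.gr j →
      f (a ᵍ⊗ₜ[ℝ] b) = g (a ᵍ⊗ₜ[ℝ] b)) : f = g := by
  apply GradedTensorProduct.hom_ext
  apply TensorProduct.ext
  refine DirectSum.decompose_lhom_ext A.gr fun i => ?_
  ext a : 1
  refine DirectSum.decompose_lhom_ext B.gr fun j => ?_
  ext b
  exact h i j a b a.2 b.2

instance (A B : GAlg) : GradedAlgebra (tensorGr A B) where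
  toDecomposition := DirectSum.Decomposition.ofLinearMap (tensorGr A B) (dec A B)
    (by
      apply tensor_ext
      intro i j a b ha hb
      simp [dec_tmul A B ha hb])
    (by
      apply DirectSum.linearMap_ext
      intro k
      ext ⟨x, hx⟩ : 1
      simp only [LinearMap.comp_apply, DirectSum.coeLinearMap_lof, LinearMap.id_apply]
      induction hx using Submodule.span_induction with
      | zero => simp only [map_zero]; exact (map_zero _).symm
      | add x y hx hy h h' => rw [map_add, h, h', ← map_add]; rfl
      | smul r x _ h => rw [map_smul, h, ← map_smul]; rfl
      | mem x hx =>
        obtain ⟨i, j, a, b, rfl, ha, hb, rfl⟩ := hx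
        rw [dec_tmul A B ha hb])

theorem tensor_comm (A B : GAlg) {k l : ℤ} {x y : A.gr ᵍ⊗[ℝ] B.gr} (hx : x ∈ tensorGr A B k)
    (hy : y ∈ tensorGr A B l) : x * y = (k * l).negOnePow • (y * x) := by
  induction hx using Submodule.span_induction with
  | zero => simp
  | add x x' _ _ h h' => rw [add_mul, h, h', mul_add, smul_add]
  | smul r x _ h => rw [tensor_smul_mul, h, tensor_mul_smul, smul_comm]
  | mem x hx =>
    obtain ⟨i, j, a, b, rfl, ha, hb, rfl⟩ := hx
    induction hy using Submodule.span_induction with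
    | zero => simp
    | add x x' _ _ h h' => rw [mul_add (a ᵍ⊗ₜ[ℝ] b), h, h', add_mul x x', smul_add]
    | smul r x _ h => rw [tensor_mul_smul, h, tensor_smul_mul, smul_comm]
    | mem y hy =>
      obtain ⟨i', j', a', b', rfl, ha', hb', rfl⟩ := hy
      rw [tmul_mul_tmul A B a b' hb ha', tmul_mul_tmul A B a' b hb' ha, A.comm ha ha',
        B.comm hb hb']
      rw [tensor_units, smul_smul, smul_smul]
      congr 1
      simp only [← Int.negOnePow_add]
      rw [Int.negOnePow_eq_iff]
      ring_nf
      refine ⟨ - i * j', by ring⟩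

/-- The graded tensor product of two graded-commutative algebras. -/
def tensor (A B : GAlg) : GAlg where
  carrier := A.gr ᵍ⊗[ℝ] B.gr
  gr := tensorGr A B
  comm := tensor_comm A B

/-- The linear map `f ⊗ g` (no signs). -/
def tensorLin {A A' B B' : GAlg} (f : A →ₗ[ℝ] A') (g : B →ₗ[ℝ] B') :
    tensor A B →ₗ[ℝ] tensor A' B' :=
  (GradedTensorProduct.of ℝ A'.gr B'.gr).toLinearMap ∘ₗ TensorProduct.map f g ∘ₗ
    (GradedTensorProduct.of ℝ A.gr B.gr).symm.toLinearMap

theorem tensorLin_tmul {A A' B B' : GAlg} (f : A →ₗ[ℝ] A') (g : B →ₗ[ℝ] B') (a : A) (b : B) :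
    tensorLin f g (a ᵍ⊗ₜ[ℝ] b : A.gr ᵍ⊗[ℝ] B.gr) = (f a ᵍ⊗ₜ[ℝ] g b : A'.gr ᵍ⊗[ℝ] B'.gr) := rfl

/-- The tensor product of two morphisms. -/
def tensorMap {A A' B B' : GAlg} (f : Hom A A') (g : Hom B B') :
    Hom (tensor A B) (tensor A' B') where
  toAlgHom := AlgHom.ofLinearMap (tensorLin f.toAlgHom.toLinearMap g.toAlgHom.toLinearMap)
    (by
      have h := tensorLin_tmul f.toAlgHom.toLinearMap g.toAlgHom.toLinearMap 1 1
      simp only [AlgHom.toLinearMap_apply, map_one] at h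
      exact h)
    (by
      rw [LinearMap.map_mul_iff]
      refine tensor_ext fun i j a b ha hb => ?_
      refine tensor_ext fun i' j' a' b' ha' hb' => ?_
      change tensorLin _ _ ((a ᵍ⊗ₜ[ℝ] b : A.gr ᵍ⊗[ℝ] B.gr) * (a' ᵍ⊗ₜ[ℝ] b' : A.gr ᵍ⊗[ℝ] B.gr)) =
        (f a ᵍ⊗ₜ[ℝ] g b : A'.gr ᵍ⊗[ℝ] B'.gr) * (f a' ᵍ⊗ₜ[ℝ] g b' : A'.gr ᵍ⊗[ℝ] B'.gr)
      rw [tmul_mul_tmul A B a b' hb ha',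
        tmul_mul_tmul A' B' (f a) (g b') (g.map_gr hb) (f.map_gr ha'), ← map_mul, ← map_mul]
      rcases Int.units_eq_one_or (j * i').negOnePow with h | h <;> rw [h]
      · rw [one_smul, one_smul]; rfl
      · rw [Units.neg_smul, one_smul, Units.neg_smul, one_smul]
        exact map_neg (tensorLin f.toAlgHom.toLinearMap g.toAlgHom.toLinearMap) _)
  map_gr := by
    intro k x hx
    change tensorLin _ _ x ∈ tensorGr A' B' k
    induction hx using Submodule.span_induction with
    | zero => exact (map_zero (tensorLin f.toAlgHom.toLinearMap g.toAlgHom.toLinearMap)) ▸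
        Submodule.zero_mem _
    | add x x' _ _ h h' =>
      exact (map_add (tensorLin f.toAlgHom.toLinearMap g.toAlgHom.toLinearMap) x x') ▸
        Submodule.add_mem _ h h'
    | smul r x _ h =>
      exact (map_smul (tensorLin f.toAlgHom.toLinearMap g.toAlgHom.toLinearMap) r x) ▸
        Submodule.smul_mem _ _ h
    | mem x hx =>
      obtain ⟨i, j, a, b, rfl, ha, hb, rfl⟩ := hx
      exact tmul_mem A' B' (f.map_gr ha) (g.map_gr hb)



/-! ### Exterior algebras -/

/-- The exterior powers, with zero in negative degrees. -/
def extGr (V : Type) [AddCommGroup V] [Module ℝ V] : ℤ → Submodule ℝ (ExteriorAlgebra ℝ V)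
  | Int.ofNat n => ⋀[ℝ]^n V
  | Int.negSucc _ => ⊥

section ext

variable (V : Type) [AddCommGroup V] [Module ℝ V]

instance : SetLike.GradedMonoid (extGr V) where
  one_mem := SetLike.GradedOne.one_mem (A := fun n : ℕ => ⋀[ℝ]^n V)
  mul_mem := by
    intro k l x y hx hy
    match k, l with
    | Int.negSucc _, _ =>
      rw [show x = 0 from hx, zero_mul]; exact Submodule.zero_mem _
    | Int.ofNat _, Int.negSucc _ =>
      rw [show y = 0 from hy, mul_zero]; exact Submodule.zero_mem _
    | Int.ofNat m, Int.ofNat n =>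
      exact SetLike.GradedMul.mul_mem (A := fun n : ℕ => ⋀[ℝ]^n V) hx hy

/-- The inclusion of an exterior power into the direct sum of the homogeneous parts. -/
def extIncl (n : ℕ) : ⋀[ℝ]^n V →ₗ[ℝ] ⨁ k, extGr V k :=
  DirectSum.lof ℝ ℤ (fun k => extGr V k) (Int.ofNat n)

/-- The decomposition of the exterior algebra into its homogeneous parts. -/
def extDec : ExteriorAlgebra ℝ V →ₗ[ℝ] ⨁ k, extGr V k :=
  (DirectSum.toModule ℝ ℕ _ (extIncl V)) ∘ₗ
    (DirectSum.decomposeLinearEquiv (fun n : ℕ => ⋀[ℝ]^n V)).toLinearMap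

theorem extDec_coe (n : ℕ) (x : ⋀[ℝ]^n V) :
    extDec V x = extIncl V n x := by
  have h := DirectSum.decomposeLinearEquiv_apply_coe (R := ℝ) (fun n : ℕ => ⋀[ℝ]^n V) n x
  simp only [extDec, LinearMap.comp_apply, LinearEquiv.coe_coe]
  rw [h, DirectSum.toModule_lof]

instance : GradedAlgebra (extGr V) where
  toDecomposition := DirectSum.Decomposition.ofLinearMap (extGr V) (extDec V)
    (by
      refine DirectSum.decompose_lhom_ext (fun n : ℕ => ⋀[ℝ]^n V) fun n => ?_
      refine LinearMap.ext fun x => ?_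
      simp only [LinearMap.comp_apply, Submodule.subtype_apply, extDec_coe, LinearMap.id_apply]
      exact DirectSum.coeLinearMap_lof (extGr V) (Int.ofNat n) x)
    (by
      apply DirectSum.linearMap_ext
      intro k
      ext x : 1
      simp only [LinearMap.comp_apply, DirectSum.coeLinearMap_lof, LinearMap.id_apply]
      match k, x with
      | Int.ofNat n, x => exact extDec_coe V n x
      | Int.negSucc n, x =>
        have hx : x = 0 := Subtype.ext x.2
        rw [hx, map_zero]
        exact map_zero _)

theorem ext_ι_comm (v : V) (n : ℕ) {y : ExteriorAlgebra ℝ V} (hy : y ∈ ⋀[ℝ]^n V) :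
    ExteriorAlgebra.ι ℝ v * y = (n : ℤ).negOnePow • (y * ExteriorAlgebra.ι ℝ v) := by
  induction hy using Submodule.pow_induction_on_left' with
  | algebraMap r => simp [Algebra.commutes]
  | add x y i hx hy h h' => rw [mul_add, h, h', add_mul, smul_add]
  | mem_mul m hm i x hx h =>
    obtain ⟨w, rfl⟩ := hm
    have hs := eq_neg_of_add_eq_zero_left (ExteriorAlgebra.ι_add_mul_swap (R := ℝ) v w)
    rw [← mul_assoc, hs, neg_mul, mul_assoc, h, mul_smul_comm, ← mul_assoc]
    push_cast
    rw [Int.negOnePow_succ, Units.neg_smul]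

theorem ext_comm {k l : ℤ} {x y : ExteriorAlgebra ℝ V} (hx : x ∈ extGr V k)
    (hy : y ∈ extGr V l) : x * y = (k * l).negOnePow • (y * x) := by
  match k, l with
  | Int.negSucc _, _ => rw [show x = 0 from hx, zero_mul, mul_zero, smul_zero]
  | Int.ofNat _, Int.negSucc _ => rw [show y = 0 from hy, zero_mul, mul_zero, smul_zero]
  | Int.ofNat m, Int.ofNat n =>
    change x ∈ ⋀[ℝ]^m V at hx
    change y ∈ ⋀[ℝ]^n V at hy
    induction hx using Submodule.pow_induction_on_left' with
    | algebraMap r => simp [Algebra.commutes]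
    | add x x' i hx hx' h h' => rw [add_mul, h, h', mul_add, smul_add]
    | mem_mul m hm i x hx h =>
      obtain ⟨w, rfl⟩ := hm
      rw [mul_assoc, h, mul_smul_comm, ← mul_assoc, ext_ι_comm V w n hy, smul_mul_assoc,
        smul_smul, mul_assoc, ← Int.negOnePow_add]
      congr 2
      simp only [Int.ofNat_eq_natCast]
      push_cast
      ring

end ext

/-- The exterior algebra of a vector space placed in degree one. -/
abbrev ext (V : Type) [AddCommGroup V] [Module ℝ V] : GAlg where
  carrier := ExteriorAlgebra ℝ V
  gr := extGr V
  comm := ext_comm V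

theorem ext_map_mem {V V' : Type} [AddCommGroup V] [Module ℝ V] [AddCommGroup V'] [Module ℝ V']
    (f : V →ₗ[ℝ] V') (n : ℕ) {a : ExteriorAlgebra ℝ V} (ha : a ∈ ⋀[ℝ]^n V) :
    ExteriorAlgebra.map f a ∈ ⋀[ℝ]^n V' := by
  induction ha using Submodule.pow_induction_on_left' with
  | algebraMap r => rw [AlgHom.commutes]; exact Submodule.algebraMap_mem r
  | add x y i _ _ h h' => rw [map_add]; exact Submodule.add_mem _ h h'
  | mem_mul m hm i x hx h =>
    obtain ⟨w, rfl⟩ := hm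
    rw [map_mul, ExteriorAlgebra.map_apply_ι, ExteriorAlgebra.exteriorPower, pow_succ']
    exact Submodule.mul_mem_mul ⟨f w, rfl⟩ h

/-- The morphism of exterior algebras induced by a linear map. -/
def extMap {V V' : Type} [AddCommGroup V] [Module ℝ V] [AddCommGroup V'] [Module ℝ V']
    (f : V →ₗ[ℝ] V') : Hom (ext V) (ext V') where
  toAlgHom := ExteriorAlgebra.map f
  map_gr := by
    intro k a ha
    match k with
    | Int.negSucc _ =>
      rw [show a = 0 from ha]
      exact (map_zero (ExteriorAlgebra.map f)) ▸ Submodule.zero_mem _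
    | Int.ofNat n => exact ext_map_mem f n ha

theorem ext_finite (V : Type) [AddCommGroup V] [Module ℝ V] [Module.Finite ℝ V] :
    Module.Finite ℝ (ext V) := by
  let b := Module.finBasis ℝ V
  exact Module.Finite.of_basis (Module.Basis.ExteriorAlgebra b)

theorem tensor_finite (A B : GAlg) (hA : Module.Finite ℝ A) (hB : Module.Finite ℝ B) :
    Module.Finite ℝ (tensor A B) :=
  Module.Finite.equiv (M := A ⊗[ℝ] B) (GradedTensorProduct.of ℝ A.gr B.gr)

end GAlg

/-! ### Graded manifolds -/

/-- The coordinate space `ℝ^d`. -/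
abbrev Eu (d : ℕ) : Type := EuclideanSpace ℝ (Fin d)

/-- A sheaf of graded-commutative algebras on a (Hausdorff, second countable) smooth manifold,
the sheaf condition being imposed degree by degree. -/
structure GradedSpace where
  dim : ℕ
  body : Type
  [top : TopologicalSpace body]
  [t2 : T2Space body]
  [sc : SecondCountableTopology body]
  [charted : ChartedSpace (Eu dim) body]
  [mfd : IsManifold 𝓘(ℝ, Eu dim) ∞ body]
  O : Opens body → GAlg
  res : ∀ {U V : Opens body}, U ≤ V → GAlg.Hom (O V) (O U)
  res_refl : ∀ (U : Opens body) (a : O U), res (le_refl U) a = a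
  res_res : ∀ {U V W : Opens body} (h : U ≤ V) (h' : V ≤ W) (a : O W),
    res h (res h' a) = res (h.trans h') a
  glue : ∀ (ι : Type) (U : ι → Opens body) (k : ℤ) (s : ∀ i, O (U i)),
    (∀ i, s i ∈ (O (U i)).gr k) →
    (∀ i j, res (inf_le_left : U i ⊓ U j ≤ U i) (s i) = res inf_le_right (s j)) →
    ∃! a : O (iSup U), a ∈ (O (iSup U)).gr k ∧ ∀ i, res (le_iSup U i) a = s i

namespace GradedSpace

attribute [instance] GradedSpace.top GradedSpace.t2 GradedSpace.sc GradedSpace.charted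
  GradedSpace.mfd

/-- Smooth functions on an open subset of the body. -/
abbrev Smooth (M : GradedSpace) (U : Opens M.body) : Type :=
  C^∞⟮𝓘(ℝ, Eu M.dim), U; 𝓘(ℝ, ℝ), ℝ⟯

/-- Restriction of smooth functions. -/
def restrict (M : GradedSpace) {U V : Opens M.body} (h : U ≤ V) (f : M.Smooth V) : M.Smooth U :=
  f.comp ⟨Opens.inclusion h, contMDiff_inclusion h⟩

/-- Coordinates of non-zero degree over an open subset `U` of the body, together with an embedding
of the smooth functions on (open subsets of) `U` as functions of degree zero. -/
structure Coordinates (M : GradedSpace) (U : Opens M.body) where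
  r : ℕ
  deg : Fin r → ℤ
  deg_ne : ∀ j, deg j ≠ 0
  ξ : Fin r → M.O U
  ξ_mem : ∀ j, ξ j ∈ (M.O U).gr (deg j)
  s : ∀ {V : Opens M.body}, V ≤ U → (M.Smooth V →ₐ[ℝ] M.O V)
  s_mem : ∀ {V : Opens M.body} (h : V ≤ U) (f : M.Smooth V), s h f ∈ (M.O V).gr 0
  s_res : ∀ {V W : Opens M.body} (h : V ≤ W) (h' : W ≤ U) (f : M.Smooth W),
    s (h.trans h') (M.restrict h f) = M.res h (s h' f)

namespace Coordinates

variable {M : GradedSpace} {U : Opens M.body} (c : M.Coordinates U)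

/-- Exponents of non-vanishing monomials: coordinates of odd degree occur at most once. -/
def Admissible (e : Fin c.r → ℕ) : Prop := ∀ j, Odd (c.deg j) → e j ≤ 1

/-- The monomial `ξ^e` over `V ⊆ U`. -/
def monomial {V : Opens M.body} (h : V ≤ U) (e : Fin c.r → ℕ) : M.O V :=
  (List.ofFn fun j => M.res h (c.ξ j) ^ e j).prod

/-- The `N`-th power of the ideal generated by the coordinates of non-zero degree. -/
def InPow {V : Opens M.body} (h : V ≤ U) (N : ℕ) (a : M.O V) : Prop :=
  ∃ t : (Fin c.r → ℕ) → M.O V,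
    a = ∑ e ∈ (Finset.univ : Finset (Fin c.r)).piAntidiag N, t e * c.monomial h e

open Classical in
/-- The polynomial of order less than `N` with the given smooth coefficients. -/
def taylor {V : Opens M.body} (h : V ≤ U) (f : (Fin c.r → ℕ) → M.Smooth V) (N : ℕ) : M.O V :=
  ∑ n ∈ Finset.range N, ∑ e ∈ ((Finset.univ : Finset (Fin c.r)).piAntidiag n).filter c.Admissible,
    c.s h (f e) * c.monomial h e

/-- Functions over open subsets of `U` are the same as their formal power series (with smooth
coefficients) in the coordinates of non-zero degree.  All polynomials occur; whether also infinite
series occur (which can only happen when there are coordinates both of positive and of negative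
degree) is a matter of convention, and both conventions are admitted. -/
structure IsChart : Prop where
  exists_taylor : ∀ {V : Opens M.body} (h : V ≤ U) {k : ℤ} {a : M.O V}, a ∈ (M.O V).gr k →
    ∃ f, ∀ N, c.InPow h N (a - c.taylor h f N)
  unique_taylor : ∀ {V : Opens M.body} (h : V ≤ U) (f : (Fin c.r → ℕ) → M.Smooth V) (N : ℕ),
    c.InPow h N (c.taylor h f N) → ∀ e, c.Admissible e → ∑ j, e j < N → f e = 0
  separated : ∀ {V : Opens M.body} (h : V ≤ U) {k : ℤ} {a : M.O V}, a ∈ (M.O V).gr k →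
    (∀ N, c.InPow h N a) → a = 0

end Coordinates

end GradedSpace

/-- A (finite-dimensional, smooth) `ℤ`-graded manifold. -/
structure GradedManifold extends GradedSpace where
  locally_trivial : ∀ p : body, ∃ U : Opens body, p ∈ U ∧
    ∃ c : toGradedSpace.Coordinates U, c.IsChart

/-- The algebra of global functions. -/
def GradedManifold.functions (M : GradedManifold) : GAlg := M.O ⊤

/-! ### Calculus through the functor of points -/

/-- The algebra is finite-dimensional: functions on an infinitesimal parameter space. -/
def GAlg.IsFinite (R : GAlg) : Prop := Module.Finite ℝ R

/-- `R` is the algebra of smooth maps from an open subset `U` of some `ℝ^m` to a finite-dimensional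
graded-commutative algebra `W`: functions on an infinitesimally thickened coordinate domain. -/
def GAlg.IsSmooth (R : GAlg) : Prop :=
  ∃ (m : ℕ) (U : Set (Eu m)) (W : GAlg) (ev : U → GAlg.Hom R W), IsOpen U ∧ W.IsFinite ∧
    (∀ r : R, (∀ u, ev u r = 0) → r = 0) ∧
    ∀ f : Eu m → W, (∀ l : W →ₗ[ℝ] ℝ, ContDiffOn ℝ ∞ (fun u => l (f u)) U) ↔
      ∃ r : R, ∀ u : U, ev u r = f u

theorem GAlg.IsFinite.isSmooth {R : GAlg} (h : R.IsFinite) : R.IsSmooth := by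
  refine ⟨0, Set.univ, R, fun _ => GAlg.Hom.id R, isOpen_univ, h, fun r hr => hr ⟨0, trivial⟩,
    fun f => ⟨fun _ => ⟨f 0, fun u => ?_⟩, fun _ l =>
      (contDiff_const (c := l (f 0))).contDiffOn.congr fun u _ => by rw [Subsingleton.elim u 0]⟩⟩
  rw [Subsingleton.elim (u : Eu 0) 0]
  rfl

/-- `D` is a derivation of degree `k` along the morphism `φ`. -/
structure IsDer {A R : GAlg} (φ : GAlg.Hom A R) (k : ℤ) (D : A → R) : Prop where
  map_add : ∀ a b, D (a + b) = D a + D b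
  map_smul : ∀ (c : ℝ) a, D (c • a) = c • D a
  map_gr : ∀ {i : ℤ} {a : A}, a ∈ A.gr i → D a ∈ R.gr (k + i)
  leibniz : ∀ {i : ℤ} {a : A} (b : A), a ∈ A.gr i →
    D (a * b) = D a * φ b + (k * i).negOnePow • (φ a * D b)

/-- Algebras of functions on the parameter spaces satisfying `P`. -/
abbrev Test (P : GAlg → Prop) : Type 1 := {R : GAlg // P R}

/-- The operations on points and tangent vectors of a graded space that is described by its points
over parameter algebras.  `Pt R` are the points with parameters in `R`, `map` is the change of
parameters, `Vec R` is an ambient group for the tangent vectors (which are singled out by `IsTan`),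
and `vel k D x` is the velocity of the family of points `x` under a derivation `D` of degree `k` of
the parameters; `velVec` differentiates families of vectors in the same way.
Only the spaces `spec`, `prod` and `mapSpace` below are ever used. -/
structure PtSpace (P : GAlg → Prop) where
  Pt : Test P → Type
  map : ∀ {R S : Test P}, GAlg.Hom R.1 S.1 → Pt R → Pt S
  Vec : Test P → Type
  [grp : ∀ R, AddCommGroup (Vec R)]
  smul : ∀ {R : Test P}, R.1 → Vec R → Vec R
  mapVec : ∀ {R S : Test P}, GAlg.Hom R.1 S.1 → Vec R → Vec S
  IsTan : ∀ {R : Test P}, Pt R → ℤ → Vec R → Prop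
  vel : ∀ {R S : Test P}, ℤ → (R.1 →ₗ[ℝ] S.1) → Pt R → Vec S
  velVec : ∀ {R S : Test P}, ℤ → (R.1 →ₗ[ℝ] S.1) → Vec R → Vec S

namespace PtSpace

attribute [instance] PtSpace.grp

/-- The space with algebra of functions `A`: its points are the morphisms `A → R`, its tangent
vectors the derivations along such morphisms. -/
def spec (A : GAlg) : PtSpace GAlg.IsSmooth where
  Pt R := GAlg.Hom A R.1
  map φ x := φ.comp x
  Vec R := A → R.1
  smul r v := fun a => r * v a
  mapVec φ v := fun a => φ (v a)
  IsTan x k v := IsDer x k v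
  vel _ D x := fun a => D (x a)
  velVec _ D v := fun a => D (v a)

/-- The product of two spaces. -/
def prod {P : GAlg → Prop} (X Y : PtSpace P) : PtSpace P where
  Pt R := X.Pt R × Y.Pt R
  map φ z := (X.map φ z.1, Y.map φ z.2)
  Vec R := X.Vec R × Y.Vec R
  smul r v := (X.smul r v.1, Y.smul r v.2)
  mapVec φ v := (X.mapVec φ v.1, Y.mapVec φ v.2)
  IsTan z k v := X.IsTan z.1 k v.1 ∧ Y.IsTan z.2 k v.2
  vel k D z := (X.vel k D z.1, Y.vel k D z.2)
  velVec k D v := (X.velVec k D v.1, Y.velVec k D v.2)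

variable {P : GAlg → Prop} (X Y : PtSpace P)

/-- Families of elements of the parameter algebras, indexed by points. -/
abbrev Fn : Type 1 := ∀ R : Test P, X.Pt R → R.1

/-- Families of vectors, indexed by points. -/
abbrev VF : Type 1 := ∀ R : Test P, X.Pt R → X.Vec R

/-- Values `α R x k v = ι_v α` of a one-form on a tangent vector `v` of degree `k`. -/
abbrev Form1 : Type 1 := ∀ R : Test P, X.Pt R → ℤ → X.Vec R → R.1

/-- Values `ϖ R x k v l w = ι_w ι_v ϖ` of a two-form on tangent vectors `v`, `w` of degrees
`k`, `l`. -/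
abbrev Form2 : Type 1 := ∀ R : Test P, X.Pt R → ℤ → X.Vec R → ℤ → X.Vec R → R.1

/-- Families of vectors tangent to the fibre `Y` of the trivial bundle `X × Y → X`. -/
abbrev VertVF : Type 1 := ∀ R : Test P, X.Pt R → Y.Pt R → Y.Vec R

variable {X Y}

/-- `f` is a function of degree `k`. -/
structure IsFn (k : ℤ) (f : X.Fn) : Prop where
  deg : ∀ R x, f R x ∈ R.1.gr k
  natural : ∀ {R S : Test P} (φ : GAlg.Hom R.1 S.1) x, f S (X.map φ x) = φ (f R x)

/-- `V` is a vector field of degree `k`. -/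
structure IsVF (k : ℤ) (V : X.VF) : Prop where
  tangent : ∀ R x, X.IsTan x k (V R x)
  natural : ∀ {R S : Test P} (φ : GAlg.Hom R.1 S.1) x, V S (X.map φ x) = X.mapVec φ (V R x)

/-- `α` is a one-form of internal degree `n`. -/
structure IsForm1 (n : ℤ) (α : X.Form1) : Prop where
  deg : ∀ {R : Test P} {x : X.Pt R} {k v}, X.IsTan x k v → α R x k v ∈ R.1.gr (n + k)
  add : ∀ {R : Test P} {x : X.Pt R} {k v w}, X.IsTan x k v → X.IsTan x k w →
    α R x k (v + w) = α R x k v + α R x k w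
  smul : ∀ {R : Test P} {x : X.Pt R} {k v j} {r : R.1}, X.IsTan x k v → r ∈ R.1.gr j →
    α R x (j + k) (X.smul r v) = r * α R x k v
  natural : ∀ {R S : Test P} (φ : GAlg.Hom R.1 S.1) {x : X.Pt R} {k v}, X.IsTan x k v →
    α S (X.map φ x) k (X.mapVec φ v) = φ (α R x k v)

/-- `ϖ` is a two-form of internal degree `n`.  A contraction with a vector of degree `k` has total
degree `k - 1`, which determines the symmetry. -/
structure IsForm2 (n : ℤ) (ϖ : X.Form2) : Prop where
  deg : ∀ {R : Test P} {x : X.Pt R} {k v l w}, X.IsTan x k v → X.IsTan x l w →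
    ϖ R x k v l w ∈ R.1.gr (n + k + l)
  symm : ∀ {R : Test P} {x : X.Pt R} {k v l w}, X.IsTan x k v → X.IsTan x l w →
    ϖ R x k v l w = ((k - 1) * (l - 1)).negOnePow • ϖ R x l w k v
  add : ∀ {R : Test P} {x : X.Pt R} {k v l w w'}, X.IsTan x k v → X.IsTan x l w →
    X.IsTan x l w' → ϖ R x k v l (w + w') = ϖ R x k v l w + ϖ R x k v l w'
  smul : ∀ {R : Test P} {x : X.Pt R} {k v l w j} {r : R.1}, X.IsTan x k v → X.IsTan x l w →
    r ∈ R.1.gr j → ϖ R x k v (j + l) (X.smul r w) = r * ϖ R x k v l w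
  natural : ∀ {R S : Test P} (φ : GAlg.Hom R.1 S.1) {x : X.Pt R} {k v l w}, X.IsTan x k v →
    X.IsTan x l w → ϖ S (X.map φ x) k (X.mapVec φ v) l (X.mapVec φ w) = φ (ϖ R x k v l w)

/-- The vector field `V` of degree `k` maps the function `f` to `g`: whenever a family of points
has velocity `V`, the derivative of `f` along this family is `g`. -/
def Derives (k : ℤ) (V : X.VF) (f g : X.Fn) : Prop :=
  ∀ {R S : Test P} (φ : GAlg.Hom R.1 S.1) (D : R.1 →ₗ[ℝ] S.1) (x : X.Pt R), IsDer φ k D →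
    X.vel k D x = V S (X.map φ x) → D (f R x) = g S (X.map φ x)

/-- The vector field `V` of degree one squares to zero, i.e. `[V, V] = 0`. -/
def SqZero (V : X.VF) : Prop :=
  ∀ {R S : Test P} (φ : GAlg.Hom R.1 S.1) (D : R.1 →ₗ[ℝ] S.1) (x : X.Pt R), IsDer φ 1 D →
    X.vel 1 D x = V S (X.map φ x) → X.velVec 1 D (V R x) = 0

/-- `ϖ = δα`.  For every family of points `x` the pull-backs of the two forms to the parameter
space are related by Cartan's formula for the exterior differential. -/
def IsExtDeriv (α : X.Form1) (ϖ : X.Form2) : Prop :=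
  ∀ {R : Test P} (x : X.Pt R) {k l : ℤ} (D E : R.1 →ₗ[ℝ] R.1),
    IsDer (GAlg.Hom.id R.1) k D → IsDer (GAlg.Hom.id R.1) l E →
    ϖ R x k (X.vel k D x) l (X.vel l E x) =
      (k * (l - 1)).negOnePow • (D (α R x l (X.vel l E x)) -
        α R x (k + l) (X.vel (k + l) (D ∘ₗ E - (k * l).negOnePow • (E ∘ₗ D)) x)) -
      k.negOnePow • E (α R x k (X.vel k D x))

/-- `ϖ` is (weakly) non-degenerate. -/
def Nondegenerate (ϖ : X.Form2) : Prop :=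
  ∀ {R : Test P} (x : X.Pt R) {k : ℤ} {v : X.Vec R}, X.IsTan x k v →
    (∀ {l : ℤ} {w : X.Vec R}, X.IsTan x l w → ϖ R x k v l w = 0) → v = 0

/-- `ϖ = δα` is an exact symplectic form of degree `n`. -/
structure IsExactSymplectic (n : ℤ) (ϖ : X.Form2) (α : X.Form1) : Prop where
  form2 : IsForm2 n ϖ
  form1 : IsForm1 n α
  exact : IsExtDeriv α ϖ
  nondegenerate : Nondegenerate ϖ

/-- `{f, ·}_ϖ = V` for a vector field `V` of degree one, i.e. `ι_V ϖ = δf`. -/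
def IsHamiltonian (ϖ : X.Form2) (f : X.Fn) (V : X.VF) : Prop :=
  ∀ {R S : Test P} (φ : GAlg.Hom R.1 S.1) {k : ℤ} (D : R.1 →ₗ[ℝ] S.1) (x : X.Pt R),
    IsDer φ k D →
    ϖ S (X.map φ x) 1 (V S (X.map φ x)) k (X.vel k D x) = D (f R x)

/-- A Hamiltonian `Q`-manifold of degree `n`.  As `Q = {Θ, ·}`, the Maurer-Cartan equation
`{Θ, Θ} = 0` says that `Q` annihilates `Θ`. -/
structure IsHamQManifold (n : ℤ) (Q : X.VF) (ϖ : X.Form2) (α : X.Form1) (Θ : X.Fn) : Prop where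
  vf : IsVF 1 Q
  sq_zero : SqZero Q
  symplectic : IsExactSymplectic n ϖ α
  fn : IsFn (n + 1) Θ
  hamiltonian : IsHamiltonian ϖ Θ Q
  master : Derives 1 Q Θ (fun _ _ => 0)

/-- The horizontal lift of a vector field on the base of a trivial bundle. -/
def hor (Q : X.VF) : (X.prod Y).VF := fun R z => (Q R z.1, 0)

/-- A vertical vector field, as a vector field on the total space. -/
def ver (A : VertVF X Y) : (X.prod Y).VF := fun R z => (0, A R z.1 z.2)

/-- `{f, ·}_ϖ = A` in the fibres, i.e. `ι_A ϖ = δ^vert f` for a vertical vector field `A` of degree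
one: families of points whose velocity is vertical are used to differentiate `f`. -/
def IsVertHamiltonian (ϖ : Y.Form2) (f : (X.prod Y).Fn) (A : VertVF X Y) : Prop :=
  ∀ {R S : Test P} (φ : GAlg.Hom R.1 S.1) {k : ℤ} (D : R.1 →ₗ[ℝ] S.1) (x : X.Pt R) (y : Y.Pt R),
    IsDer φ k D → X.vel k D x = 0 →
    ϖ S (Y.map φ y) 1 (A S (X.map φ x) (Y.map φ y)) k (Y.vel k D y) = D (f R (x, y))

/-- A trivial Hamiltonian `Q`-bundle of degree `n` with base `(X, Q)` and fibre `Y`: the total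
cohomological vector field is `Q + A`.  In the master equation `Q Θ + ½ {Θ, Θ}_ϖ = 0` the bracket is
`{Θ, Θ}_ϖ = A Θ`, because `A = {Θ, ·}_ϖ`. -/
structure IsTrivialHamQBundle (n : ℤ) (Q : X.VF) (A : VertVF X Y) (ϖ : Y.Form2) (α : Y.Form1)
    (Θ : (X.prod Y).Fn) : Prop where
  base_vf : IsVF 1 Q
  base_sq_zero : SqZero Q
  vert_vf : IsVF 1 (ver A)
  sq_zero : SqZero (fun R z => hor Q R z + ver A R z)
  symplectic : IsExactSymplectic n ϖ α
  fn : IsFn (n + 1) Θ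
  hamiltonian : IsVertHamiltonian ϖ Θ A
  master : ∃ QΘ ΘΘ : (X.prod Y).Fn, Derives 1 (hor Q) Θ QΘ ∧ Derives 1 (ver A) Θ ΘΘ ∧
    ∀ R z, QΘ R z + (1 / 2 : ℝ) • ΘΘ R z = 0

/-- A classical BV theory: a Hamiltonian `Q`-manifold of degree `-1`. -/
def IsBVTheory (Q : X.VF) (Ω : X.Form2) (α : X.Form1) (S : X.Fn) : Prop :=
  IsHamQManifold (-1) Q Ω α S

/-- A classical pre-observable for the ambient BV theory `(X, Q, Ω, S)`: a Hamiltonian `Q`-bundle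
of degree `-1` over `X`, with fibre the space of auxiliary fields `Y`. -/
structure IsPreObservable (Q : X.VF) (Ω : X.Form2) (α : X.Form1) (S : X.Fn) (A : VertVF X Y)
    (Ωaux : Y.Form2) (αaux : Y.Form1) (Saux : (X.prod Y).Fn) : Prop where
  ambient : IsBVTheory Q Ω α S
  bundle : IsTrivialHamQBundle (-1) Q A Ωaux αaux Saux

end PtSpace

/-! ### Differential forms on closed oriented manifolds -/

/-- Covectors. -/
abbrev Cov (d : ℕ) : Type := Module.Dual ℝ (Eu d)

/-- The derivative at `u` of the inverse of the preferred chart at `x₀`, as an endomorphism of the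
model space (with which Mathlib identifies all tangent spaces). -/
def chartDeriv {d : ℕ} {X : Type} [TopologicalSpace X] [ChartedSpace (Eu d) X] (x₀ : X) (u : Eu d) :
    Eu d →L[ℝ] Eu d :=
  mfderiv 𝓘(ℝ, Eu d) 𝓘(ℝ, Eu d) (chartAt (Eu d) x₀).symm u

/-- `sgn x` tells whether the orientation of the tangent space at `x` agrees with the standard one
of the model space; `chartSign` tells whether the chart at `x₀` is orientation preserving at `u`. -/
def chartSign {d : ℕ} {X : Type} [TopologicalSpace X] [ChartedSpace (Eu d) X] (sgn : X → ℤˣ)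
    (x₀ : X) (u : Eu d) : ℝ :=
  ((sgn ((chartAt (Eu d) x₀).symm u) : ℤ) : ℝ) *
    Real.sign (LinearMap.det (chartDeriv x₀ u : Eu d →ₗ[ℝ] Eu d))

/-- A closed (compact, without boundary) oriented smooth manifold of dimension `d`. -/
structure ClosedOriented (d : ℕ) where
  carrier : Type
  [top : TopologicalSpace carrier]
  [t2 : T2Space carrier]
  [compact : CompactSpace carrier]
  [charted : ChartedSpace (Eu d) carrier]
  [mfd : IsManifold 𝓘(ℝ, Eu d) ∞ carrier]
  sgn : carrier → ℤˣ
  sgn_locally_constant : ∀ x₀ : carrier, ContinuousOn (chartSign sgn x₀) (chartAt (Eu d) x₀).target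

instance (d : ℕ) : CoeSort (ClosedOriented d) Type := ⟨ClosedOriented.carrier⟩

attribute [instance] ClosedOriented.top ClosedOriented.t2 ClosedOriented.compact
  ClosedOriented.charted ClosedOriented.mfd

/-- Derivative at `u` in direction `v` of a function with values in a finite-dimensional vector
space. -/
def vecDeriv {d : ℕ} {V : Type} [AddCommGroup V] [Module ℝ V] (f : Eu d → V) (u v : Eu d) : V :=
  ∑ᶠ b, fderiv ℝ (fun w => (Module.Basis.ofVectorSpace ℝ V).repr (f w) b) u v •
    Module.Basis.ofVectorSpace ℝ V b

/-- Integral over `s` of a function with values in a finite-dimensional vector space. -/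
def vecIntegral {d : ℕ} {V : Type} [AddCommGroup V] [Module ℝ V] (s : Set (Eu d)) (f : Eu d → V) :
    V :=
  ∑ᶠ b, (∫ u in s, (Module.Basis.ofVectorSpace ℝ V).repr (f u) b) • Module.Basis.ofVectorSpace ℝ V b

/-- Exterior forms on `ℝ^d` with coefficients in `L`. -/
def FormAlg (d : ℕ) (L : GAlg) : GAlg := (GAlg.ext (Cov d)).tensor L

theorem FormAlg.isFinite (d : ℕ) {L : GAlg} (h : L.IsFinite) : (FormAlg d L).IsFinite :=
  GAlg.tensor_finite _ _ (GAlg.ext_finite _) h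

/-- `FormAlg d L` as a parameter algebra for the points of graded manifolds. -/
def formTest (d : ℕ) (L : Test GAlg.IsFinite) : Test GAlg.IsSmooth :=
  ⟨FormAlg d L.1, (FormAlg.isFinite d L.2).isSmooth⟩

/-- Change of coefficients. -/
def coeffMap (d : ℕ) {L L' : GAlg} (φ : GAlg.Hom L L') : GAlg.Hom (FormAlg d L) (FormAlg d L') :=
  GAlg.tensorMap (GAlg.Hom.id _) φ

/-- The action of a derivation `D` of degree `k` on coefficients:
`η ⊗ c ↦ (-1)^{k |η|} η ⊗ D c`. -/
def coeffDer (d : ℕ) {L L' : GAlg} (k : ℤ) (D : L →ₗ[ℝ] L') : FormAlg d L →ₗ[ℝ] FormAlg d L' :=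
  GAlg.tensorLin
    ((CliffordAlgebra.involute (Q := (0 : QuadraticForm ℝ (Cov d)))).toLinearMap ^ k.natAbs) D

/-- A scalar, as a form of de Rham degree zero. -/
def coeffIncl (d : ℕ) {L : GAlg} (c : L) : FormAlg d L :=
  GradedTensorProduct.tmul ℝ (𝒜 := (GAlg.ext (Cov d)).gr) (ℬ := L.gr) 1 c

/-- The `i`-th coordinate one-form. -/
def coframe (d : ℕ) (L : GAlg) (i : Fin d) : FormAlg d L :=
  GradedTensorProduct.tmul ℝ (𝒜 := (GAlg.ext (Cov d)).gr) (ℬ := L.gr)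
    (ExteriorAlgebra.ι ℝ (EuclideanSpace.proj i : Eu d →L[ℝ] ℝ).toLinearMap) 1

/-- Pull-back of exterior forms along a linear map. -/
def pullForm {d e : ℕ} (L : GAlg) (T : Eu d →L[ℝ] Eu e) : GAlg.Hom (FormAlg e L) (FormAlg d L) :=
  GAlg.tensorMap (GAlg.extMap (T : Eu d →ₗ[ℝ] Eu e).dualMap) (GAlg.Hom.id L)

/-- The coefficient of `e¹ ∧ ⋯ ∧ e^d`: `η ⊗ c ↦ η_{1⋯d} c`. -/
def topCoeff (d : ℕ) (L : GAlg) : FormAlg d L →ₗ[ℝ] L :=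
  (TensorProduct.lid ℝ L).toLinearMap ∘ₗ
    TensorProduct.map ((Module.Basis.ExteriorAlgebra
      (EuclideanSpace.basisFun (Fin d) ℝ).toBasis.dualBasis).coord Finset.univ) LinearMap.id ∘ₗ
    (GradedTensorProduct.of ℝ (GAlg.ext (Cov d)).gr L.gr).symm.toLinearMap

section forms

variable {d : ℕ} (X : ClosedOriented d) {L : GAlg}

/-- The expression in the chart at `x₀` of a form on `X` with coefficients in `L`. -/
def rep (F : X → FormAlg d L) (x₀ : X) (u : Eu d) : FormAlg d L :=
  pullForm L (chartDeriv x₀ u) (F ((chartAt (Eu d) x₀).symm u))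

/-- Smoothness of a form. -/
def SmoothForm (F : X → FormAlg d L) : Prop :=
  ∀ (x₀ : X) (l : FormAlg d L →ₗ[ℝ] ℝ),
    ContDiffOn ℝ ∞ (fun u => l (rep X F x₀ u)) (chartAt (Eu d) x₀).target

/-- The de Rham differential `Σ_i du^i ∧ ∂_i`, computed at `x` in the chart at `x`. -/
def deRham (F : X → FormAlg d L) (x : X) : FormAlg d L :=
  ∑ i, coframe d L i *
    vecDeriv (rep X F x) (chartAt (Eu d) x x) (EuclideanSpace.single i (1 : ℝ))

/-- A smooth partition of unity subordinate to the preferred charts. -/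
def partition : SmoothPartitionOfUnity X 𝓘(ℝ, Eu d) X Set.univ :=
  (SmoothPartitionOfUnity.exists_isSubordinate_chartAt_source 𝓘(ℝ, Eu d) X).choose

/-- Integration over `X` of forms with coefficients in `L`, as an operation acting from the left
on `η ⊗ c`; equivalently, integration over the fibres `T[1]X`. -/
def fiberIntegral (F : X → FormAlg d L) : L :=
  ∑ᶠ x₀ : X, vecIntegral (chartAt (Eu d) x₀).target fun u =>
    (partition X x₀ ((chartAt (Eu d) x₀).symm u) * chartSign X.sgn x₀ u) •
      topCoeff d L (rep X F x₀ u)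

end forms

theorem rep_coeffMap {d : ℕ} (X : ClosedOriented d) {L L' : GAlg} (φ : GAlg.Hom L L')
    (F : X → FormAlg d L) (x₀ : X) (u : Eu d) :
    rep X (fun x => coeffMap d φ (F x)) x₀ u = coeffMap d φ (rep X F x₀ u) := by
  have h : (pullForm L' (chartDeriv x₀ u)).toAlgHom.toLinearMap ∘ₗ
        (coeffMap d φ).toAlgHom.toLinearMap =
      (coeffMap d φ).toAlgHom.toLinearMap ∘ₗ (pullForm L (chartDeriv x₀ u)).toAlgHom.toLinearMap :=
    GAlg.tensor_ext fun _ _ _ _ _ _ => rfl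
  exact LinearMap.congr_fun h _

/-! ### Mapping spaces and transgression -/

namespace PtSpace

/-- The space `Map(T[1]X, N)` of graded maps, `A` being the algebra of functions on `N`.  A point
with parameters in `L` is a morphism from `A` to the algebra of smooth differential forms on `X`
with coefficients in `L`. -/
def mapSpace {d : ℕ} (X : ClosedOriented d) (A : GAlg) : PtSpace GAlg.IsFinite where
  Pt L := {Y : X → GAlg.Hom A (FormAlg d L.1) // ∀ a, SmoothForm X fun p => Y p a}
  map φ Y := ⟨fun p => (coeffMap d φ).comp (Y.1 p), fun a x₀ l => by
    have h := Y.2 a x₀ (l ∘ₗ (coeffMap d φ).toAlgHom.toLinearMap)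
    refine h.congr fun u _ => ?_
    exact congrArg l (rep_coeffMap X φ (fun p => Y.1 p a) x₀ u)⟩
  Vec L := X → A → FormAlg d L.1
  smul c v := fun p a => coeffIncl d c * v p a
  mapVec φ v := fun p a => coeffMap d φ (v p a)
  IsTan Y k v := (∀ p, IsDer (Y.1 p) k (v p)) ∧ ∀ a, SmoothForm X fun p => v p a
  vel k D Y := fun p a => coeffDer d k D (Y.1 p a)
  velVec k D v := fun p a => coeffDer d k D (v p a)

section transgression

variable {d : ℕ} (X : ClosedOriented d) {A : GAlg}

/-- The lift to the mapping space of the de Rham differential on the source. -/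
def dLift : (mapSpace X A).VF := fun _ Y p a => deRham X (fun q => Y.1 q a) p

/-- The lift to the mapping space of a vector field on the target. -/
def targetLift (Q : (spec A).VF) : (mapSpace X A).VF := fun L Y p => Q (formTest d L) (Y.1 p)

/-- Transgression of functions. -/
def transFn (f : (spec A).Fn) : (mapSpace X A).Fn := fun L Y =>
  fiberIntegral X fun p => f (formTest d L) (Y.1 p)

/-- Transgression of one-forms.  The sign is that of moving the contraction, of total degree
`k - 1`, past the integration over the fibre, of degree `-d`. -/
def trans1 (α : (spec A).Form1) : (mapSpace X A).Form1 := fun L Y k v =>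
  ((k - 1) * d).negOnePow • fiberIntegral X fun p => α (formTest d L) (Y.1 p) k (v p)

/-- Transgression of two-forms, with the sign of moving two contractions past the integration. -/
def trans2 (ϖ : (spec A).Form2) : (mapSpace X A).Form2 := fun L Y k v l w =>
  ((k - 1 + (l - 1)) * d).negOnePow •
    fiberIntegral X fun p => ϖ (formTest d L) (Y.1 p) k (v p) l (w p)

/-- The cohomological vector field `Q_X = d_X^lifted + Q^lifted`. -/
def akszQ (Q : (spec A).VF) : (mapSpace X A).VF := fun L Y => dLift X L Y + targetLift X Q L Y

/-- The BV two-form `Ω_X = (-1)^{dim X} τ_X(ϖ)`. -/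
def akszΩ (ϖ : (spec A).Form2) : (mapSpace X A).Form2 := fun L Y k v l w =>
  (d : ℤ).negOnePow • trans2 X ϖ L Y k v l w

/-- The kinetic action `ι_{d^lifted} τ_X(α)`. -/
def kinetic (α : (spec A).Form1) : (mapSpace X A).Fn := fun L Y => trans1 X α L Y 1 (dLift X L Y)

/-- The master action `S_X = ι_{d^lifted} τ_X(α) + τ_X(Θ)`. -/
def akszS (α : (spec A).Form1) (Θ : (spec A).Fn) : (mapSpace X A).Fn := fun L Y =>
  kinetic X α L Y + transFn X Θ L Y

end transgression

section auxiliary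

variable {d e : ℕ} {A B : GAlg} (γ : ClosedOriented d) {S : ClosedOriented e} (i : γ → S)

/-- The pull-back `i^*X` of an ambient field. -/
def pullField {L : Test GAlg.IsFinite} (X : (mapSpace S A).Pt L) (p : γ) :
    GAlg.Hom A (formTest d L).1 :=
  (pullForm L.1 (mfderiv 𝓘(ℝ, Eu d) 𝓘(ℝ, Eu e) i p)).comp (X.1 (i p))

/-- `p^* A^lifted`, where `p` is the pull-back of ambient fields. -/
def auxTarget (V : VertVF (spec A) (spec B)) : VertVF (mapSpace S A) (mapSpace γ B) :=
  fun L X Y p => V (formTest d L) (pullField γ i X p) (Y.1 p)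

/-- `A_γ = d_γ^lifted + p^* A^lifted`. -/
def auxVF (V : VertVF (spec A) (spec B)) : VertVF (mapSpace S A) (mapSpace γ B) := fun L X Y =>
  dLift γ L Y + auxTarget γ i V L X Y

/-- `S_γ = ι_{d_γ^lifted} τ_γ(α') + p^* τ_γ(Θ')`. -/
def auxS (α : (spec B).Form1) (Θ : ((spec A).prod (spec B)).Fn) :
    ((mapSpace S A).prod (mapSpace γ B)).Fn := fun L z =>
  kinetic γ α L z.2 +
    fiberIntegral γ fun p => Θ (formTest d L) (pullField γ i z.1 p, z.2.1 p)

end auxiliary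

end PtSpace

end

open PtSpace

noncomputable section

/-! ### Signs and gradings -/

/-! A field is a point of the target with values in differential forms on the source. The identities
of the target therefore hold for the densities built from a field. Integrating them gives the BV
identities, because every de Rham exact term is killed by Stokes' theorem on the closed source
(`fiberIntegral_deRham`). Integration lowers degree by the dimension of the source, so dimension `n
+ 1` turns degree `n` into `-1` and degree `n + 1` into `0`.

Hamiltonian property. Let a field `Y` have velocity `DY`, with `D` of degree `k`. Cartan's formula
for `ω = δα` gives `ω(dY, DY) = ± d(α(DY)) + D(α(dY))` (`form2_dLift_vel`), and `Q = {Θ, ·}` gives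
`ω(Q(Y), DY) = D(Θ(Y))`. The sum of these two relations integrates to `ι_{Q_X} Ω = δS`
(`akszΩ_dLift_add`).

Square zero. If `DY = dY + Q(Y)`, then `D(dY) = -d(DY) = -d(Q(Y))`. By the chain rule, `D(Q(Y))` is
`d(Q(Y))` plus the derivative of `Q` along itself, which is zero.

Master equation. Since `Q_X` is Hamiltonian, `Q_X S = Ω(Q_X, Q_X)`. Its density is `ω(dY, dY) + 2
ω(Q(Y), dY) + ω(Q(Y), Q(Y))` (`akszΩ_self`). The first summand is `2 d(α(dY))`, the second is `2
d(Θ(Y))`, and the third is `QΘ = 0`.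

Auxiliary fields. Pull-back along `i` intertwines the ambient vector field on `Σ` with the one built
in the same way on `γ` (`pullVec_akszQ`), so only fields on `γ` occur. Up to a common sign, the
density of `Q_Σ S_γ + ½ {S_γ, S_γ}` is then `d(Θ'(x, y))` plus the expression `QΘ' + ½ {Θ', Θ'}`,
which vanishes on the target (`aux_master`).

Weak non-degeneracy. A tangent vector orthogonal to everything is in particular orthogonal to local
tangent vectors cut off by bump functions. The fundamental lemma of the calculus of variations then
reduces the claim to non-degeneracy on the target (`akszΩ_nondegenerate`).

Two devices supply calculus for functions known only as natural families over parameter algebras.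
First, a point over the square-zero extension `S[ε]` is a point over `S` together with a tangent
vector. Directional derivatives are `ε`-coefficients, and the chain rule `dir_eq` is mere
naturality. Second, forms on a chart with finite-dimensional coefficients are themselves an
admissible parameter algebra of the target, with `d` a derivation of it. A field read in a chart is
a point over that algebra, so smoothness of densities and the formulas involving `d` are special
cases of naturality and of the hypotheses on the target. -/

theorem units_smul_eq_real {M : Type} [AddCommGroup M] [Module ℝ M] (u : ℤˣ) (x : M) :
    u • x = ((u : ℤ) : ℝ) • x := by
  rcases Int.units_eq_one_or u with rfl | rfl <;> simp

theorem map_units_smul {M N F : Type} [AddCommGroup M] [AddCommGroup N] [FunLike F M N]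
    [AddMonoidHomClass F M N] (f : F) (u : ℤˣ) (x : M) : f (u • x) = u • f x := by
  rcases Int.units_eq_one_or u with rfl | rfl <;> simp

theorem units_smul_eq_zero {M : Type} [AddCommGroup M] {u : ℤˣ} {x : M} :
    u • x = 0 ↔ x = 0 := by
  rcases Int.units_eq_one_or u with rfl | rfl <;> simp

theorem negOnePow_congr {m n k : ℤ} (h : m - n = k + k) : m.negOnePow = n.negOnePow := by
  rw [Int.negOnePow_eq_iff]; exact ⟨k, h⟩

theorem units_mul_self (u : ℤˣ) : u * u = 1 := by
  rcases Int.units_eq_one_or u with rfl | rfl <;> simp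

namespace GAlg

theorem Hom.ext {A B : GAlg} {f g : Hom A B} (h : ∀ a, f a = g a) : f = g := by
  obtain ⟨f, hf⟩ := f
  obtain ⟨g, hg⟩ := g
  have : f = g := AlgHom.ext h
  subst this
  rfl

theorem Hom.map_add {A B : GAlg} (f : Hom A B) (a b : A) : f (a + b) = f a + f b :=
  _root_.map_add f.toAlgHom a b

theorem Hom.map_mul {A B : GAlg} (f : Hom A B) (a b : A) : f (a * b) = f a * f b :=
  _root_.map_mul f.toAlgHom a b

theorem Hom.map_zero {A B : GAlg} (f : Hom A B) : f 0 = 0 :=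
  _root_.map_zero f.toAlgHom

theorem Hom.map_one {A B : GAlg} (f : Hom A B) : f 1 = 1 :=
  _root_.map_one f.toAlgHom

theorem Hom.map_smul {A B : GAlg} (f : Hom A B) (c : ℝ) (a : A) : f (c • a) = c • f a :=
  _root_.map_smul f.toAlgHom c a

theorem Hom.map_units {A B : GAlg} (f : Hom A B) (u : ℤˣ) (a : A) : f (u • a) = u • f a :=
  map_units_smul f.toAlgHom u a

theorem hom_induction {A : GAlg} {p : A → Prop} (add : ∀ a b, p a → p b → p (a + b))
    (hom : ∀ (i : ℤ) (a : A), a ∈ A.gr i → p a) (a : A) : p a :=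
  DirectSum.Decomposition.inductionOn A.gr (hom 0 0 (Submodule.zero_mem _))
    (fun {i} m => hom i m m.2) add a

/-- The linear map multiplying elements of degree `i` by `(-1)^{e i}`. -/
def twistLin (A : GAlg) (e : ℤ) : A →ₗ[ℝ] A :=
  (DirectSum.toModule ℝ ℤ A fun i => (((e * i).negOnePow : ℤ) : ℝ) • (A.gr i).subtype) ∘ₗ
    (DirectSum.decomposeLinearEquiv A.gr).toLinearMap

theorem twistLin_apply (A : GAlg) (e : ℤ) {i : ℤ} {a : A} (ha : a ∈ A.gr i) :
    twistLin A e a = (e * i).negOnePow • a := by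
  have h := DirectSum.decomposeLinearEquiv_apply_coe (R := ℝ) A.gr i ⟨a, ha⟩
  simp only at h
  simp [twistLin, h, DirectSum.toModule_lof, units_smul_eq_real]

/-- The automorphism multiplying elements of degree `i` by `(-1)^{e i}`. -/
def twist (A : GAlg) (e : ℤ) : Hom A A where
  toAlgHom := AlgHom.ofLinearMap (twistLin A e)
    (by rw [twistLin_apply A e (SetLike.GradedOne.one_mem (A := A.gr))]; simp)
    (by
      intro x y
      induction x using hom_induction with
      | add a b ha hb => rw [add_mul, _root_.map_add, _root_.map_add, ha, hb, add_mul]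
      | hom i a ha =>
        induction y using hom_induction with
        | add b c hb hc => rw [mul_add, _root_.map_add, _root_.map_add, hb, hc, mul_add]
        | hom j b hb =>
          rw [twistLin_apply A e ha, twistLin_apply A e hb,
            twistLin_apply A e (SetLike.GradedMul.mul_mem ha hb), smul_mul_smul_comm, mul_add,
            Int.negOnePow_add])
  map_gr := by
    intro k a ha
    change twistLin A e a ∈ _
    rw [twistLin_apply A e ha]
    exact units_smul_mem _ _ ha

theorem twist_apply {A : GAlg} (e : ℤ) {i : ℤ} {a : A} (ha : a ∈ A.gr i) :
    twist A e a = (e * i).negOnePow • a := twistLin_apply A e ha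

/-- The `k`-th projection fixes the `k`-th piece and kills the sum of all the others, which forces
independence. The gradings of square-zero extensions and of algebras of smooth functions are both
obtained this way. -/
theorem isInternal_of_proj {M : Type} [AddCommGroup M] [Module ℝ M] (gr : ℤ → Submodule ℝ M)
    (proj : ℤ → M →ₗ[ℝ] M) (mem : ∀ k x, proj k x ∈ gr k)
    (same : ∀ k, ∀ x ∈ gr k, proj k x = x) (diff : ∀ j k, j ≠ k → ∀ x ∈ gr j, proj k x = 0)
    (sum : ∀ x, ∃ s : Finset ℤ, x = ∑ k ∈ s, proj k x) : DirectSum.IsInternal gr := by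
  apply DirectSum.isInternal_submodule_of_iSupIndep_of_iSup_eq_top
  · intro k
    rw [Submodule.disjoint_def]
    intro x hx hx'
    have : (⨆ j, ⨆ (_ : j ≠ k), gr j) ≤ LinearMap.ker (proj k) :=
      iSup₂_le fun j hj x hx => diff j k hj x hx
    rw [← same k x hx]
    exact this hx'
  · rw [eq_top_iff]
    intro x _
    obtain ⟨s, hs⟩ := sum x
    rw [hs]
    exact Submodule.sum_mem _ fun k _ => Submodule.mem_iSup_of_mem k (mem k x)

/-- The projection to the degree `k` part. -/
def proj (A : GAlg) (k : ℤ) : A →ₗ[ℝ] A :=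
  (A.gr k).subtype ∘ₗ DirectSum.component ℝ ℤ (fun i => A.gr i) k ∘ₗ
    (DirectSum.decomposeLinearEquiv A.gr).toLinearMap

theorem proj_mem (A : GAlg) (k : ℤ) (x : A) : proj A k x ∈ A.gr k :=
  (DirectSum.decompose A.gr x k).2

theorem proj_same (A : GAlg) {k : ℤ} {x : A} (hx : x ∈ A.gr k) : proj A k x = x :=
  DirectSum.decompose_of_mem_same A.gr hx

theorem proj_ne (A : GAlg) {j k : ℤ} (h : j ≠ k) {x : A} (hx : x ∈ A.gr j) : proj A k x = 0 :=
  DirectSum.decompose_of_mem_ne A.gr hx h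

open Classical in
theorem sum_proj (A : GAlg) (x : A) (s : Finset ℤ) (hs : (DirectSum.decompose A.gr x).support ⊆ s) :
    ∑ k ∈ s, proj A k x = x := by
  conv_rhs => rw [← DirectSum.sum_support_decompose A.gr x]
  symm
  refine Finset.sum_subset hs fun k _ hk => ?_
  have : DirectSum.decompose A.gr x k = 0 := by simpa using hk
  simp [this]

end GAlg

/-! ### Derivations -/

namespace IsDer

variable {A R S : GAlg} {φ : GAlg.Hom A R} {k : ℤ}

theorem map_zero {D : A → R} (h : IsDer φ k D) : D 0 = 0 := by
  have := h.map_smul 0 0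
  simpa using this

/-- The underlying linear map. -/
def toLin {D : A → R} (h : IsDer φ k D) : A →ₗ[ℝ] R where
  toFun := D
  map_add' := h.map_add
  map_smul' := h.map_smul

theorem zero : IsDer φ k (fun _ => 0) where
  map_add _ _ := by simp
  map_smul _ _ := by simp
  map_gr _ := Submodule.zero_mem _
  leibniz _ _ := by simp

theorem add {D E : A → R} (hD : IsDer φ k D) (hE : IsDer φ k E) :
    IsDer φ k (fun a => D a + E a) where
  map_add a b := by rw [hD.map_add, hE.map_add]; abel
  map_smul c a := by rw [hD.map_smul, hE.map_smul, smul_add]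
  map_gr h := Submodule.add_mem _ (hD.map_gr h) (hE.map_gr h)
  leibniz b h := by
    rw [hD.leibniz b h, hE.leibniz b h, add_mul, mul_add, smul_add]; abel

/-- Post-composition with a morphism. -/
theorem comp_hom {D : A → R} (hD : IsDer φ k D) (ψ : GAlg.Hom R S) :
    IsDer (ψ.comp φ) k (fun a => ψ (D a)) where
  map_add a b := by rw [hD.map_add, GAlg.Hom.map_add]
  map_smul c a := by rw [hD.map_smul, GAlg.Hom.map_smul]
  map_gr h := ψ.map_gr (hD.map_gr h)
  leibniz b h := by
    rw [hD.leibniz b h, GAlg.Hom.map_add, GAlg.Hom.map_units, GAlg.Hom.map_mul, GAlg.Hom.map_mul]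
    rfl

/-- Pre-composition with a morphism. -/
theorem hom_comp {ψ : GAlg.Hom R S} {D : R → S} (hD : IsDer ψ k D) (φ : GAlg.Hom A R) :
    IsDer (ψ.comp φ) k (fun a => D (φ a)) where
  map_add a b := by rw [GAlg.Hom.map_add, hD.map_add]
  map_smul c a := by rw [GAlg.Hom.map_smul, hD.map_smul]
  map_gr h := hD.map_gr (φ.map_gr h)
  leibniz b h := by
    rw [GAlg.Hom.map_mul, hD.leibniz _ (φ.map_gr h)]; rfl

theorem smul {D : A → R} (hD : IsDer φ k D) {j : ℤ} {r : R} (hr : r ∈ R.gr j) :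
    IsDer φ (j + k) (fun a => r * D a) where
  map_add a b := by rw [hD.map_add, mul_add]
  map_smul c a := by rw [hD.map_smul, mul_smul_comm]
  map_gr h := by
    rw [add_assoc]; exact SetLike.GradedMul.mul_mem hr (hD.map_gr h)
  leibniz {i a} b h := by
    rw [hD.leibniz b h, mul_add, mul_assoc, mul_smul_comm, ← mul_assoc r (φ a), R.comm hr (φ.map_gr h),
      smul_mul_assoc, smul_smul, mul_assoc, ← Int.negOnePow_add, add_mul, add_comm (k * i)]

/-- Absorbing the sign in the automorphism `twist` removes the homogeneity hypothesis. In this form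
the Leibniz rule is exactly multiplicativity of `φ + εD` in a square-zero extension. -/
theorem leibniz_twist {D : A → R} (hD : IsDer φ k D) (a b : A) :
    D (a * b) = D a * φ b + GAlg.twist R k (φ a) * D b := by
  induction a using GAlg.hom_induction with
  | add a a' h h' =>
    rw [add_mul, hD.map_add, h, h', hD.map_add, GAlg.Hom.map_add, GAlg.Hom.map_add, add_mul,
      add_mul]
    abel
  | hom i a ha =>
    rw [hD.leibniz b ha, GAlg.twist_apply k (φ.map_gr ha), smul_mul_assoc]

theorem map_one {D : A → R} (hD : IsDer φ k D) : D 1 = 0 := by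
  have h := hD.leibniz 1 (SetLike.GradedOne.one_mem (A := A.gr))
  rw [mul_one, GAlg.Hom.map_one, mul_one, one_mul, mul_zero, Int.negOnePow_zero, one_smul] at h
  simpa using h

end IsDer

end

noncomputable section

/-! ### Square-zero extensions -/

namespace GAlg

/-- The underlying space of `S ⊕ ⨁ᵢ εᵢ S`, where `εᵢ εⱼ = 0` and `εᵢ` has degree `-κ i`. -/
def SqCarrier (S : GAlg) {ι : Type} (_κ : ι → ℤ) : Type := S × (ι → S)

section

variable (S : GAlg) {ι : Type} (κ : ι → ℤ)

instance : AddCommGroup (SqCarrier S κ) := inferInstanceAs (AddCommGroup (S × (ι → S)))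

instance : Module ℝ (SqCarrier S κ) := inferInstanceAs (Module ℝ (S × (ι → S)))

/-- An element stands for `x.1 + ∑ εᵢ x.2 i`; the twist is the sign of moving `εᵢ` to the left past
the first factor. -/
instance : Mul (SqCarrier S κ) :=
  ⟨fun x y => (x.1 * y.1, fun i => x.2 i * y.1 + twist S (κ i) x.1 * y.2 i)⟩

instance : One (SqCarrier S κ) := ⟨(1, 0)⟩

variable {S κ}

theorem sq_ext {x y : SqCarrier S κ} (h : x.1 = y.1) (h' : ∀ i, x.2 i = y.2 i) : x = y :=
  Prod.ext h (funext h')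

theorem sq_mul_fst (x y : SqCarrier S κ) : (x * y).1 = x.1 * y.1 := rfl

theorem sq_mul_snd (x y : SqCarrier S κ) (i : ι) :
    (x * y).2 i = x.2 i * y.1 + twist S (κ i) x.1 * y.2 i := rfl

theorem sq_add_fst (x y : SqCarrier S κ) : (x + y).1 = x.1 + y.1 := rfl

theorem sq_add_snd (x y : SqCarrier S κ) (i : ι) : (x + y).2 i = x.2 i + y.2 i := rfl

theorem sq_one_fst : (1 : SqCarrier S κ).1 = 1 := rfl

theorem sq_one_snd (i : ι) : (1 : SqCarrier S κ).2 i = 0 := rfl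

theorem sq_zero_fst : (0 : SqCarrier S κ).1 = 0 := rfl

theorem sq_zero_snd (i : ι) : (0 : SqCarrier S κ).2 i = 0 := rfl

theorem sq_smul_fst (c : ℝ) (x : SqCarrier S κ) : (c • x).1 = c • x.1 := rfl

theorem sq_smul_snd (c : ℝ) (x : SqCarrier S κ) (i : ι) : (c • x).2 i = c • x.2 i := rfl

variable (S κ)

instance : Ring (SqCarrier S κ) :=
  { (inferInstance : AddCommGroup (SqCarrier S κ)) with
    mul := (· * ·)
    one := 1
    left_distrib := fun x y z => sq_ext (mul_add _ _ _) fun i => by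
      simp only [sq_mul_snd, sq_add_snd, sq_add_fst, mul_add]; abel
    right_distrib := fun x y z => sq_ext (add_mul _ _ _) fun i => by
      simp only [sq_mul_snd, sq_add_snd, sq_add_fst, add_mul, Hom.map_add]; abel
    zero_mul := fun x => sq_ext (zero_mul _) fun i => by
      simp only [sq_mul_snd, sq_zero_fst, sq_zero_snd, zero_mul, Hom.map_zero, add_zero]
    mul_zero := fun x => sq_ext (mul_zero _) fun i => by
      simp only [sq_mul_snd, sq_zero_fst, sq_zero_snd, mul_zero, add_zero]
    one_mul := fun x => sq_ext (one_mul _) fun i => by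
      simp only [sq_mul_snd, sq_one_fst, sq_one_snd, zero_mul, Hom.map_one, one_mul, zero_add]
    mul_one := fun x => sq_ext (mul_one _) fun i => by
      simp only [sq_mul_snd, sq_one_fst, sq_one_snd, mul_zero, mul_one, add_zero]
    mul_assoc := fun x y z => sq_ext (mul_assoc _ _ _) fun i => by
      simp only [sq_mul_snd, sq_mul_fst, Hom.map_mul, add_mul, mul_add, mul_assoc, add_assoc] }

instance : Algebra ℝ (SqCarrier S κ) :=
  Algebra.ofModule
    (fun r x y => sq_ext (smul_mul_assoc _ _ _) fun i => by
      simp only [sq_mul_snd, sq_smul_fst, sq_smul_snd, Hom.map_smul, smul_mul_assoc, smul_add])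
    (fun r x y => sq_ext (mul_smul_comm _ _ _) fun i => by
      simp only [sq_mul_snd, sq_smul_fst, sq_smul_snd, mul_smul_comm, smul_add])

/-- The homogeneous parts of a square-zero extension. -/
def sqGr (k : ℤ) : Submodule ℝ (SqCarrier S κ) where
  carrier := {x | x.1 ∈ S.gr k ∧ ∀ i, x.2 i ∈ S.gr (κ i + k)}
  add_mem' hx hy := ⟨Submodule.add_mem _ hx.1 hy.1, fun i => Submodule.add_mem _ (hx.2 i) (hy.2 i)⟩
  zero_mem' := ⟨Submodule.zero_mem _, fun _ => Submodule.zero_mem _⟩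
  smul_mem' c _ hx := ⟨Submodule.smul_mem _ c hx.1, fun i => Submodule.smul_mem _ c (hx.2 i)⟩

/-- The projections to the homogeneous parts of a square-zero extension. -/
def sqProj (k : ℤ) : SqCarrier S κ →ₗ[ℝ] SqCarrier S κ where
  toFun x := (proj S k x.1, fun i => proj S (κ i + k) (x.2 i))
  map_add' _ _ := sq_ext (map_add _ _ _) fun _ => map_add _ _ _
  map_smul' _ _ := sq_ext (map_smul _ _ _) fun _ => map_smul _ _ _

theorem sq_sum_fst (s : Finset ℤ) (f : ℤ → SqCarrier S κ) :
    (∑ k ∈ s, f k).1 = ∑ k ∈ s, (f k).1 :=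
  Prod.fst_sum

theorem sq_sum_snd (s : Finset ℤ) (f : ℤ → SqCarrier S κ) (i : ι) :
    (∑ k ∈ s, f k).2 i = ∑ k ∈ s, (f k).2 i := by
  have : (∑ k ∈ s, f k).2 = ∑ k ∈ s, (f k).2 := Prod.snd_sum
  rw [this, Finset.sum_apply]

variable [Fintype ι]

open Classical in
theorem sq_isInternal : DirectSum.IsInternal (sqGr S κ) := by
  refine isInternal_of_proj _ (sqProj S κ) (fun k x => ⟨proj_mem _ _ _, fun i => proj_mem _ _ _⟩)
    (fun k x hx => sq_ext (proj_same _ hx.1) fun i => proj_same _ (hx.2 i))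
    (fun j k h x hx => sq_ext (proj_ne _ h hx.1) fun i => proj_ne _ (by simpa using h) (hx.2 i))
    (fun x => ?_)
  -- As `εᵢ` has degree `-κ i`, a component of degree `k` in the `i`-th coefficient has total degree
  -- `k - κ i`.
  let s : Finset ℤ := (DirectSum.decompose S.gr x.1).support ∪
    Finset.univ.biUnion fun i => (DirectSum.decompose S.gr (x.2 i)).support.image fun k => k - κ i
  refine ⟨s, sq_ext ?_ fun i => ?_⟩
  · rw [sq_sum_fst]
    exact (sum_proj S x.1 s Finset.subset_union_left).symm
  · rw [sq_sum_snd]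
    have h := sum_proj S (x.2 i) (s.image fun k => κ i + k) (by
      intro k hk
      refine Finset.mem_image.2 ⟨k - κ i, Finset.mem_union_right _ (Finset.mem_biUnion.2
        ⟨i, Finset.mem_univ _, Finset.mem_image_of_mem _ hk⟩), by ring⟩)
    rw [Finset.sum_image (fun a _ b _ h => by simpa using h)] at h
    exact h.symm

instance : SetLike.GradedMonoid (sqGr S κ) where
  one_mem := ⟨SetLike.GradedOne.one_mem (A := S.gr), fun _ => Submodule.zero_mem _⟩
  mul_mem := by
    intro p q x y hx hy
    refine ⟨SetLike.GradedMul.mul_mem hx.1 hy.1, fun i => Submodule.add_mem _ ?_ ?_⟩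
    · rw [← add_assoc]; exact SetLike.GradedMul.mul_mem (hx.2 i) hy.1
    · rw [add_left_comm]
      exact SetLike.GradedMul.mul_mem ((twist S (κ i)).map_gr hx.1) (hy.2 i)

instance : GradedAlgebra (sqGr S κ) where
  toDecomposition := (sq_isInternal S κ).chooseDecomposition

/-- The square-zero extension `S ⊕ ⨁ᵢ εᵢ S`, where `εᵢ` has degree `-κ i`. -/
def sq : GAlg where
  carrier := SqCarrier S κ
  gr := sqGr S κ
  comm := by
    intro p q x y hx hy
    have hu : ∀ u : ℤˣ, (u • (y * x)).1 = u • (y.1 * x.1) ∧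
        ∀ i, (u • (y * x)).2 i = u • (y.2 i * x.1 + twist S (κ i) y.1 * x.2 i) := by
      intro u
      rcases Int.units_eq_one_or u with rfl | rfl
      · simp only [one_smul]; exact ⟨rfl, fun i => rfl⟩
      · simp only [Units.neg_smul, one_smul]; exact ⟨rfl, fun i => rfl⟩
    refine sq_ext ?_ fun i => ?_
    · rw [(hu _).1]; exact S.comm hx.1 hy.1
    · rw [(hu _).2, sq_mul_snd, twist_apply _ hx.1, twist_apply _ hy.1, S.comm (hx.2 i) hy.1,
        smul_mul_assoc, smul_mul_assoc, S.comm hx.1 (hy.2 i), smul_add, smul_smul, smul_smul,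
        add_comm, ← Int.negOnePow_add, ← Int.negOnePow_add]
      congr 2
      · exact negOnePow_congr (k := κ i * p) (by ring)
      · exact congrArg Int.negOnePow (by ring)

end

variable {S T R : GAlg} {ι : Type} [Fintype ι] {κ : ι → ℤ}

/-- The linear projections of a square-zero extension. -/
def sqFst (S : GAlg) (κ : ι → ℤ) : Hom (sq S κ) S where
  toAlgHom := AlgHom.ofLinearMap (LinearMap.fst ℝ S (ι → S)) rfl fun _ _ => rfl
  map_gr h := h.1

/-- The coefficient of `εᵢ`. -/
def sqSnd (S : GAlg) (κ : ι → ℤ) (i : ι) : sq S κ →ₗ[ℝ] S :=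
  LinearMap.proj i ∘ₗ LinearMap.snd ℝ S (ι → S)

theorem sq_hext {x y : sq S κ} (h : sqFst S κ x = sqFst S κ y)
    (h' : ∀ i, sqSnd S κ i x = sqSnd S κ i y) : x = y :=
  sq_ext (κ := κ) h h'

/-- Converse of `sqMk`: morphisms into the extension amount to a morphism together with derivations
along it. Conditions quantified over all derivations are later tested on this one. -/
theorem sqSnd_isDer (φ : Hom S T) (i : ι) :
    IsDer (φ.comp (sqFst S κ)) (κ i) (fun x => φ (sqSnd S κ i x)) where
  map_add a b := by rw [map_add, Hom.map_add]
  map_smul c a := by rw [map_smul, Hom.map_smul]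
  map_gr h := φ.map_gr (h.2 i)
  leibniz {j a} b h := by
    have h1 : sqSnd S κ i (a * b) =
      sqSnd S κ i a * sqFst S κ b + twist S (κ i) (sqFst S κ a) * sqSnd S κ i b := rfl
    rw [h1, Hom.map_add, Hom.map_mul, Hom.map_mul, twist_apply _ ((sqFst S κ).map_gr h),
      Hom.map_units, smul_mul_assoc]
    rfl

/-- The morphism `φ + ∑ᵢ εᵢ Dᵢ` into a square-zero extension. -/
def sqMk (φ : Hom R S) (D : ι → R → S) (hD : ∀ i, IsDer φ (κ i) (D i)) : Hom R (sq S κ) where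
  toAlgHom := AlgHom.ofLinearMap
    (φ.toAlgHom.toLinearMap.prod (LinearMap.pi fun i => (hD i).toLin) : R →ₗ[ℝ] S × (ι → S))
    (sq_ext (κ := κ) φ.map_one fun i => (hD i).map_one)
    (fun x y => sq_ext (κ := κ) (φ.map_mul x y) fun i => (hD i).leibniz_twist x y)
  map_gr {k r} h := (⟨φ.map_gr h, fun i => (hD i).map_gr h⟩ :
    φ r ∈ S.gr k ∧ ∀ i, D i r ∈ S.gr (κ i + k))

/-- If `S` consists of smooth functions with values in `W`, then the extension consists of smooth
functions with values in the finite-dimensional algebra `sq W κ`. Hence infinitesimally thickened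
points are admissible test points. -/
theorem sq_isSmooth (hS : S.IsSmooth) (κ : ι → ℤ) : (sq S κ).IsSmooth := by
  classical
  obtain ⟨m, U, W, ev, hU, hW, inj, surj⟩ := hS
  refine ⟨m, U, sq W κ, fun u => sqMk ((ev u).comp (sqFst S κ)) (fun i x => ev u (sqSnd S κ i x))
    (fun i => sqSnd_isDer (ev u) i), hU, ?_, fun r hr => ?_, fun f => ⟨fun hf => ?_, ?_⟩⟩
  · have : Module.Finite ℝ W := hW
    exact inferInstanceAs (Module.Finite ℝ (W × (ι → W)))
  · refine sq_hext (inj _ fun u => ?_) fun i => (inj _ fun u => ?_).trans (map_zero (sqSnd S κ i)).symm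
    · exact congrArg (sqFst W κ) (hr u)
    · exact congrArg (sqSnd W κ i) (hr u)
  · obtain ⟨r, hr⟩ := (surj fun u => (f u).1).1 fun l => hf (l ∘ₗ (sqFst W κ).toAlgHom.toLinearMap)
    have := fun i => (surj fun u => (f u).2 i).1 fun l => hf (l ∘ₗ sqSnd W κ i)
    choose t ht using this
    exact ⟨(r, t), fun u => sq_ext (κ := κ) (hr u) fun i => ht i u⟩
  · rintro ⟨r, hr⟩ l
    have h0 := (surj fun u => (f u).1).2 ⟨r.1, fun u => congrArg (sqFst W κ) (hr u)⟩
      (l ∘ₗ LinearMap.inl ℝ W (ι → W))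
    have h1 := fun i => (surj fun u => (f u).2 i).2 ⟨r.2 i, fun u => congrArg (sqSnd W κ i) (hr u)⟩
      (l ∘ₗ LinearMap.inr ℝ W (ι → W) ∘ₗ LinearMap.single ℝ (fun _ => W) i)
    refine (h0.add (ContDiffOn.sum (s := Finset.univ) fun i _ => h1 i)).congr fun u _ => ?_
    simp only [LinearMap.comp_apply]
    rw [← map_sum]
    refine (congrArg l (Prod.ext ?_ ?_)).trans (map_add l _ _)
    · change (f u).1 = (f u).1 + (∑ i, LinearMap.inr ℝ W (ι → W) (LinearMap.single ℝ (fun _ => W) i ((f u).2 i))).1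
      rw [Prod.fst_sum]
      simp
    · change (f u).2 = 0 + (∑ i, LinearMap.inr ℝ W (ι → W) (LinearMap.single ℝ (fun _ => W) i ((f u).2 i))).2
      rw [Prod.snd_sum, zero_add]
      ext i
      simp [Finset.sum_apply, Pi.single_apply]

end GAlg

/-- A square-zero extension of a parameter algebra. -/
def sqTest (S : Test GAlg.IsSmooth) {ι : Type} [Fintype ι] (κ : ι → ℤ) : Test GAlg.IsSmooth :=
  ⟨GAlg.sq S.1 κ, GAlg.sq_isSmooth S.2 κ⟩

/-! ### Directional derivatives of functions on a product -/

namespace PtSpace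

variable {A B : GAlg}

/-- Compatibility of a function with changes of parameters. -/
def IsNatural (f : ((spec A).prod (spec B)).Fn) : Prop :=
  ∀ {R S : Test GAlg.IsSmooth} (φ : GAlg.Hom R.1 S.1) (z : ((spec A).prod (spec B)).Pt R),
    f S (((spec A).prod (spec B)).map φ z) = φ (f R z)

/-- The point `x + ε v`, where `v` is a tangent vector of degree `k` at `x` and `ε` has degree
`-k`. -/
def thicken {S : Test GAlg.IsSmooth} {k : ℤ} (z : ((spec A).prod (spec B)).Pt S)
    (v : ((spec A).prod (spec B)).Vec S) (hv : ((spec A).prod (spec B)).IsTan z k v) :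
    ((spec A).prod (spec B)).Pt (sqTest S fun _ : Unit => k) :=
  (GAlg.sqMk z.1 (fun _ => v.1) (fun _ => hv.1), GAlg.sqMk z.2 (fun _ => v.2) (fun _ => hv.2))

/-- The derivative of the function `f` in the direction of the tangent vector `v`. -/
def dir (f : ((spec A).prod (spec B)).Fn) {S : Test GAlg.IsSmooth} {k : ℤ}
    (z : ((spec A).prod (spec B)).Pt S) (v : ((spec A).prod (spec B)).Vec S)
    (hv : ((spec A).prod (spec B)).IsTan z k v) : S.1 :=
  GAlg.sqSnd S.1 (fun _ : Unit => k) () (f (sqTest S fun _ : Unit => k) (thicken z v hv))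

variable {f : ((spec A).prod (spec B)).Fn} {R S : Test GAlg.IsSmooth} {k : ℤ}

/-- Chain rule by naturality alone: the morphism `φ + εD` into `S[ε]` sends the point `(x, y)` to
`z' + ε(v, w)`, so the `ε`-coefficient of `f` there is `D` applied to its value. No regularity of
`f` is involved. -/
theorem dir_eq (hf : IsNatural f) {φ : GAlg.Hom R.1 S.1} {D : R.1 → S.1} (hD : IsDer φ k D)
    {x : GAlg.Hom A R.1} {y : GAlg.Hom B R.1} {z' : ((spec A).prod (spec B)).Pt S}
    {v : A → S.1} {w : B → S.1} (hv : ((spec A).prod (spec B)).IsTan z' k (v, w))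
    (hz : ((spec A).prod (spec B)).map φ (x, y) = z') (h₁ : ∀ a, D (x a) = v a)
    (h₂ : ∀ b, D (y b) = w b) : dir f z' (v, w) hv = D (f R (x, y)) := by
  subst hz
  let z : ((spec A).prod (spec B)).Pt R := (x, y)
  have h := hf (R := R) (S := sqTest S fun _ : Unit => k)
    (GAlg.sqMk φ (fun _ => D) (fun _ => hD)) z
  have h' : ((spec A).prod (spec B)).map (S := sqTest S fun _ : Unit => k)
      (GAlg.sqMk φ (fun _ => D) (fun _ => hD)) z =
      thicken (((spec A).prod (spec B)).map φ z) (v, w) hv := by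
    refine Prod.ext ?_ ?_
    · exact GAlg.Hom.ext fun a => GAlg.sq_hext rfl fun _ => h₁ a
    · exact GAlg.Hom.ext fun b => GAlg.sq_hext rfl fun _ => h₂ b
  rw [h'] at h
  exact congrArg (GAlg.sqSnd S.1 (fun _ : Unit => k) ()) h

theorem dir_map (hf : IsNatural f) (φ : GAlg.Hom R.1 S.1) {z : ((spec A).prod (spec B)).Pt R}
    {v : ((spec A).prod (spec B)).Vec R} (hv : ((spec A).prod (spec B)).IsTan z k v)
    (hv' : ((spec A).prod (spec B)).IsTan (((spec A).prod (spec B)).map φ z) k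
      (((spec A).prod (spec B)).mapVec φ v)) :
    dir f (((spec A).prod (spec B)).map φ z) (((spec A).prod (spec B)).mapVec φ v) hv' =
      φ (dir f z v hv) :=
  dir_eq (R := sqTest R fun _ : Unit => k) (x := (thicken z v hv).1) (y := (thicken z v hv).2) hf
    (GAlg.sqSnd_isDer φ ()) hv' rfl
    (fun _ => rfl) (fun _ => rfl)

/-- The point `z + ε₁v + ε₂w` over two parameters of equal degree is differentiated by each of the
two coefficients and by their sum, which is again a derivation; its velocities are `v`, `w` and `v +
w`. -/
theorem dir_add (hf : IsNatural f) {z : ((spec A).prod (spec B)).Pt S}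
    {v w : ((spec A).prod (spec B)).Vec S} (hv : ((spec A).prod (spec B)).IsTan z k v)
    (hw : ((spec A).prod (spec B)).IsTan z k w)
    (hvw : ((spec A).prod (spec B)).IsTan z k (v + w)) :
    dir f z (v + w) hvw = dir f z v hv + dir f z w hw := by
  let κ : Bool → ℤ := fun _ => k
  let z' : ((spec A).prod (spec B)).Pt (sqTest S κ) :=
    (GAlg.sqMk z.1 (fun b => bif b then v.1 else w.1) (fun b => by cases b; exacts [hw.1, hv.1]),
     GAlg.sqMk z.2 (fun b => bif b then v.2 else w.2) (fun b => by cases b; exacts [hw.2, hv.2]))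
  have ht := GAlg.sqSnd_isDer (κ := κ) (GAlg.Hom.id S.1) true
  have hf' := GAlg.sqSnd_isDer (κ := κ) (GAlg.Hom.id S.1) false
  have h₁ : dir f z v hv = _ := dir_eq (R := sqTest S κ) (x := z'.1) (y := z'.2) hf ht hv rfl
    (fun _ => rfl) (fun _ => rfl)
  have h₂ : dir f z w hw = _ := dir_eq (R := sqTest S κ) (x := z'.1) (y := z'.2) hf hf' hw rfl
    (fun _ => rfl) (fun _ => rfl)
  have h₃ : dir f z (v + w) hvw = _ := dir_eq (R := sqTest S κ) (x := z'.1) (y := z'.2) hf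
    (ht.add hf') hvw rfl (fun _ => rfl) (fun _ => rfl)
  rw [h₁, h₂, h₃]

end PtSpace

end

noncomputable section

/-! ### Smooth functions with values in finite-dimensional vector spaces -/

/-- Smoothness at a point of a function with values in a vector space, tested on linear
functionals. -/
def VSmoothAt {m : ℕ} {V : Type} [AddCommGroup V] [Module ℝ V] (f : Eu m → V) (u : Eu m) : Prop :=
  ∀ l : V →ₗ[ℝ] ℝ, ContDiffAt ℝ ∞ (fun w => l (f w)) u

section VSmooth

variable {m : ℕ} {V V' V'' : Type} [AddCommGroup V] [Module ℝ V] [AddCommGroup V'] [Module ℝ V']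
  [AddCommGroup V''] [Module ℝ V'']

theorem lin_eq_sum {ι : Type} [Fintype ι] (b : Module.Basis ι ℝ V) (T : V →ₗ[ℝ] V') (x : V) :
    T x = ∑ i, b.coord i x • T (b i) := by
  conv_lhs => rw [← b.sum_repr x]
  simp only [map_sum, map_smul, Module.Basis.coord_apply]

theorem vSmoothAt_iff_contDiffOn {s : Set (Eu m)} (hs : IsOpen s) {f : Eu m → V} :
    (∀ l : V →ₗ[ℝ] ℝ, ContDiffOn ℝ ∞ (fun w => l (f w)) s) ↔ ∀ u ∈ s, VSmoothAt f u :=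
  ⟨fun h u hu l => (h l).contDiffAt (hs.mem_nhds hu),
    fun h l u hu => (h u hu l).contDiffWithinAt⟩

namespace VSmoothAt

variable {f g : Eu m → V} {u : Eu m}

theorem congr (hf : VSmoothAt f u) (h : g =ᶠ[nhds u] f) : VSmoothAt g u := fun l =>
  (hf l).congr_of_eventuallyEq (h.fun_comp l)

theorem lin (hf : VSmoothAt f u) (T : V →ₗ[ℝ] V') : VSmoothAt (fun w => T (f w)) u :=
  fun l => hf (l ∘ₗ T)

theorem add (hf : VSmoothAt f u) (hg : VSmoothAt g u) : VSmoothAt (fun w => f w + g w) u := by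
  intro l
  simpa using (hf l).add (hg l)

theorem const (v : V) : VSmoothAt (fun _ : Eu m => v) u := fun _ => contDiffAt_const

theorem sum {ι : Type} {s : Finset ι} {f : ι → Eu m → V} (h : ∀ i ∈ s, VSmoothAt (f i) u) :
    VSmoothAt (fun w => ∑ i ∈ s, f i w) u := by
  intro l
  simpa using ContDiffAt.sum fun i hi => h i hi l

theorem smul {c : Eu m → ℝ} (hc : ContDiffAt ℝ ∞ c u) (hf : VSmoothAt f u) :
    VSmoothAt (fun w => c w • f w) u := by
  intro l
  simpa using hc.mul (hf l)

/-- Expanding the first argument in a basis gives a finite sum of scalar functions times smooth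
functions. -/
theorem bilin [Module.Finite ℝ V] {g : Eu m → V'} (hf : VSmoothAt f u) (hg : VSmoothAt g u)
    (B : V →ₗ[ℝ] V' →ₗ[ℝ] V'') : VSmoothAt (fun w => B (f w) (g w)) u := by
  let b := Module.finBasis ℝ V
  have h : ∀ w, B (f w) (g w) = ∑ i, b.coord i (f w) • B (b i) (g w) := fun w =>
    lin_eq_sum b (B.flip (g w)) (f w)
  simp only [h]
  exact sum fun i _ => (hg.lin (B (b i))).smul (hf (b.coord i))

theorem mul {W : GAlg} [Module.Finite ℝ W] {f g : Eu m → W} (hf : VSmoothAt f u)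
    (hg : VSmoothAt g u) : VSmoothAt (fun w => f w * g w) u :=
  hf.bilin hg (LinearMap.mul ℝ W)

theorem comp {n : ℕ} {f : Eu n → V} {g : Eu m → Eu n} (hf : VSmoothAt f (g u))
    (hg : ContDiffAt ℝ ∞ g u) : VSmoothAt (fun w => f (g w)) u := fun l =>
  (hf l).comp u hg

theorem differentiableAt (hf : VSmoothAt f u) (l : V →ₗ[ℝ] ℝ) :
    DifferentiableAt ℝ (fun w => l (f w)) u :=
  (hf l).differentiableAt (by simp)

end VSmoothAt

theorem vSmoothAt_of_contDiffAt {F : Type} [NormedAddCommGroup F] [NormedSpace ℝ F]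
    [FiniteDimensional ℝ F] {f : Eu m → F} {u : Eu m} (hf : ContDiffAt ℝ ∞ f u) :
    VSmoothAt f u := fun l =>
  (LinearMap.toContinuousLinearMap l).contDiff.contDiffAt.comp u hf

/-- Eliminates the chosen basis from the definition: the rules for `vecDeriv` follow from scalar
calculus by testing on linear functionals, without a norm on `V`. -/
theorem lin_vecDeriv [Module.Finite ℝ V] {f : Eu m → V} {u : Eu m}
    (hf : ∀ l : V →ₗ[ℝ] ℝ, DifferentiableAt ℝ (fun w => l (f w)) u) (l : V →ₗ[ℝ] ℝ) (v : Eu m) :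
    l (vecDeriv f u v) = fderiv ℝ (fun w => l (f w)) u v := by
  let b := Module.Basis.ofVectorSpace ℝ V
  have : Fintype (Module.Basis.ofVectorSpaceIndex ℝ V) := FiniteDimensional.fintypeBasisIndex b
  have h : (fun w => l (f w)) = fun w => ∑ i, b.coord i (f w) * l (b i) :=
    funext fun w => lin_eq_sum b l (f w)
  rw [h, fderiv_fun_sum fun i _ => (hf (b.coord i)).mul_const _, vecDeriv,
    finsum_eq_sum_of_fintype, map_sum]
  simp only [map_smul, ContinuousLinearMap.sum_apply]
  refine Finset.sum_congr rfl fun i _ => ?_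
  have hi := fderiv_mul_const (hf (b.coord i)) (l (b i))
  rw [hi]
  simp [b, mul_comm]

theorem vec_ext {x y : V} (h : ∀ l : V →ₗ[ℝ] ℝ, l x = l y) : x = y := by
  rw [← sub_eq_zero]
  refine (Module.forall_dual_apply_eq_zero_iff ℝ (x - y)).1 fun l => ?_
  rw [map_sub, h l, sub_self]

theorem vecDeriv_congr {f g : Eu m → V} {u : Eu m} (h : f =ᶠ[nhds u] g) (v : Eu m) :
    vecDeriv f u v = vecDeriv g u v := by
  unfold vecDeriv
  refine finsum_congr fun b => ?_
  have := (h.fun_comp fun x => (Module.Basis.ofVectorSpace ℝ V).repr x b).fderiv_eq (𝕜 := ℝ)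
  exact congrArg (fun T => T v • Module.Basis.ofVectorSpace ℝ V b) this

namespace VSmoothAt

variable [Module.Finite ℝ V] {f g : Eu m → V} {u : Eu m}

theorem vecDeriv_lin [Module.Finite ℝ V'] (hf : VSmoothAt f u) (T : V →ₗ[ℝ] V') (v : Eu m) :
    vecDeriv (fun w => T (f w)) u v = T (vecDeriv f u v) := by
  refine vec_ext fun l => ?_
  rw [lin_vecDeriv (hf.lin T).differentiableAt]
  exact (lin_vecDeriv hf.differentiableAt (l ∘ₗ T) v).symm

theorem vecDeriv_add (hf : VSmoothAt f u) (hg : VSmoothAt g u) (v : Eu m) :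
    vecDeriv (fun w => f w + g w) u v = vecDeriv f u v + vecDeriv g u v := by
  refine vec_ext fun l => ?_
  rw [lin_vecDeriv (hf.add hg).differentiableAt, map_add, lin_vecDeriv hf.differentiableAt,
    lin_vecDeriv hg.differentiableAt]
  simp only [map_add]
  rw [fderiv_fun_add (hf.differentiableAt l) (hg.differentiableAt l)]
  rfl

theorem vecDeriv_sum {ι : Type} {s : Finset ι} {f : ι → Eu m → V}
    (hf : ∀ i ∈ s, VSmoothAt (f i) u) (v : Eu m) :
    vecDeriv (fun w => ∑ i ∈ s, f i w) u v = ∑ i ∈ s, vecDeriv (f i) u v := by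
  refine vec_ext fun l => ?_
  rw [lin_vecDeriv (VSmoothAt.sum hf).differentiableAt, map_sum]
  simp only [map_sum]
  rw [fderiv_fun_sum fun i hi => (hf i hi).differentiableAt l, ContinuousLinearMap.sum_apply]
  exact Finset.sum_congr rfl fun i hi => (lin_vecDeriv (hf i hi).differentiableAt l v).symm

theorem vecDeriv_smul {c : Eu m → ℝ} (hc : ContDiffAt ℝ ∞ c u) (hf : VSmoothAt f u) (v : Eu m) :
    vecDeriv (fun w => c w • f w) u v = fderiv ℝ c u v • f u + c u • vecDeriv f u v := by
  refine vec_ext fun l => ?_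
  rw [lin_vecDeriv (hf.smul hc).differentiableAt, map_add, map_smul, map_smul,
    lin_vecDeriv hf.differentiableAt]
  simp only [map_smul, smul_eq_mul]
  rw [fderiv_fun_mul (hc.differentiableAt (by simp)) (hf.differentiableAt l)]
  simp [mul_comm, add_comm]

theorem vecDeriv_bilin [Module.Finite ℝ V'] [Module.Finite ℝ V''] {g : Eu m → V'}
    (hf : VSmoothAt f u) (hg : VSmoothAt g u) (B : V →ₗ[ℝ] V' →ₗ[ℝ] V'') (v : Eu m) :
    vecDeriv (fun w => B (f w) (g w)) u v =
      B (vecDeriv f u v) (g u) + B (f u) (vecDeriv g u v) := by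
  let b := Module.finBasis ℝ V
  have h : ∀ x y, B x y = ∑ i, b.coord i x • B (b i) y := fun x y => lin_eq_sum b (B.flip y) x
  have h' : (fun w => B (f w) (g w)) = fun w => ∑ i, b.coord i (f w) • B (b i) (g w) :=
    funext fun w => h _ _
  rw [h', h (vecDeriv f u v), h (f u), vecDeriv_sum fun i _ => (hg.lin (B (b i))).smul (hf (b.coord i)), ← Finset.sum_add_distrib]
  refine Finset.sum_congr rfl fun i _ => ?_
  rw [(hg.lin (B (b i))).vecDeriv_smul (hf (b.coord i)), hg.vecDeriv_lin,
    lin_vecDeriv hf.differentiableAt]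

theorem vecDeriv_mul {W : GAlg} [Module.Finite ℝ W] {f g : Eu m → W} (hf : VSmoothAt f u)
    (hg : VSmoothAt g u) (v : Eu m) :
    vecDeriv (fun w => f w * g w) u v = vecDeriv f u v * g u + f u * vecDeriv g u v :=
  hf.vecDeriv_bilin hg (LinearMap.mul ℝ W) v

/-- One neighbourhood must serve all functionals; the finitely many coordinate functionals suffice.
-/
theorem eventually_differentiable (hf : VSmoothAt f u) :
    ∀ᶠ w in nhds u, ∀ l : V →ₗ[ℝ] ℝ, DifferentiableAt ℝ (fun w => l (f w)) w := by
  let b := Module.finBasis ℝ V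
  have h : ∀ i, ∀ᶠ w in nhds u, DifferentiableAt ℝ (fun w => b.coord i (f w)) w := fun i =>
    (((hf (b.coord i)).of_le (by simp : (1 : WithTop ℕ∞) ≤ ∞)).eventually (by simp)).mono
      fun w hw => hw.differentiableAt (by simp)
  filter_upwards [Filter.eventually_all.2 h] with w hw l
  have : (fun w => l (f w)) = fun w => ∑ i, b.coord i (f w) * l (b i) :=
    funext fun w => lin_eq_sum b l (f w)
  rw [this]
  exact DifferentiableAt.fun_sum fun i _ => (hw i).mul_const _

theorem vecDeriv (hf : VSmoothAt f u) (v : Eu m) : VSmoothAt (fun w => vecDeriv f w v) u := by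
  intro l
  have h : ContDiffAt ℝ ∞ (fun w => fderiv ℝ (fun w => l (f w)) w v) u :=
    ((hf l).fderiv_right (m := ∞) (by simp)).clm_apply contDiffAt_const
  refine h.congr_of_eventuallyEq ?_
  filter_upwards [hf.eventually_differentiable] with w hw
  exact lin_vecDeriv hw l v

theorem vecDeriv_comm (hf : VSmoothAt f u) (v v' : Eu m) :
    _root_.vecDeriv (fun w => _root_.vecDeriv f w v) u v' =
      _root_.vecDeriv (fun w => _root_.vecDeriv f w v') u v := by
  refine vec_ext fun l => ?_
  have key : ∀ v v', l (_root_.vecDeriv (fun w => _root_.vecDeriv f w v) u v') =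
      fderiv ℝ (fderiv ℝ (fun w => l (f w))) u v' v := by
    intro v v'
    rw [lin_vecDeriv (hf.vecDeriv v).differentiableAt]
    have : (fun w => l (_root_.vecDeriv f w v)) =ᶠ[nhds u]
        fun w => fderiv ℝ (fun w => l (f w)) w v := by
      filter_upwards [hf.eventually_differentiable] with w hw
      exact lin_vecDeriv hw l v
    rw [this.fderiv_eq]
    have hd : DifferentiableAt ℝ (fderiv ℝ (fun w => l (f w))) u :=
      ((hf l).fderiv_right (m := ∞) (by simp)).differentiableAt (by simp)
    rw [fderiv_clm_apply hd (differentiableAt_const v)]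
    simp
  rw [key, key]
  exact ((hf l).isSymmSndFDerivAt (by
    rw [minSmoothness_of_isRCLikeNormedField]
    exact WithTop.coe_le_coe.2 (le_top : (2 : ℕ∞) ≤ ⊤))) v' v

end VSmoothAt

end VSmooth

end

noncomputable section

/-! ### Algebras of smooth functions -/

namespace GAlg

section

variable {m : ℕ} (U : Opens (Eu m)) (W : GAlg)

open Classical in
/-- Extension by zero. -/
def extend {U : Opens (Eu m)} {W : GAlg} (f : U → W) (u : Eu m) : W :=
  if h : u ∈ U then f ⟨u, h⟩ else 0

theorem extend_eq {U : Opens (Eu m)} {W : GAlg} (f : U → W) {u : Eu m} (h : u ∈ U) :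
    extend f u = f ⟨u, h⟩ := dif_pos h

theorem extend_eventuallyEq {U : Opens (Eu m)} {W : GAlg} {f : U → W} {g : Eu m → W}
    (h : ∀ u : U, f u = g u) {u : Eu m} (hu : u ∈ U) : extend f =ᶠ[nhds u] g := by
  filter_upwards [U.isOpen.mem_nhds hu] with w hw
  exact (extend_eq f hw).trans (h ⟨w, hw⟩)

variable [Module.Finite ℝ W]

/-- Smooth functions on `U` with values in `W`. -/
def smoothSub : Subalgebra ℝ (U → W) where
  carrier := {f | ∀ u ∈ U, VSmoothAt (extend f) u}
  add_mem' {f g} hf hg u hu := ((hf u hu).add (hg u hu)).congr (extend_eventuallyEq (fun w => by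
    rw [extend_eq f w.2, extend_eq g w.2]; rfl) hu)
  mul_mem' {f g} hf hg u hu := ((hf u hu).mul (hg u hu)).congr (extend_eventuallyEq (fun w => by
    rw [extend_eq f w.2, extend_eq g w.2]; rfl) hu)
  algebraMap_mem' r u hu := (VSmoothAt.const (algebraMap ℝ W r)).congr
    (extend_eventuallyEq (g := fun _ => algebraMap ℝ W r) (fun _ => rfl) hu)

variable {U W} in
theorem mem_smoothSub {f : U → W} : f ∈ smoothSub U W ↔ ∀ u ∈ U, VSmoothAt (extend f) u := Iff.rfl

/-- Pointwise application of a linear map. -/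
def smoothLin {U : Opens (Eu m)} {W W' : GAlg} [Module.Finite ℝ W] [Module.Finite ℝ W']
    (T : W →ₗ[ℝ] W') : smoothSub U W →ₗ[ℝ] smoothSub U W' where
  toFun f := ⟨fun u => T (f.1 u), mem_smoothSub.2 fun u hu => ((mem_smoothSub.1 f.2 u hu).lin T).congr
    (extend_eventuallyEq (fun w => by rw [extend_eq f.1 w.2]) hu)⟩
  map_add' f g := Subtype.ext (funext fun _ => map_add T _ _)
  map_smul' c f := Subtype.ext (funext fun _ => map_smul T _ _)

/-- The functions with values in the degree `k` part. -/
def smoothGr (k : ℤ) : Submodule ℝ (smoothSub U W) where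
  carrier := {f | ∀ u, f.1 u ∈ W.gr k}
  add_mem' hf hg u := Submodule.add_mem _ (hf u) (hg u)
  zero_mem' _ := Submodule.zero_mem _
  smul_mem' c _ hf u := Submodule.smul_mem _ c (hf u)

-- Finite dimension leaves only finitely many non-zero degrees, so one finite set of degrees serves
-- all values of a function simultaneously.
open Classical in
theorem exists_degrees : ∃ s : Finset ℤ, ∀ x : W, ∑ k ∈ s, proj W k x = x := by
  let b := Module.finBasis ℝ W
  let s := Finset.univ.biUnion fun i => (DirectSum.decompose W.gr (b i)).support
  refine ⟨s, fun x => ?_⟩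
  have h : ∑ k ∈ s, proj W k = LinearMap.id := b.ext fun i => by
    rw [LinearMap.sum_apply]
    exact sum_proj W (b i) s (Finset.subset_biUnion_of_mem
      (fun i => (DirectSum.decompose W.gr (b i)).support) (Finset.mem_univ i))
  have := LinearMap.congr_fun h x
  rwa [LinearMap.sum_apply] at this

theorem smooth_isInternal : DirectSum.IsInternal (smoothGr U W) := by
  refine isInternal_of_proj _ (fun k => smoothLin (proj W k)) (fun k f u => proj_mem _ _ _)
    (fun k f hf => Subtype.ext (funext fun u => proj_same _ (hf u)))
    (fun j k h f hf => Subtype.ext (funext fun u => proj_ne _ h (hf u))) fun f => ?_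
  obtain ⟨s, hs⟩ := exists_degrees W
  refine ⟨s, Subtype.ext (funext fun u => ?_)⟩
  rw [AddSubmonoidClass.coe_finset_sum, Finset.sum_apply]
  exact (hs (f.1 u)).symm

instance : SetLike.GradedMonoid (smoothGr U W) where
  one_mem _ := SetLike.GradedOne.one_mem (A := W.gr)
  mul_mem _ _ _ _ hf hg u := SetLike.GradedMul.mul_mem (hf u) (hg u)

instance : GradedAlgebra (smoothGr U W) where
  toDecomposition := (smooth_isInternal U W).chooseDecomposition

/-- The graded algebra of smooth functions on `U` with values in `W`. -/
def smooth : GAlg where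
  carrier := smoothSub U W
  gr := smoothGr U W
  comm {i j f g} hf hg := Subtype.ext (funext fun u => by
    have h := W.comm (hf u) (hg u)
    rcases Int.units_eq_one_or (i * j).negOnePow with e | e <;> rw [e] at h ⊢
    · rw [one_smul] at h ⊢; exact h
    · rw [Units.neg_smul, one_smul] at h ⊢; exact h)

end

variable {m : ℕ} {U : Opens (Eu m)} {W W' A : GAlg} [Module.Finite ℝ W] [Module.Finite ℝ W']

/-- Evaluation at a point. -/
def ev (u : U) : Hom (smooth U W) W where
  toAlgHom := (Pi.evalAlgHom ℝ (fun _ : U => (W : Type)) u).comp (smoothSub U W).val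
  map_gr h := h u

/-- The element of the algebra given by a smooth function. -/
def smoothMk (f : Eu m → W) (hf : ∀ u ∈ U, VSmoothAt f u) : smooth U W :=
  (⟨fun u => f u, mem_smoothSub.2 fun u hu => (hf u hu).congr (extend_eventuallyEq (fun _ => rfl) hu)⟩ :
    smoothSub U W)

theorem smooth_ext {f g : smooth U W} (h : ∀ u, ev u f = ev u g) : f = g :=
  Subtype.ext (funext h)

/-- The underlying function, extended by zero. -/
def fn (f : smooth U W) : Eu m → W := extend f.1

theorem fn_eq (f : smooth U W) {u : Eu m} (hu : u ∈ U) : fn f u = ev ⟨u, hu⟩ f :=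
  extend_eq f.1 hu

theorem fn_smooth (f : smooth U W) {u : Eu m} (hu : u ∈ U) : VSmoothAt (fn f) u :=
  mem_smoothSub.1 f.2 u hu

theorem fn_eventuallyEq {f : smooth U W} {g : Eu m → W} (h : ∀ u : U, ev u f = g u) {u : Eu m}
    (hu : u ∈ U) : fn f =ᶠ[nhds u] g := extend_eventuallyEq h hu

theorem smooth_mem {k : ℤ} {f : smooth U W} : f ∈ (smooth U W).gr k ↔ ∀ u, ev u f ∈ W.gr k :=
  Iff.rfl

theorem smooth_isSmooth : (smooth U W).IsSmooth := by
  refine ⟨m, U, W, ev, U.isOpen, ‹_›, fun r hr => smooth_ext fun u => ?_, fun f => ?_⟩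
  · rw [hr u, Hom.map_zero]
  · rw [vSmoothAt_iff_contDiffOn U.isOpen]
    refine ⟨fun h => ⟨smoothMk f h, fun u => rfl⟩, ?_⟩
    rintro ⟨r, hr⟩ u hu
    exact (fn_smooth r hu).congr (fn_eventuallyEq hr hu).symm

/-- The morphism to smooth functions given by a smooth family of morphisms. -/
def smoothHom (x : Eu m → Hom A W) (hx : ∀ a, ∀ u ∈ U, VSmoothAt (fun w => x w a) u) :
    Hom A (smooth U W) where
  toAlgHom := AlgHom.ofLinearMap
    { toFun := fun a => smoothMk (fun w => x w a) (hx a)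
      map_add' := fun a b => smooth_ext fun u => (x u).map_add a b
      map_smul' := fun c a => smooth_ext fun u => (x u).map_smul c a }
    (smooth_ext fun u => (x u).map_one) (fun a b => smooth_ext fun u => (x u).map_mul a b)
  map_gr h u := (x u).map_gr h

theorem ev_smoothHom (x : Eu m → Hom A W) (hx : ∀ a, ∀ u ∈ U, VSmoothAt (fun w => x w a) u)
    (u : U) : (ev u).comp (smoothHom x hx) = x u := Hom.ext fun _ => rfl

theorem smooth_isDer {A : GAlg} {k : ℤ} {x : Hom A (smooth U W)} {D : A → smooth U W}
    (h : ∀ u, IsDer ((ev u).comp x) k (fun a => ev u (D a))) : IsDer x k D where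
  map_add a b := smooth_ext fun u => ((h u).map_add a b).trans (Hom.map_add _ _ _).symm
  map_smul c a := smooth_ext fun u => ((h u).map_smul c a).trans (Hom.map_smul _ _ _).symm
  map_gr ha u := (h u).map_gr ha
  leibniz b ha := smooth_ext fun u => by
    rw [Hom.map_add, Hom.map_units, Hom.map_mul, Hom.map_mul]; exact (h u).leibniz b ha

/-- Pointwise application of a morphism. -/
def smoothMap (U : Opens (Eu m)) (φ : Hom W W') : Hom (smooth U W) (smooth U W') where
  toAlgHom := AlgHom.ofLinearMap (smoothLin φ.toAlgHom.toLinearMap)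
    (smooth_ext fun _ => φ.map_one) (fun _ _ => smooth_ext fun _ => φ.map_mul _ _)
  map_gr h u := φ.map_gr (h u)

/-- Pointwise application of a linear map. -/
def smoothApp (U : Opens (Eu m)) (T : W →ₗ[ℝ] W') : smooth U W →ₗ[ℝ] smooth U W' := smoothLin T

theorem smoothApp_isDer {k : ℤ} {φ : Hom W W'} {D : W →ₗ[ℝ] W'} (hD : IsDer φ k D) :
    IsDer (smoothMap U φ) k (smoothApp U D) :=
  smooth_isDer (x := smoothMap U φ) fun u => hD.hom_comp (ev u)

end GAlg

/-- Smooth functions on an open subset of a coordinate space, as a parameter algebra. -/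
def smoothTest {m : ℕ} (U : Opens (Eu m)) (W : GAlg) [Module.Finite ℝ W] : Test GAlg.IsSmooth :=
  ⟨GAlg.smooth U W, GAlg.smooth_isSmooth⟩

end

noncomputable section

/-! ### Exterior forms with coefficients -/

instance {d : ℕ} {L : GAlg} [Module.Finite ℝ L] : Module.Finite ℝ (FormAlg d L) :=
  FormAlg.isFinite d ‹_›

instance (L : Test GAlg.IsFinite) : Module.Finite ℝ L.1 := L.2

theorem GAlg.tensor_mem_induction {A B : GAlg} {k : ℤ}
    {p : (x : A.gr ᵍ⊗[ℝ] B.gr) → x ∈ GAlg.tensorGr A B k → Prop}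
    (zero : p 0 (Submodule.zero_mem _))
    (add : ∀ x y hx hy, p x hx → p y hy → p (x + y) (Submodule.add_mem _ hx hy))
    (smul : ∀ (r : ℝ) x hx, p x hx → p (r • x) (Submodule.smul_mem _ r hx))
    (tmul : ∀ (i j : ℤ) (a : A) (b : B) (h : i + j = k) (ha : a ∈ A.gr i) (hb : b ∈ B.gr j),
      p (a ᵍ⊗ₜ[ℝ] b) (h ▸ GAlg.tmul_mem A B ha hb))
    {x : A.gr ᵍ⊗[ℝ] B.gr} (hx : x ∈ GAlg.tensorGr A B k) : p x hx := by
  induction hx using Submodule.span_induction with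
  | zero => exact zero
  | add x y hx hy h h' => exact add x y hx hy h h'
  | smul r x hx h => exact smul r x hx h
  | mem x hx =>
    obtain ⟨i, j, a, b, h, ha, hb, rfl⟩ := hx
    exact tmul i j a b h ha hb

namespace FormAlg

variable {d e : ℕ} {L L' L'' : GAlg}

/-- The form `η ⊗ c`. -/
def mk (η : ExteriorAlgebra ℝ (Cov d)) (c : L) : FormAlg d L :=
  GradedTensorProduct.tmul ℝ (𝒜 := (GAlg.ext (Cov d)).gr) (ℬ := L.gr) η c

/-- The form `η ⊗ c`, as a bilinear map. -/
def mkLin (d : ℕ) (L : GAlg) : ExteriorAlgebra ℝ (Cov d) →ₗ[ℝ] L →ₗ[ℝ] FormAlg d L :=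
  (TensorProduct.mk ℝ (ExteriorAlgebra ℝ (Cov d)) L).compr₂
    (GradedTensorProduct.of ℝ (GAlg.ext (Cov d)).gr L.gr).toLinearMap

theorem mk_units (η : ExteriorAlgebra ℝ (Cov d)) (c : L) (u v : ℤˣ) :
    mk (u • η) (v • c) = (u * v) • mk η c := 
  GAlg.tensor_units (GAlg.ext (Cov d)) L u v η c

theorem mk_units_left (η : ExteriorAlgebra ℝ (Cov d)) (c : L) (u : ℤˣ) :
    mk (u • η) c = u • mk η c := by
  have := mk_units η c u 1
  rwa [one_smul, mul_one] at this

theorem mk_units_right (η : ExteriorAlgebra ℝ (Cov d)) (c : L) (u : ℤˣ) :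
    mk η (u • c) = u • mk η c := by
  have := mk_units η c 1 u
  rwa [one_smul, one_mul] at this

theorem mk_mem {i j : ℤ} {η : ExteriorAlgebra ℝ (Cov d)} {c : L} (hη : η ∈ GAlg.extGr (Cov d) i)
    (hc : c ∈ L.gr j) : mk η c ∈ (FormAlg d L).gr (i + j) :=
  GAlg.tmul_mem (GAlg.ext (Cov d)) L hη hc

theorem mk_mul_mk {i j : ℤ} (η : ExteriorAlgebra ℝ (Cov d)) {c : L}
    {η' : ExteriorAlgebra ℝ (Cov d)} (c' : L) (hc : c ∈ L.gr j)
    (hη' : η' ∈ GAlg.extGr (Cov d) i) :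
    mk η c * mk η' c' = (j * i).negOnePow • mk (η * η') (c * c') :=
  GAlg.tmul_mul_tmul (GAlg.ext (Cov d)) L η c' hc hη'

theorem lin_ext {M : Type} [AddCommGroup M] [Module ℝ M] {f g : FormAlg d L →ₗ[ℝ] M}
    (h : ∀ (i j : ℤ) (η : ExteriorAlgebra ℝ (Cov d)) (c : L), η ∈ GAlg.extGr (Cov d) i →
      c ∈ L.gr j → f (mk η c) = g (mk η c)) : f = g :=
  GAlg.tensor_ext (A := GAlg.ext (Cov d)) (B := L) h

theorem hom_ext_mk {R : GAlg} {f g : GAlg.Hom (FormAlg d L) R}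
    (h : ∀ (i j : ℤ) (η : ExteriorAlgebra ℝ (Cov d)) (c : L), η ∈ GAlg.extGr (Cov d) i →
      c ∈ L.gr j → f (mk η c) = g (mk η c)) : f = g :=
  GAlg.Hom.ext fun a => LinearMap.congr_fun
    (lin_ext (f := f.toAlgHom.toLinearMap) (g := g.toAlgHom.toLinearMap) h) a

theorem mem_induction {k : ℤ} {p : (x : FormAlg d L) → x ∈ (FormAlg d L).gr k → Prop}
    (zero : p 0 (Submodule.zero_mem _))
    (add : ∀ x y hx hy, p x hx → p y hy → p (x + y) (Submodule.add_mem _ hx hy))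
    (smul : ∀ (r : ℝ) x hx, p x hx → p (r • x) (Submodule.smul_mem _ r hx))
    (tmul : ∀ (i j : ℤ) (η : ExteriorAlgebra ℝ (Cov d)) (c : L) (h : i + j = k)
      (hη : η ∈ GAlg.extGr (Cov d) i) (hc : c ∈ L.gr j), p (mk η c) (h ▸ mk_mem hη hc))
    {x : FormAlg d L} (hx : x ∈ (FormAlg d L).gr k) : p x hx :=
  GAlg.tensor_mem_induction (A := GAlg.ext (Cov d)) (B := L) (p := p) zero add smul tmul hx

theorem coeffIncl_eq (c : L) : coeffIncl d c = mk 1 c := rfl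

theorem coframe_eq (i : Fin d) : coframe d L i =
    mk (ExteriorAlgebra.ι ℝ (EuclideanSpace.proj i : Eu d →L[ℝ] ℝ).toLinearMap) 1 := rfl

theorem coeffMap_mk (φ : GAlg.Hom L L') (η : ExteriorAlgebra ℝ (Cov d)) (c : L) :
    coeffMap d φ (mk η c) = mk η (φ c) := rfl

theorem pullForm_mk (T : Eu d →L[ℝ] Eu e) (η : ExteriorAlgebra ℝ (Cov e)) (c : L) :
    pullForm L T (mk η c) = mk (ExteriorAlgebra.map (T : Eu d →ₗ[ℝ] Eu e).dualMap η) c := rfl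

theorem ι_mem (ξ : Cov d) : ExteriorAlgebra.ι ℝ ξ ∈ GAlg.extGr (Cov d) 1 := by
  change ExteriorAlgebra.ι ℝ ξ ∈ ⋀[ℝ]^1 (Cov d)
  rw [ExteriorAlgebra.exteriorPower, pow_one]
  exact ⟨ξ, rfl⟩

theorem map_mem (T : Eu d →L[ℝ] Eu e) {i : ℤ} {η : ExteriorAlgebra ℝ (Cov e)}
    (hη : η ∈ GAlg.extGr (Cov e) i) :
    ExteriorAlgebra.map (T : Eu d →ₗ[ℝ] Eu e).dualMap η ∈ GAlg.extGr (Cov d) i :=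
  (GAlg.extMap (T : Eu d →ₗ[ℝ] Eu e).dualMap).map_gr hη

theorem one_mem_ext : (1 : ExteriorAlgebra ℝ (Cov d)) ∈ GAlg.extGr (Cov d) 0 :=
  SetLike.GradedOne.one_mem (A := GAlg.extGr (Cov d))

theorem one_mem_gr (L : GAlg) : (1 : L) ∈ L.gr 0 := SetLike.GradedOne.one_mem (A := L.gr)

theorem coframe_mem (i : Fin d) : coframe d L i ∈ (FormAlg d L).gr 1 := by
  have := mk_mem (L := L) (ι_mem (EuclideanSpace.proj i : Eu d →L[ℝ] ℝ).toLinearMap)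
    (one_mem_gr L)
  rwa [add_zero] at this

theorem coeffIncl_mem {j : ℤ} {c : L} (hc : c ∈ L.gr j) :
    coeffIncl d c ∈ (FormAlg d L).gr j := by
  have := mk_mem (one_mem_ext (d := d)) hc
  rwa [zero_add] at this

theorem involute_apply {i : ℤ} {η : ExteriorAlgebra ℝ (Cov d)} (hη : η ∈ GAlg.extGr (Cov d) i) :
    CliffordAlgebra.involute (Q := (0 : QuadraticForm ℝ (Cov d))) η = i.negOnePow • η := by
  match i with
  | Int.negSucc _ => rw [show η = 0 from hη]; simp
  | Int.ofNat n =>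
    change η ∈ ⋀[ℝ]^n (Cov d) at hη
    induction hη using Submodule.pow_induction_on_left' with
    | algebraMap r => rw [AlgHom.commutes]; simp
    | add x y i hx hy h h' => rw [map_add, h, h', smul_add]
    | mem_mul m hm i x hx h =>
      obtain ⟨w, rfl⟩ := hm
      rw [map_mul, h]
      have : CliffordAlgebra.involute (Q := (0 : QuadraticForm ℝ (Cov d)))
        (ExteriorAlgebra.ι ℝ w) = -ExteriorAlgebra.ι ℝ w := CliffordAlgebra.involute_ι w
      rw [this, neg_mul, mul_smul_comm]
      simp only [Int.ofNat_eq_natCast]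
      push_cast
      rw [Int.negOnePow_succ, Units.neg_smul]

theorem involute_pow_apply {i : ℤ} {η : ExteriorAlgebra ℝ (Cov d)}
    (hη : η ∈ GAlg.extGr (Cov d) i) (n : ℕ) :
    ((CliffordAlgebra.involute (Q := (0 : QuadraticForm ℝ (Cov d)))).toLinearMap ^ n) η =
      (n * i).negOnePow • η := by
  induction n with
  | zero => simp
  | succ n ih =>
    rw [pow_succ', Module.End.mul_apply, ih, map_units_smul, AlgHom.toLinearMap_apply,
      involute_apply hη, smul_smul, ← Int.negOnePow_add]
    congr 2
    push_cast
    ring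

theorem coeffDer_mk (k : ℤ) (D : L →ₗ[ℝ] L') {i : ℤ} {η : ExteriorAlgebra ℝ (Cov d)}
    (hη : η ∈ GAlg.extGr (Cov d) i) (c : L) :
    coeffDer d k D (mk η c) = (k * i).negOnePow • mk η (D c) := by
  have h : coeffDer d k D (mk η c) = mk (((CliffordAlgebra.involute
    (Q := (0 : QuadraticForm ℝ (Cov d)))).toLinearMap ^ k.natAbs) η) (D c) := rfl
  rw [h, involute_pow_apply hη, mk_units_left]
  congr 1
  -- Only the parity of `k` enters the sign, so the exponent `k.natAbs` in the definition is correct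
  -- for negative `k` too.
  rcases Int.natAbs_eq k with h | h
  · rw [← h]
  · conv_rhs => rw [h]
    rw [neg_mul, Int.negOnePow_neg]

theorem coeffDer_mem {k : ℤ} {D : L →ₗ[ℝ] L'} (hD : ∀ {j : ℤ} {c : L}, c ∈ L.gr j → D c ∈ L'.gr (k + j))
    {p : ℤ} {x : FormAlg d L} (hx : x ∈ (FormAlg d L).gr p) :
    coeffDer d k D x ∈ (FormAlg d L').gr (k + p) := by
  induction hx using mem_induction with
  | zero => rw [map_zero]; exact Submodule.zero_mem _
  | add x y _ _ h h' => rw [map_add]; exact Submodule.add_mem _ h h'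
  | smul r x _ h => rw [map_smul]; exact Submodule.smul_mem _ _ h
  | tmul i j η c hij hη hc =>
    rw [coeffDer_mk k D hη, ← hij, add_left_comm]
    exact GAlg.units_smul_mem _ _ (mk_mem hη (hD hc))

/-- With the Koszul sign built in, moving a field in its parameters becomes a derivation of
form-valued parameters; this is what allows the hypotheses on the target to be applied to velocities
of fields. -/
theorem coeffDer_isDer {φ : GAlg.Hom L L'} {k : ℤ} {D : L →ₗ[ℝ] L'} (hD : IsDer φ k D) :
    IsDer (coeffMap d φ) k (coeffDer d k D) where
  map_add := map_add _
  map_smul := map_smul _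
  map_gr := coeffDer_mem hD.map_gr
  leibniz {p x} y hx := by
    induction hx using mem_induction with
    | zero => simp [map_zero, GAlg.Hom.map_zero]
    | add x x' _ _ h h' =>
      rw [add_mul, map_add, h, h', map_add, GAlg.Hom.map_add, add_mul, add_mul, smul_add]
      abel
    | smul r x _ h =>
      rw [smul_mul_assoc, map_smul, h, map_smul, GAlg.Hom.map_smul, smul_mul_assoc,
        smul_mul_assoc, smul_add, smul_comm r]
    | tmul i j η c hij hη hc =>
      -- For a fixed pure tensor as first factor both sides are linear in the second factor, so pure
      -- tensors suffice there as well.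
      have key : coeffDer d k D ∘ₗ LinearMap.mulLeft ℝ (mk η c) =
          LinearMap.mulLeft ℝ (coeffDer d k D (mk η c)) ∘ₗ
            (coeffMap d φ).toAlgHom.toLinearMap + (((k * p).negOnePow : ℤ) : ℝ) •
          (LinearMap.mulLeft ℝ (coeffMap d φ (mk η c)) ∘ₗ coeffDer d k D) := by
        refine lin_ext fun i' j' η' c' hη' hc' => ?_
        simp only [LinearMap.comp_apply, LinearMap.add_apply, LinearMap.smul_apply,
          LinearMap.mulLeft_apply, AlgHom.toLinearMap_apply, ← units_smul_eq_real]
        rw [mk_mul_mk η c' hc hη', map_units_smul,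
          coeffDer_mk k D (SetLike.GradedMul.mul_mem hη hη'), coeffDer_mk k D hη,
          coeffDer_mk k D hη', coeffMap_mk, coeffMap_mk, hD.leibniz c' hc, smul_mul_assoc,
          mul_smul_comm, mk_mul_mk η (φ c') (hD.map_gr hc) hη',
          mk_mul_mk η (D c') (φ.map_gr hc) hη']
        have hadd : ∀ x y : L', mk (η * η') (x + y) = mk (η * η') x + mk (η * η') y :=
          map_add (mkLin d L' (η * η'))
        rw [hadd, mk_units_right]
        simp only [smul_add, smul_smul, ← Int.negOnePow_add, ← hij]
        congr 2
        · congr 1; ring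
        · congr 1; ring
      have := LinearMap.congr_fun key y
      simpa only [LinearMap.comp_apply, LinearMap.add_apply, LinearMap.smul_apply,
          LinearMap.mulLeft_apply, AlgHom.toLinearMap_apply, ← units_smul_eq_real] using this

theorem pullForm_coeffMap (φ : GAlg.Hom L L') (T : Eu d →L[ℝ] Eu e) (x : FormAlg e L) :
    pullForm L' T (coeffMap e φ x) = coeffMap d φ (pullForm L T x) :=
  LinearMap.congr_fun (lin_ext
    (f := (pullForm L' T).toAlgHom.toLinearMap ∘ₗ (coeffMap e φ).toAlgHom.toLinearMap)
    (g := (coeffMap d φ).toAlgHom.toLinearMap ∘ₗ (pullForm L T).toAlgHom.toLinearMap)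
    fun _ _ _ _ _ _ => rfl) x

theorem pullForm_coeffDer (k : ℤ) (D : L →ₗ[ℝ] L') (T : Eu d →L[ℝ] Eu e) (x : FormAlg e L) :
    pullForm L' T (coeffDer e k D x) = coeffDer d k D (pullForm L T x) :=
  LinearMap.congr_fun (lin_ext
    (f := (pullForm L' T).toAlgHom.toLinearMap ∘ₗ coeffDer e k D)
    (g := coeffDer d k D ∘ₗ (pullForm L T).toAlgHom.toLinearMap)
    fun i j η c hη hc => by
      simp only [LinearMap.comp_apply, AlgHom.toLinearMap_apply]
      rw [coeffDer_mk k D hη, GAlg.Hom.map_units, pullForm_mk, pullForm_mk,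
        coeffDer_mk k D (map_mem T hη)]) x

theorem pullForm_comp {f : ℕ} (T : Eu e →L[ℝ] Eu f) (S : Eu d →L[ℝ] Eu e) (x : FormAlg f L) :
    pullForm L (T.comp S) x = pullForm L S (pullForm L T x) :=
  LinearMap.congr_fun (lin_ext
    (f := (pullForm L (T.comp S)).toAlgHom.toLinearMap)
    (g := (pullForm L S).toAlgHom.toLinearMap ∘ₗ (pullForm L T).toAlgHom.toLinearMap)
    fun i j η c _ _ => by
      simp only [LinearMap.comp_apply, AlgHom.toLinearMap_apply, pullForm_mk]
      congr 1
      exact (AlgHom.congr_fun (ExteriorAlgebra.map_comp_map (T : Eu e →ₗ[ℝ] Eu f).dualMap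
        (S : Eu d →ₗ[ℝ] Eu e).dualMap) η).symm) x

theorem pullForm_id (x : FormAlg d L) : pullForm L (ContinuousLinearMap.id ℝ (Eu d)) x = x :=
  LinearMap.congr_fun (lin_ext
    (f := (pullForm L (ContinuousLinearMap.id ℝ (Eu d))).toAlgHom.toLinearMap)
    (g := LinearMap.id)
    fun i j η c _ _ => by
      simp only [AlgHom.toLinearMap_apply, pullForm_mk, LinearMap.id_apply]
      congr 1
      exact AlgHom.congr_fun (ExteriorAlgebra.map_id (R := ℝ) (M := Cov d)) η) x

theorem coeffDer_comp (k l : ℤ) (D : L' →ₗ[ℝ] L'') (E : L →ₗ[ℝ] L') (x : FormAlg d L) :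
    coeffDer d k D (coeffDer d l E x) = coeffDer d (k + l) (D ∘ₗ E) x :=
  LinearMap.congr_fun (lin_ext (f := coeffDer d k D ∘ₗ coeffDer d l E)
    (g := coeffDer d (k + l) (D ∘ₗ E)) fun i j η c hη hc => by
      rw [LinearMap.comp_apply, coeffDer_mk _ _ hη, map_units_smul, coeffDer_mk _ _ hη,
        coeffDer_mk _ _ hη, smul_smul, ← Int.negOnePow_add, add_mul, add_comm (l * i)]
      rfl) x

theorem coeffDer_sub (k : ℤ) (D E : L →ₗ[ℝ] L') (x : FormAlg d L) :
    coeffDer d k (D - E) x = coeffDer d k D x - coeffDer d k E x :=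
  LinearMap.congr_fun (lin_ext (f := coeffDer d k (D - E)) (g := coeffDer d k D - coeffDer d k E)
    fun i j η c hη hc => by
      rw [LinearMap.sub_apply, coeffDer_mk _ _ hη, coeffDer_mk _ _ hη, coeffDer_mk _ _ hη,
        ← smul_sub]
      congr 1
      exact map_sub (mkLin d L' η) _ _) x

theorem coeffDer_units (k : ℤ) (u : ℤˣ) (D : L →ₗ[ℝ] L') (x : FormAlg d L) :
    coeffDer d k (u • D) x = u • coeffDer d k D x := by
  rcases Int.units_eq_one_or u with rfl | rfl
  · simp
  · have h := coeffDer_sub k 0 D x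
    have h0 : coeffDer d k (0 : L →ₗ[ℝ] L') x = 0 := by
      have := coeffDer_sub k D D x
      rwa [sub_self, sub_self] at this
    rw [h0, zero_sub, zero_sub] at h
    simp only [Units.neg_smul, one_smul]
    exact h

end FormAlg

end

noncomputable section

/-! ### The top coefficient -/

namespace FormAlg

variable {d : ℕ} {L L' : GAlg}

/-- The standard basis of the space of covectors. -/
abbrev covBasis (d : ℕ) : Module.Basis (Fin d) ℝ (Cov d) :=
  (EuclideanSpace.basisFun (Fin d) ℝ).toBasis.dualBasis

/-- The monomial basis of the exterior algebra of covectors. -/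
abbrev extBasis (d : ℕ) : Module.Basis (Finset (Fin d)) ℝ (ExteriorAlgebra ℝ (Cov d)) :=
  (covBasis d).ExteriorAlgebra

/-- The component along a monomial. -/
def comp (L : GAlg) (s : Finset (Fin d)) : FormAlg d L →ₗ[ℝ] L :=
  (TensorProduct.lid ℝ L).toLinearMap ∘ₗ
    TensorProduct.map ((extBasis d).coord s) LinearMap.id ∘ₗ
    (GradedTensorProduct.of ℝ (GAlg.ext (Cov d)).gr L.gr).symm.toLinearMap

theorem comp_mk (s : Finset (Fin d)) (η : ExteriorAlgebra ℝ (Cov d)) (c : L) :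
    comp L s (mk η c) = (extBasis d).coord s η • c := rfl

theorem topCoeff_mk (η : ExteriorAlgebra ℝ (Cov d)) (c : L) :
    topCoeff d L (mk η c) = (extBasis d).coord Finset.univ η • c := rfl

theorem sum_comp (x : FormAlg d L) : ∑ s, mk (extBasis d s) (comp L s x) = x := by
  have h : ∑ s, mkLin d L (extBasis d s) ∘ₗ comp L s = LinearMap.id := by
    refine lin_ext fun i j η c _ _ => ?_
    have h1 : ∀ s, (mkLin d L (extBasis d s) ∘ₗ comp L s) (mk η c) =
        (mkLin d L).flip c ((extBasis d).coord s η • extBasis d s) := by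
      intro s
      rw [LinearMap.comp_apply, comp_mk, map_smul, map_smul]
      rfl
    rw [LinearMap.sum_apply, Finset.sum_congr rfl fun s _ => h1 s, ← map_sum]
    have h2 : ∑ s, (extBasis d).coord s η • extBasis d s = η := (extBasis d).sum_repr η
    rw [h2]
    rfl
  have := LinearMap.congr_fun h x
  rw [LinearMap.sum_apply] at this
  exact this

theorem eq_zero_of_comp {x : FormAlg d L} (h : ∀ s, comp L s x = 0) : x = 0 := by
  rw [← sum_comp x]
  refine Finset.sum_eq_zero fun s _ => ?_
  rw [h s]
  exact map_zero (mkLin d L (extBasis d s))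

theorem extBasis_mem (s : Finset (Fin d)) : extBasis d s ∈ GAlg.extGr (Cov d) s.card := by
  change extBasis d s ∈ ⋀[ℝ]^s.card (Cov d)
  rw [ExteriorAlgebra.basis_apply_ofCard (covBasis d) (rfl : s.card = s.card)]
  exact ExteriorAlgebra.ιMulti_range ℝ _ ⟨_, rfl⟩

theorem coord_of_mem {n : ℕ} {η : ExteriorAlgebra ℝ (Cov d)} (hη : η ∈ ⋀[ℝ]^n (Cov d))
    {s : Finset (Fin d)} (hs : s.card ≠ n) : (extBasis d).coord s η = 0 := by
  have h : (extBasis d).coord s ∘ₗ (⋀[ℝ]^n (Cov d)).subtype = 0 := by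
    refine ((covBasis d).exteriorPower n).ext fun t => ?_
    have ht := ExteriorAlgebra.basis_eq_coe_basis (covBasis d) t
    rw [LinearMap.comp_apply, Submodule.subtype_apply, ← ht]
    have hne : (t : Finset (Fin d)) ≠ s := by
      rintro rfl
      exact hs t.2
    simp [Finsupp.single_apply, hne]
  exact LinearMap.congr_fun h ⟨η, hη⟩

theorem coord_of_mem_extGr {i : ℤ} {η : ExteriorAlgebra ℝ (Cov d)}
    (hη : η ∈ GAlg.extGr (Cov d) i) {s : Finset (Fin d)} (hs : (s.card : ℤ) ≠ i) :
    (extBasis d).coord s η = 0 := by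
  match i with
  | Int.negSucc _ => rw [show η = 0 from hη, map_zero]
  | Int.ofNat n => exact coord_of_mem (n := n) hη (fun h => hs (by simp [h]))

theorem comp_mem {p : ℤ} {x : FormAlg d L} (hx : x ∈ (FormAlg d L).gr p) (s : Finset (Fin d)) :
    comp L s x ∈ L.gr (p - s.card) := by
  induction hx using mem_induction with
  | zero => rw [map_zero]; exact Submodule.zero_mem _
  | add x y _ _ h h' => rw [map_add]; exact Submodule.add_mem _ h h'
  | smul r x _ h => rw [map_smul]; exact Submodule.smul_mem _ _ h
  | tmul i j η c hij hη hc =>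
    rw [comp_mk]
    by_cases hs : (s.card : ℤ) = i
    · rw [hs, show p - i = j by linarith]
      exact Submodule.smul_mem _ _ hc
    · rw [coord_of_mem_extGr hη hs, zero_smul]
      exact Submodule.zero_mem _

theorem topCoeff_mem {p : ℤ} {x : FormAlg d L} (hx : x ∈ (FormAlg d L).gr p) :
    topCoeff d L x ∈ L.gr (p - d) := by
  have := comp_mem hx (Finset.univ : Finset (Fin d))
  rwa [Finset.card_univ, Fintype.card_fin] at this

theorem topCoeff_coeffMap (φ : GAlg.Hom L L') (x : FormAlg d L) :
    topCoeff d L' (coeffMap d φ x) = φ (topCoeff d L x) :=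
  LinearMap.congr_fun (lin_ext (f := topCoeff d L' ∘ₗ (coeffMap d φ).toAlgHom.toLinearMap)
    (g := φ.toAlgHom.toLinearMap ∘ₗ topCoeff d L) fun i j η c _ _ => by
      simp only [LinearMap.comp_apply, AlgHom.toLinearMap_apply, coeffMap_mk, topCoeff_mk,
        map_smul]) x

/-- The top coordinate vanishes unless the de Rham degree is `d`, so that degree may be replaced by
`d` in signs. All the signs `(-1)^{kd}` of integration come from here. -/
theorem coord_univ_smul {i : ℤ} {η : ExteriorAlgebra ℝ (Cov d)} (hη : η ∈ GAlg.extGr (Cov d) i)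
    (k : ℤ) (c : L) : (k * i).negOnePow • ((extBasis d).coord Finset.univ η • c) =
      (k * d).negOnePow • ((extBasis d).coord Finset.univ η • c) := by
  by_cases h : (d : ℤ) = i
  · rw [h]
  · rw [coord_of_mem_extGr hη (by simpa using h), zero_smul, smul_zero, smul_zero]

theorem topCoeff_coeffDer (k : ℤ) (D : L →ₗ[ℝ] L') (x : FormAlg d L) :
    topCoeff d L' (coeffDer d k D x) = (k * d).negOnePow • D (topCoeff d L x) := by
  rw [units_smul_eq_real]
  refine LinearMap.congr_fun (lin_ext (f := topCoeff d L' ∘ₗ coeffDer d k D)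
    (g := (((k * d).negOnePow : ℤ) : ℝ) • (D ∘ₗ topCoeff d L)) fun i j η c hη _ => ?_) x
  rw [LinearMap.smul_apply, ← units_smul_eq_real, LinearMap.comp_apply, LinearMap.comp_apply,
    coeffDer_mk k D hη, map_units_smul, topCoeff_mk, topCoeff_mk, map_smul, coord_univ_smul hη]

theorem topCoeff_coeffIncl {j : ℤ} {c : L} (hc : c ∈ L.gr j) (x : FormAlg d L) :
    topCoeff d L (coeffIncl d c * x) = (j * d).negOnePow • (c * topCoeff d L x) := by
  rw [units_smul_eq_real]
  refine LinearMap.congr_fun (lin_ext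
    (f := topCoeff d L ∘ₗ LinearMap.mulLeft ℝ (coeffIncl d c))
    (g := (((j * d).negOnePow : ℤ) : ℝ) • (LinearMap.mulLeft ℝ c ∘ₗ topCoeff d L))
    fun i j' η c' hη _ => ?_) x
  rw [LinearMap.smul_apply, ← units_smul_eq_real, LinearMap.comp_apply, LinearMap.comp_apply,
    LinearMap.mulLeft_apply, LinearMap.mulLeft_apply, coeffIncl_eq, mk_mul_mk 1 c' hc hη, one_mul,
    map_units_smul, topCoeff_mk, topCoeff_mk, mul_smul_comm, coord_univ_smul hη]

/-- On products of `d` covectors the top coordinate is an alternating map, hence a multiple of the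
determinant in a basis, which scales by `det f`. In every other degree both sides vanish. -/
theorem coord_map (f : Cov d →ₗ[ℝ] Cov d) (η : ExteriorAlgebra ℝ (Cov d)) :
    (extBasis d).coord Finset.univ (ExteriorAlgebra.map f η) =
      LinearMap.det f * (extBasis d).coord Finset.univ η := by
  have h : (extBasis d).coord Finset.univ ∘ₗ (ExteriorAlgebra.map f).toLinearMap =
      LinearMap.det f • (extBasis d).coord Finset.univ := by
    refine DirectSum.decompose_lhom_ext (fun n : ℕ => ⋀[ℝ]^n (Cov d)) fun n => ?_
    refine LinearMap.ext fun ⟨x, hx⟩ => ?_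
    simp only [LinearMap.comp_apply, Submodule.subtype_apply, AlgHom.toLinearMap_apply,
      LinearMap.smul_apply, smul_eq_mul]
    by_cases hn : d = n
    · subst hn
      rw [← ExteriorAlgebra.ιMulti_span_fixedDegree] at hx
      induction hx using Submodule.span_induction with
      | zero => simp
      | add x y _ _ h h' => rw [map_add, map_add, h, h', map_add, mul_add]
      | smul r x _ h => rw [map_smul, map_smul, h, map_smul, smul_eq_mul, smul_eq_mul]; ring
      | mem x hx =>
        obtain ⟨v, rfl⟩ := hx
        let a : (Cov d) [⋀^Fin d]→ₗ[ℝ] ℝ :=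
          ((extBasis d).coord Finset.univ).compAlternatingMap (ExteriorAlgebra.ιMulti ℝ d)
        have ha := a.eq_smul_basis_det (covBasis d)
        have h1 : a (f ∘ v) = LinearMap.det f * a v := by
          rw [ha, AlternatingMap.smul_apply, AlternatingMap.smul_apply, Module.Basis.det_comp,
            smul_eq_mul, smul_eq_mul]
          ring
        rw [ExteriorAlgebra.map_apply_ιMulti]
        exact h1
    · have hc : (Finset.univ : Finset (Fin d)).card ≠ n := by simpa using hn
      rw [coord_of_mem hx hc, coord_of_mem (GAlg.ext_map_mem f n hx) hc, mul_zero]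
  exact LinearMap.congr_fun h η

theorem topCoeff_pullForm (T : Eu d →L[ℝ] Eu d) (x : FormAlg d L) :
    topCoeff d L (pullForm L T x) = LinearMap.det (T : Eu d →ₗ[ℝ] Eu d) • topCoeff d L x := by
  refine LinearMap.congr_fun (lin_ext
    (f := topCoeff d L ∘ₗ (pullForm L T).toAlgHom.toLinearMap)
    (g := LinearMap.det (T : Eu d →ₗ[ℝ] Eu d) • topCoeff d L) fun i j η c hη _ => ?_) x
  simp only [LinearMap.comp_apply, AlgHom.toLinearMap_apply, LinearMap.smul_apply, pullForm_mk,
    topCoeff_mk]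
  rw [coord_map, LinearMap.det_dualMap, mul_smul]

/-- The complementary monomial pairs only with the monomial of `s`: any other index set either meets
`sᶜ` or fails to complete it to the full set. -/
theorem coord_compl_mul (s : Finset (Fin d)) : ∃ u : ℤˣ, ∀ η : ExteriorAlgebra ℝ (Cov d),
    (extBasis d).coord Finset.univ (extBasis d sᶜ * η) = u • (extBasis d).coord s η := by
  have hd : Disjoint sᶜ s := disjoint_compl_left
  let s₁ : Set.powersetCard (Fin d) sᶜ.card := ⟨sᶜ, rfl⟩
  let t₁ (t : Finset (Fin d)) : Set.powersetCard (Fin d) t.card := ⟨t, rfl⟩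
  let u : ℤˣ := (Set.powersetCard.permOfDisjoint (s := s₁) (t := t₁ s) hd).sign
  refine ⟨u, fun η => ?_⟩
  rw [units_smul_eq_real]
  refine LinearMap.congr_fun (f := (extBasis d).coord Finset.univ ∘ₗ
    LinearMap.mulLeft ℝ (extBasis d sᶜ)) (g := ((u : ℤ) : ℝ) • (extBasis d).coord s)
    ((extBasis d).ext fun t => ?_) η
  rw [LinearMap.comp_apply, LinearMap.mulLeft_apply, LinearMap.smul_apply]
  by_cases ht : Disjoint sᶜ t
  · have h := ExteriorAlgebra.basis_mul_of_disjoint (covBasis d) s₁ (t₁ t) ht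
    have h' : (Set.powersetCard.disjUnion (s := s₁) (t := t₁ t) ht : Finset (Fin d)) =
      sᶜ.disjUnion t ht := rfl
    rw [h'] at h
    change (extBasis d).coord Finset.univ
      ((covBasis d).ExteriorAlgebra s₁ * (covBasis d).ExteriorAlgebra (t₁ t)) = _
    rw [h, map_units_smul]
    by_cases hts : t = s
    · subst hts
      rw [units_smul_eq_real]
      have : tᶜ.disjUnion t ht = Finset.univ := by
        rw [Finset.disjUnion_eq_union, Finset.union_comm]
        exact Finset.union_compl t
      rw [this]
      simp [u]
    · have hne : sᶜ.disjUnion t ht ≠ Finset.univ := by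
        intro hu
        apply hts
        rw [Finset.disjUnion_eq_union] at hu
        refine Finset.Subset.antisymm ?_ ?_
        · intro i hi
          by_contra h'
          exact Finset.disjoint_left.1 ht (Finset.mem_compl.2 h') hi
        · intro i hi
          have : i ∈ sᶜ ∪ t := hu ▸ Finset.mem_univ i
          rcases Finset.mem_union.1 this with h' | h'
          · exact absurd hi (Finset.mem_compl.1 h')
          · exact h'
      have h0 : (extBasis d).coord Finset.univ (extBasis d (sᶜ.disjUnion t ht)) = 0 := by
        rw [Module.Basis.coord_apply, Module.Basis.repr_self, Finsupp.single_apply, if_neg hne]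
      rw [h0]
      simp [Finsupp.single_apply, hts]
  · have h := ExteriorAlgebra.basis_mul_of_not_disjoint (covBasis d) s₁ (t₁ t) ht
    change (extBasis d).coord Finset.univ
      ((covBasis d).ExteriorAlgebra s₁ * (covBasis d).ExteriorAlgebra (t₁ t)) = _
    have hts : t ≠ s := by
      rintro rfl
      exact ht disjoint_compl_left
    rw [h]
    simp [Finsupp.single_apply, hts]

/-- The wedge pairing is perfect: a non-zero component along `s` is moved to top degree by the
monomial of `sᶜ`. Non-degeneracy of the BV form rests on this. -/
theorem exists_topCoeff_ne_zero {x : FormAlg d L} (hx : x ≠ 0) :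
    ∃ (j : ℤ) (η : FormAlg d L), η ∈ (FormAlg d L).gr j ∧ topCoeff d L (η * x) ≠ 0 := by
  obtain ⟨s, hs⟩ : ∃ s, comp L s x ≠ 0 := by
    by_contra! h
    exact hx (eq_zero_of_comp h)
  obtain ⟨u, hu⟩ := coord_compl_mul s
  refine ⟨_, mk (extBasis d sᶜ) 1, mk_mem (extBasis_mem _) (one_mem_gr L), ?_⟩
  have h : topCoeff d L ∘ₗ LinearMap.mulLeft ℝ (mk (extBasis d sᶜ) 1) =
      ((u : ℤ) : ℝ) • comp L s := by
    refine lin_ext fun i j η c hη _ => ?_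
    rw [LinearMap.comp_apply, LinearMap.mulLeft_apply, LinearMap.smul_apply,
      mk_mul_mk _ c (one_mem_gr L) hη, zero_mul, Int.negOnePow_zero, one_smul, one_mul,
      topCoeff_mk, hu, comp_mk, units_smul_eq_real, smul_eq_mul, mul_smul]
  have hx' := LinearMap.congr_fun h x
  rw [LinearMap.comp_apply, LinearMap.mulLeft_apply, LinearMap.smul_apply,
    ← units_smul_eq_real] at hx'
  rw [hx', Ne, units_smul_eq_zero]
  exact hs

end FormAlg

end

noncomputable section

/-! ### The de Rham differential in coordinates -/

namespace FormAlg

variable {d e : ℕ} {L L' : GAlg}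

/-- A covector, as a form of de Rham degree one. -/
def covForm (d : ℕ) (L : GAlg) : Cov d →ₗ[ℝ] FormAlg d L :=
  (mkLin d L).flip 1 ∘ₗ ExteriorAlgebra.ι ℝ

theorem covForm_eq (ξ : Cov d) : covForm d L ξ = mk (ExteriorAlgebra.ι ℝ ξ) 1 := rfl

theorem covForm_eq_sum (ξ : Cov d) :
    covForm d L ξ = ∑ i, ξ (EuclideanSpace.single i (1 : ℝ)) • coframe d L i := by
  have h : ξ = ∑ i, ξ (EuclideanSpace.single i (1 : ℝ)) •
      (EuclideanSpace.proj i : Eu d →L[ℝ] ℝ).toLinearMap := by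
    refine (EuclideanSpace.basisFun (Fin d) ℝ).toBasis.ext fun j => ?_
    simp [Finset.sum_apply, Pi.single_apply]
  conv_lhs => rw [h]
  rw [map_sum]
  refine Finset.sum_congr rfl fun i _ => ?_
  rw [map_smul]
  rfl

theorem covForm_mem (ξ : Cov d) : covForm d L ξ ∈ (FormAlg d L).gr 1 := by
  have := mk_mem (L := L) (ι_mem ξ) (one_mem_gr L)
  rwa [add_zero] at this

theorem pullForm_covForm (T : Eu d →L[ℝ] Eu e) (ξ : Cov e) :
    pullForm L T (covForm e L ξ) = covForm d L (ξ ∘ₗ (T : Eu d →ₗ[ℝ] Eu e)) := by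
  rw [covForm_eq, pullForm_mk, ExteriorAlgebra.map_apply_ι]
  rfl

theorem coframe_anticomm (i j : Fin d) :
    coframe d L i * coframe d L j = -(coframe d L j * coframe d L i) := by
  rw [(FormAlg d L).comm (coframe_mem i) (coframe_mem j)]
  simp

theorem coeffDer_coframe_mul {φ : GAlg.Hom L L'} {k : ℤ} {D : L →ₗ[ℝ] L'} (hD : IsDer φ k D)
    (i : Fin d) (x : FormAlg d L) :
    coeffDer d k D (coframe d L i * x) = k.negOnePow • (coframe d L' i * coeffDer d k D x) := by
  rw [(coeffDer_isDer hD).leibniz x (coframe_mem i), coframe_eq, coeffDer_mk k D (ι_mem _),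
    hD.map_one, mul_one, coeffMap_mk, φ.map_one]
  have : mk (ExteriorAlgebra.ι ℝ (EuclideanSpace.proj i : Eu d →L[ℝ] ℝ).toLinearMap) (0 : L') = 0 :=
    map_zero (mkLin d L' _)
  rw [this, smul_zero, zero_mul, zero_add]
  rfl

end FormAlg

open FormAlg

/-- A subspace is cut out by the functionals vanishing on it. Derivatives and integrals are
accessible only through functionals, and this is how they are seen to preserve degrees. -/
theorem mem_of_dual {V : Type} [AddCommGroup V] [Module ℝ V] {S : Submodule ℝ V} {x : V}
    (h : ∀ l : V →ₗ[ℝ] ℝ, (∀ y ∈ S, l y = 0) → l x = 0) : x ∈ S := by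
  by_contra hx
  obtain ⟨l, hl, hS⟩ := Submodule.exists_le_ker_of_notMem hx
  exact hl (h l fun y hy => hS hy)

section dAt

variable {d e : ℕ} {L L' : GAlg} [Module.Finite ℝ L] [Module.Finite ℝ L']

theorem vecDeriv_mem {m : ℕ} {V : Type} [AddCommGroup V] [Module ℝ V] [Module.Finite ℝ V]
    {S : Submodule ℝ V} {f : Eu m → V} {u : Eu m} (hf : VSmoothAt f u)
    (h : ∀ᶠ w in nhds u, f w ∈ S) (v : Eu m) : vecDeriv f u v ∈ S := by
  refine mem_of_dual fun l hl => ?_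
  rw [lin_vecDeriv hf.differentiableAt]
  have : (fun w => l (f w)) =ᶠ[nhds u] fun _ => 0 := h.mono fun w hw => hl _ hw
  rw [this.fderiv_eq]
  simp

/-- The exterior differential at `u` of a form on a coordinate space. -/
def dAt (F : Eu d → FormAlg d L) (u : Eu d) : FormAlg d L :=
  ∑ i, coframe d L i * vecDeriv F u (EuclideanSpace.single i (1 : ℝ))

variable {F G : Eu d → FormAlg d L} {u : Eu d}

theorem dAt_congr (h : F =ᶠ[nhds u] G) : dAt F u = dAt G u :=
  Finset.sum_congr rfl fun i _ => by rw [vecDeriv_congr h]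

theorem VSmoothAt.dAt (hF : VSmoothAt F u) : VSmoothAt (dAt F) u :=
  VSmoothAt.sum fun i _ => (VSmoothAt.const (coframe d L i)).mul (hF.vecDeriv _)

theorem dAt_add (hF : VSmoothAt F u) (hG : VSmoothAt G u) :
    dAt (fun w => F w + G w) u = dAt F u + dAt G u := by
  simp only [dAt, hF.vecDeriv_add hG, mul_add, Finset.sum_add_distrib]

theorem dAt_sum {ι : Type} {s : Finset ι} {F : ι → Eu d → FormAlg d L}
    (hF : ∀ i ∈ s, VSmoothAt (F i) u) :
    dAt (fun w => ∑ i ∈ s, F i w) u = ∑ i ∈ s, dAt (F i) u := by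
  simp only [dAt, VSmoothAt.vecDeriv_sum hF, Finset.mul_sum]
  exact Finset.sum_comm

theorem dAt_const (x : FormAlg d L) : dAt (fun _ => x) u = 0 := by
  refine Finset.sum_eq_zero fun i _ => ?_
  have : vecDeriv (fun _ : Eu d => x) u (EuclideanSpace.single i (1 : ℝ)) = 0 :=
    vec_ext fun l => by
      rw [lin_vecDeriv (VSmoothAt.const x).differentiableAt]
      simp
  rw [this, mul_zero]

theorem dAt_smul {c : Eu d → ℝ} (hc : ContDiffAt ℝ ∞ c u) (hF : VSmoothAt F u) :
    dAt (fun w => c w • F w) u =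
      covForm d L (fderiv ℝ c u : Eu d →ₗ[ℝ] ℝ) * F u + c u • dAt F u := by
  rw [covForm_eq_sum, Finset.sum_mul, dAt, dAt, Finset.smul_sum, ← Finset.sum_add_distrib]
  refine Finset.sum_congr rfl fun i _ => ?_
  rw [hF.vecDeriv_smul hc, mul_add, mul_smul_comm, mul_smul_comm, smul_mul_assoc]
  rfl

theorem dAt_const_smul (c : ℝ) (hF : VSmoothAt F u) : dAt (fun w => c • F w) u = c • dAt F u := by
  rw [dAt_smul contDiffAt_const hF]
  simp

theorem dAt_mul {i : ℤ} (hF : VSmoothAt F u) (hG : VSmoothAt G u)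
    (hi : F u ∈ (FormAlg d L).gr i) :
    dAt (fun w => F w * G w) u = dAt F u * G u + i.negOnePow • (F u * dAt G u) := by
  rw [dAt, dAt, dAt, Finset.sum_mul, Finset.mul_sum, Finset.smul_sum, ← Finset.sum_add_distrib]
  refine Finset.sum_congr rfl fun j _ => ?_
  rw [hF.vecDeriv_mul hG, mul_add, mul_assoc, ← mul_assoc _ (F u),
    (FormAlg d L).comm (coframe_mem j) hi, one_mul, smul_mul_assoc, mul_assoc]

theorem dAt_mem {k : ℤ} (hF : VSmoothAt F u) (h : ∀ᶠ w in nhds u, F w ∈ (FormAlg d L).gr k) :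
    dAt F u ∈ (FormAlg d L).gr (1 + k) :=
  Submodule.sum_mem _ fun i _ => SetLike.GradedMul.mul_mem (coframe_mem i) (vecDeriv_mem hF h _)

theorem dAt_coeffMap (φ : GAlg.Hom L L') (hF : VSmoothAt F u) :
    dAt (fun w => coeffMap d φ (F w)) u = coeffMap d φ (dAt F u) := by
  have h : coeffMap d φ (dAt F u) = (coeffMap d φ).toAlgHom.toLinearMap (dAt F u) := rfl
  rw [h, dAt, dAt, map_sum]
  refine Finset.sum_congr rfl fun i _ => ?_
  have h' := hF.vecDeriv_lin (coeffMap d φ).toAlgHom.toLinearMap (EuclideanSpace.single i (1 : ℝ))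
  simp only [AlgHom.toLinearMap_apply] at h' ⊢
  rw [h', GAlg.Hom.map_mul, coframe_eq (L := L), coeffMap_mk, φ.map_one]
  rfl

/-- `D` kills the coframe and acts on coefficients only, so it commutes with `d` up to the sign of
passing each `du^i`. -/
theorem dAt_coeffDer {φ : GAlg.Hom L L'} {k : ℤ} {D : L →ₗ[ℝ] L'} (hD : IsDer φ k D)
    (hF : VSmoothAt F u) :
    dAt (fun w => coeffDer d k D (F w)) u = k.negOnePow • coeffDer d k D (dAt F u) := by
  rw [dAt, dAt, map_sum, Finset.smul_sum]
  refine Finset.sum_congr rfl fun i _ => ?_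
  rw [hF.vecDeriv_lin, coeffDer_coframe_mul hD, smul_smul, units_mul_self, one_smul]

/-- Second partial derivatives commute and the `du^i` anticommute, so the double sum is its own
negative. -/
theorem dAt_dAt (hF : VSmoothAt F u) : dAt (dAt F) u = 0 := by
  have h : ∀ i j : Fin d, vecDeriv (fun w => coframe d L j *
      vecDeriv F w (EuclideanSpace.single j (1 : ℝ))) u (EuclideanSpace.single i (1 : ℝ)) =
      coframe d L j * vecDeriv (fun w => vecDeriv F w (EuclideanSpace.single j (1 : ℝ))) u
        (EuclideanSpace.single i (1 : ℝ)) := fun i j =>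
    (hF.vecDeriv _).vecDeriv_lin (LinearMap.mulLeft ℝ (coframe d L j)) _
  let a : Fin d → Fin d → FormAlg d L := fun i j => coframe d L i * (coframe d L j *
    vecDeriv (fun w => vecDeriv F w (EuclideanSpace.single j (1 : ℝ))) u
        (EuclideanSpace.single i (1 : ℝ)))
  have ha : ∀ i j, a i j = -a j i := by
    intro i j
    simp only [a]
    rw [hF.vecDeriv_comm, ← mul_assoc, coframe_anticomm, neg_mul, mul_assoc]
  have h1 : dAt (dAt F) u = ∑ i, ∑ j, a i j := by
    rw [dAt]
    refine Finset.sum_congr rfl fun i _ => ?_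
    have : vecDeriv (dAt F) u (EuclideanSpace.single i (1 : ℝ)) = _ :=
      VSmoothAt.vecDeriv_sum (fun j _ => (VSmoothAt.const (coframe d L j)).mul (hF.vecDeriv _)) _
    rw [this, Finset.mul_sum]
    exact Finset.sum_congr rfl fun j _ => by rw [h]
  have h2 : ∑ i, ∑ j, a i j = -∑ i, ∑ j, a i j := by
    conv_lhs => rw [Finset.sum_comm]
    rw [← Finset.sum_neg_distrib]
    refine Finset.sum_congr rfl fun i _ => ?_
    rw [← Finset.sum_neg_distrib]
    exact Finset.sum_congr rfl fun j _ => ha j i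
  have h3 : (2 : ℝ) • ∑ i, ∑ j, a i j = 0 := by
    rw [two_smul]
    nth_rewrite 1 [h2]
    exact neg_add_cancel _
  rw [h1]
  exact (smul_eq_zero.1 h3).resolve_left two_ne_zero

end dAt

/-! ### Naturality of the exterior differential under smooth maps -/

section pull

variable {d e : ℕ} {L : GAlg} [Module.Finite ℝ L]

theorem covForm_fderiv {c : Eu d → ℝ} {u : Eu d} (hc : DifferentiableAt ℝ c u) :
    covForm d L (fderiv ℝ c u : Eu d →ₗ[ℝ] ℝ) = dAt (fun w => c w • (1 : FormAlg d L)) u := by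
  rw [covForm_eq_sum, dAt]
  refine Finset.sum_congr rfl fun i _ => ?_
  have h : vecDeriv (fun w => c w • (1 : FormAlg d L)) u (EuclideanSpace.single i (1 : ℝ)) =
      fderiv ℝ c u (EuclideanSpace.single i (1 : ℝ)) • (1 : FormAlg d L) := by
    refine vec_ext fun l => ?_
    have hl : ∀ l : FormAlg d L →ₗ[ℝ] ℝ, (fun w => l (c w • (1 : FormAlg d L))) =
        fun w => c w * l 1 := fun l => funext fun w => by rw [map_smul, smul_eq_mul]
    rw [lin_vecDeriv fun l => by rw [hl]; exact hc.mul_const _, hl, fderiv_mul_const hc, map_smul]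
    simp [mul_comm]
  rw [h, mul_smul_comm, mul_one]
  rfl

/-- Pull-back is polynomial in the linear map; the induction splits off one covector at a time, on
which it is linear. -/
theorem vSmoothAt_pullForm_const {m : ℕ} {T : Eu m → Eu d →L[ℝ] Eu e} {u : Eu m}
    (hT : VSmoothAt T u) (x : FormAlg e L) : VSmoothAt (fun w => pullForm L (T w) x) u := by
  have key : ∀ (n : ℕ) (η : ExteriorAlgebra ℝ (Cov e)) (c : L), η ∈ ⋀[ℝ]^n (Cov e) →
      VSmoothAt (fun w => pullForm L (T w) (mk η c)) u := by
    intro n η c hη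
    induction hη using Submodule.pow_induction_on_left' with
    | algebraMap r =>
      have : (fun w => pullForm L (T w) (mk (algebraMap ℝ _ r) c)) =
          fun _ => FormAlg.mk (algebraMap ℝ _ r) c := by
        funext w
        rw [pullForm_mk, AlgHom.commutes]
      rw [this]
      exact VSmoothAt.const _
    | add x y i hx hy h h' =>
      have : (fun w => pullForm L (T w) (mk (x + y) c)) =
          fun w => pullForm L (T w) (mk x c) + pullForm L (T w) (mk y c) := by
        funext w
        rw [← GAlg.Hom.map_add]
        exact congrArg _ (map_add ((mkLin e L).flip c) x y)
      rw [this]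
      exact h.add h'
    | mem_mul ξ hξ i x hx h =>
      obtain ⟨ξ, rfl⟩ := hξ
      have h1 : mk (ExteriorAlgebra.ι ℝ ξ * x) c = covForm e L ξ * mk x c := by
        have hx' : x ∈ GAlg.extGr (Cov e) i := hx
        rw [covForm_eq, mk_mul_mk _ c (one_mem_gr L) hx', zero_mul, Int.negOnePow_zero, one_smul,
          one_mul]
      have h2 : ∀ w, pullForm L (T w) (mk (ExteriorAlgebra.ι ℝ ξ * x) c) =
          covForm d L (ξ ∘ₗ (T w : Eu d →ₗ[ℝ] Eu e)) * pullForm L (T w) (mk x c) := fun w => by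
        rw [h1, GAlg.Hom.map_mul, pullForm_covForm]
      simp only [h2]
      let B : (Eu d →L[ℝ] Eu e) →ₗ[ℝ] FormAlg d L :=
        covForm d L ∘ₗ (LinearMap.compRight ℝ ξ : (Eu d →ₗ[ℝ] Eu e) →ₗ[ℝ] Eu d →ₗ[ℝ] ℝ) ∘ₗ
          ContinuousLinearMap.coeLM ℝ
      exact (hT.lin B).mul h
  have hx : x = ∑ s, mk (extBasis e s) (FormAlg.comp L s x) := (sum_comp x).symm
  have h : (fun w => pullForm L (T w) x) =
      fun w => ∑ s, pullForm L (T w) (mk (extBasis e s) (FormAlg.comp L s x)) := by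
    funext w
    conv_lhs => rw [hx]
    exact map_sum (pullForm L (T w)).toAlgHom _ _
  rw [h]
  exact VSmoothAt.sum fun s _ => key s.card _ _ (extBasis_mem s)

theorem pullForm_eq_sum {ι : Type} [Fintype ι] (b : Module.Basis ι ℝ (FormAlg e L))
    (T : Eu d →L[ℝ] Eu e) (x : FormAlg e L) :
    pullForm L T x = ∑ j, b.coord j x • pullForm L T (b j) :=
  lin_eq_sum b (pullForm L T).toAlgHom.toLinearMap x

theorem vSmoothAt_pullForm {m : ℕ} {T : Eu m → Eu d →L[ℝ] Eu e} {u : Eu m} (hT : VSmoothAt T u)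
    {F : Eu m → FormAlg e L} (hF : VSmoothAt F u) :
    VSmoothAt (fun w => pullForm L (T w) (F w)) u := by
  let b := Module.finBasis ℝ (FormAlg e L)
  simp only [pullForm_eq_sum b _ (F _)]
  exact VSmoothAt.sum fun j _ => (vSmoothAt_pullForm_const hT (b j)).smul (hF (b.coord j))

theorem vSmoothAt_fderiv {g : Eu d → Eu e} {u : Eu d} (hg : ContDiffAt ℝ ∞ g u) :
    VSmoothAt (fderiv ℝ g) u :=
  vSmoothAt_of_contDiffAt (hg.fderiv_right (m := ∞) (by simp))

/-- A constant covector `ξ` pulls back to `d(ξ ∘ g)`, which is closed by `dAt_dAt`, and products of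
closed forms are closed. -/
theorem dAt_pullForm_const {g : Eu d → Eu e} {u : Eu d} (hg : ContDiffAt ℝ ∞ g u)
    (x : FormAlg e L) : dAt (fun w => pullForm L (fderiv ℝ g w) x) u = 0 := by
  have hT := vSmoothAt_fderiv hg
  have key : ∀ (n : ℕ) (η : ExteriorAlgebra ℝ (Cov e)) (c : L), η ∈ ⋀[ℝ]^n (Cov e) →
      dAt (fun w => pullForm L (fderiv ℝ g w) (mk η c)) u = 0 := by
    intro n η c hη
    induction hη using Submodule.pow_induction_on_left' with
    | algebraMap r =>
      have : (fun w => pullForm L (fderiv ℝ g w) (mk (algebraMap ℝ _ r) c)) =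
          fun _ => FormAlg.mk (algebraMap ℝ _ r) c := by
        funext w
        rw [pullForm_mk, AlgHom.commutes]
      rw [this]
      exact dAt_const _
    | add x y i hx hy h h' =>
      have : (fun w => pullForm L (fderiv ℝ g w) (mk (x + y) c)) =
          fun w => pullForm L (fderiv ℝ g w) (mk x c) + pullForm L (fderiv ℝ g w) (mk y c) := by
        funext w
        rw [← GAlg.Hom.map_add]
        exact congrArg _ (map_add ((mkLin e L).flip c) x y)
      rw [this, dAt_add (vSmoothAt_pullForm_const hT _) (vSmoothAt_pullForm_const hT _), h, h',
        add_zero]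
    | mem_mul ξ hξ i x hx h =>
      obtain ⟨ξ, rfl⟩ := hξ
      have h1 : mk (ExteriorAlgebra.ι ℝ ξ * x) c = covForm e L ξ * mk x c := by
        have hx' : x ∈ GAlg.extGr (Cov e) i := hx
        rw [covForm_eq, mk_mul_mk _ c (one_mem_gr L) hx', zero_mul, Int.negOnePow_zero, one_smul,
          one_mul]
      have h2 : ∀ w, pullForm L (fderiv ℝ g w) (mk (ExteriorAlgebra.ι ℝ ξ * x) c) =
          pullForm L (fderiv ℝ g w) (covForm e L ξ) * pullForm L (fderiv ℝ g w) (mk x c) :=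
        fun w => by rw [h1, GAlg.Hom.map_mul]
      let ξ' : Eu e →L[ℝ] ℝ := LinearMap.toContinuousLinearMap ξ
      have hξ' : ContDiffAt ℝ ∞ (fun w => ξ' (g w)) u := ξ'.contDiff.contDiffAt.comp u hg
      have h3 : (fun w => pullForm L (fderiv ℝ g w) (covForm e L ξ)) =ᶠ[nhds u]
          dAt (fun w => ξ' (g w) • (1 : FormAlg d L)) := by
        filter_upwards [(hg.of_le (by simp : (1 : WithTop ℕ∞) ≤ ∞)).eventually (by simp),
          (hξ'.of_le (by simp : (1 : WithTop ℕ∞) ≤ ∞)).eventually (by simp)] with w hw hw'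
        rw [← covForm_fderiv (hw'.differentiableAt (by simp)), pullForm_covForm]
        congr 1
        have := (ξ'.hasFDerivAt.comp w (hw.differentiableAt (by simp)).hasFDerivAt).fderiv
        change _ = ((fderiv ℝ (ξ' ∘ g) w : Eu d →L[ℝ] ℝ) : Eu d →ₗ[ℝ] ℝ)
        rw [this]
        rfl
      have h4 : dAt (fun w => pullForm L (fderiv ℝ g w) (covForm e L ξ)) u = 0 := by
        rw [dAt_congr h3]
        exact dAt_dAt ((VSmoothAt.const 1).smul hξ')
      simp only [h2]
      rw [dAt_mul (vSmoothAt_pullForm_const hT _) (vSmoothAt_pullForm_const hT _)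
        ((pullForm L _).map_gr (covForm_mem ξ)), h, h4, zero_mul, mul_zero, smul_zero, add_zero]
  have hx : x = ∑ s, mk (extBasis e s) (FormAlg.comp L s x) := (sum_comp x).symm
  have h : (fun w => pullForm L (fderiv ℝ g w) x) =
      fun w => ∑ s, pullForm L (fderiv ℝ g w) (mk (extBasis e s) (FormAlg.comp L s x)) := by
    funext w
    conv_lhs => rw [hx]
    exact map_sum (pullForm L (fderiv ℝ g w)).toAlgHom _ _
  rw [h, dAt_sum fun s _ => vSmoothAt_pullForm_const hT _]
  exact Finset.sum_eq_zero fun s _ => key s.card _ _ (extBasis_mem s)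

/-- The exterior differential commutes with pull-backs. -/
theorem dAt_pullForm {g : Eu d → Eu e} {u : Eu d} (hg : ContDiffAt ℝ ∞ g u)
    {F : Eu e → FormAlg e L} (hF : VSmoothAt F (g u)) :
    dAt (fun w => pullForm L (fderiv ℝ g w) (F (g w))) u =
      pullForm L (fderiv ℝ g u) (dAt F (g u)) := by
  -- In a basis, `F` is a sum of scalar functions times constant forms. Pulled-back constant forms
  -- are closed, so what remains is the chain rule for the scalar coefficients.
  let b := Module.finBasis ℝ (FormAlg e L)
  have hT := vSmoothAt_fderiv hg
  have hc : ∀ j, ContDiffAt ℝ ∞ (fun w => b.coord j (F (g w))) u := fun j => (hF.comp hg) (b.coord j)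
  have h1 : (fun w => pullForm L (fderiv ℝ g w) (F (g w))) =
      fun w => ∑ j, b.coord j (F (g w)) • pullForm L (fderiv ℝ g w) (b j) :=
    funext fun w => pullForm_eq_sum b _ _
  have h2 : F = fun y => ∑ j, b.coord j (F y) • b j :=
    funext fun y => lin_eq_sum b LinearMap.id (F y)
  have h3 : dAt F (g u) = ∑ j, covForm e L
      (fderiv ℝ (fun y => b.coord j (F y)) (g u) : Eu e →ₗ[ℝ] ℝ) * b j := by
    conv_lhs => rw [h2]
    rw [dAt_sum fun j _ => (VSmoothAt.const (b j)).smul (hF (b.coord j))]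
    refine Finset.sum_congr rfl fun j _ => ?_
    rw [dAt_smul (hF (b.coord j)) (VSmoothAt.const (b j)), dAt_const, smul_zero, add_zero]
  rw [h1, h3, dAt_sum fun j _ => (vSmoothAt_pullForm_const hT (b j)).smul (hc j)]
  refine Eq.trans ?_ (map_sum (pullForm L (fderiv ℝ g u)).toAlgHom _ _).symm
  refine Finset.sum_congr rfl fun j _ => ?_
  rw [dAt_smul (hc j) (vSmoothAt_pullForm_const hT (b j)), dAt_pullForm_const hg, smul_zero,
    add_zero]
  refine Eq.trans ?_ (GAlg.Hom.map_mul (pullForm L (fderiv ℝ g u)) _ _).symm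
  rw [pullForm_covForm]
  congr 2
  have := fderiv_comp u (g := fun y => b.coord j (F y)) (f := g) (hF.differentiableAt _)
    (hg.differentiableAt (by simp))
  exact congrArg _ this

end pull

/-! ### The differential on smooth forms -/

namespace GAlg

variable {d : ℕ} {U : Opens (Eu d)} {L L' : GAlg} [Module.Finite ℝ L] [Module.Finite ℝ L']

/-- The exterior differential on smooth forms on `U`. -/
def dSmooth (f : smooth U (FormAlg d L)) : smooth U (FormAlg d L) :=
  smoothMk (dAt (fn f)) fun _ hu => (fn_smooth f hu).dAt

theorem ev_dSmooth (f : smooth U (FormAlg d L)) (u : U) : ev u (dSmooth f) = dAt (fn f) u := rfl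

/-- The forms on `U` are a parameter algebra of the target, so this makes `d` available as a
derivation in the chain rule and in Cartan's formula there. -/
theorem dSmooth_isDer : IsDer (Hom.id (smooth U (FormAlg d L))) 1 dSmooth where
  map_add f g := smooth_ext fun u => by
    rw [Hom.map_add, ev_dSmooth, ev_dSmooth, ev_dSmooth,
      ← dAt_add (fn_smooth f u.2) (fn_smooth g u.2)]
    refine dAt_congr (fn_eventuallyEq (fun w => ?_) u.2)
    rw [fn_eq f w.2, fn_eq g w.2, Hom.map_add]
  map_smul c f := smooth_ext fun u => by
    rw [Hom.map_smul, ev_dSmooth, ev_dSmooth, ← dAt_const_smul c (fn_smooth f u.2)]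
    refine dAt_congr (fn_eventuallyEq (fun w => ?_) u.2)
    rw [fn_eq f w.2, Hom.map_smul]
  map_gr {i f} hf u := dAt_mem (fn_smooth f u.2) (by
    filter_upwards [U.isOpen.mem_nhds u.2] with w hw
    rw [fn_eq f hw]
    exact smooth_mem.1 hf _)
  leibniz {i f} g hf := smooth_ext fun u => by
    rw [Hom.map_add, Hom.map_units, Hom.map_mul, Hom.map_mul, ev_dSmooth, ev_dSmooth, ev_dSmooth,
      one_mul]
    have h1 : fn (f * g) =ᶠ[nhds (u : Eu d)] fun w => fn f w * fn g w :=
      fn_eventuallyEq (fun w => by rw [fn_eq f w.2, fn_eq g w.2, Hom.map_mul]) u.2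
    rw [dAt_congr h1, dAt_mul (fn_smooth f u.2) (fn_smooth g u.2)
      (i := i) (by rw [fn_eq f u.2]; exact smooth_mem.1 hf _), fn_eq f u.2, fn_eq g u.2]
    rfl

theorem dSmooth_dSmooth (f : smooth U (FormAlg d L)) : dSmooth (dSmooth f) = 0 :=
  smooth_ext fun u => by
    rw [ev_dSmooth, Hom.map_zero, ← dAt_dAt (fn_smooth f u.2)]
    exact dAt_congr (fn_eventuallyEq (fun w => rfl) u.2)

theorem dSmooth_coeffMap (φ : Hom L L') (f : smooth U (FormAlg d L)) :
    dSmooth (smoothMap U (coeffMap d φ) f) = smoothMap U (coeffMap d φ) (dSmooth f) :=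
  smooth_ext fun u => by
    rw [ev_dSmooth]
    refine Eq.trans ?_ (dAt_coeffMap φ (fn_smooth f u.2))
    exact dAt_congr (fn_eventuallyEq (fun w => by rw [fn_eq f w.2]; rfl) u.2)

theorem dSmooth_coeffDer {φ : Hom L L'} {k : ℤ} {D : L →ₗ[ℝ] L'} (hD : IsDer φ k D)
    (f : smooth U (FormAlg d L)) :
    dSmooth (smoothApp U (coeffDer d k D) f) =
      k.negOnePow • smoothApp U (coeffDer d k D) (dSmooth f) :=
  smooth_ext fun u => by
    rw [ev_dSmooth, Hom.map_units]
    refine Eq.trans ?_ (dAt_coeffDer hD (fn_smooth f u.2))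
    exact dAt_congr (fn_eventuallyEq (fun w => by rw [fn_eq f w.2]; rfl) u.2)

end GAlg

end

noncomputable section

/-! ### Differential forms on manifolds -/

open FormAlg

section charts

variable {d e : ℕ} {X : ClosedOriented d} {S : ClosedOriented e}

instance : IsManifold 𝓘(ℝ, Eu d) 1 X := IsManifold.of_le (n := ∞) (by simp)

theorem contMDiffAt_chart {x₀ p : X} (hp : p ∈ (chartAt (Eu d) x₀).source) :
    ContMDiffAt 𝓘(ℝ, Eu d) 𝓘(ℝ, Eu d) ∞ (chartAt (Eu d) x₀) p :=
  contMDiffOn_chart.contMDiffAt ((chartAt (Eu d) x₀).open_source.mem_nhds hp)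

theorem contMDiffAt_chart_symm {x₀ : X} {u : Eu d} (hu : u ∈ (chartAt (Eu d) x₀).target) :
    ContMDiffAt 𝓘(ℝ, Eu d) 𝓘(ℝ, Eu d) ∞ (chartAt (Eu d) x₀).symm u :=
  contMDiffOn_chart_symm.contMDiffAt ((chartAt (Eu d) x₀).open_target.mem_nhds hu)

/-- The expression of a map in the charts at `x₀` and `y₀`. -/
def inCharts (i : X → S) (x₀ : X) (y₀ : S) (u : Eu d) : Eu e :=
  chartAt (Eu e) y₀ (i ((chartAt (Eu d) x₀).symm u))

variable {i : X → S} {x₀ : X} {y₀ : S} {u : Eu d}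

theorem contDiffAt_inCharts (hi : ContMDiff 𝓘(ℝ, Eu d) 𝓘(ℝ, Eu e) ∞ i)
    (hu : u ∈ (chartAt (Eu d) x₀).target)
    (hy : i ((chartAt (Eu d) x₀).symm u) ∈ (chartAt (Eu e) y₀).source) :
    ContDiffAt ℝ ∞ (inCharts i x₀ y₀) u :=
  ((contMDiffAt_chart hy).comp u ((hi _).comp u (contMDiffAt_chart_symm hu))).contDiffAt

/-- Chain rule for two factorisations of the same map near `u`: the map in charts followed by the
inverse chart at `y₀`, or the inverse chart at `x₀` followed by `i`. -/
theorem chartDeriv_inCharts (hi : ContMDiff 𝓘(ℝ, Eu d) 𝓘(ℝ, Eu e) ∞ i)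
    (hu : u ∈ (chartAt (Eu d) x₀).target)
    (hy : i ((chartAt (Eu d) x₀).symm u) ∈ (chartAt (Eu e) y₀).source) :
    (chartDeriv y₀ (inCharts i x₀ y₀ u)).comp (fderiv ℝ (inCharts i x₀ y₀) u) =
      (show Eu d →L[ℝ] Eu e from
        mfderiv 𝓘(ℝ, Eu d) 𝓘(ℝ, Eu e) i ((chartAt (Eu d) x₀).symm u)).comp (chartDeriv x₀ u) := by
  have hc := (contMDiffAt_chart_symm hu).continuousAt
  have hev : (chartAt (Eu e) y₀).symm ∘ inCharts i x₀ y₀ =ᶠ[nhds u]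
      i ∘ (chartAt (Eu d) x₀).symm := by
    have : ContinuousAt (i ∘ (chartAt (Eu d) x₀).symm) u := hi.continuous.continuousAt.comp hc
    filter_upwards [this.preimage_mem_nhds ((chartAt (Eu e) y₀).open_source.mem_nhds hy)] with w hw
    exact (chartAt (Eu e) y₀).left_inv hw
  have hmem : inCharts i x₀ y₀ u ∈ (chartAt (Eu e) y₀).target := (chartAt (Eu e) y₀).map_source hy
  have h1 := mfderiv_comp (I := 𝓘(ℝ, Eu d)) (I' := 𝓘(ℝ, Eu e)) (I'' := 𝓘(ℝ, Eu e)) u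
    ((contMDiffAt_chart_symm hmem).mdifferentiableAt (by simp))
    (((contDiffAt_inCharts hi hu hy).contMDiffAt).mdifferentiableAt (by simp))
  have h2 := mfderiv_comp (I := 𝓘(ℝ, Eu d)) (I' := 𝓘(ℝ, Eu d)) (I'' := 𝓘(ℝ, Eu e)) u
    ((hi _).mdifferentiableAt (by simp))
    ((contMDiffAt_chart_symm hu).mdifferentiableAt (by simp))
  have h3 := hev.mfderiv_eq (I := 𝓘(ℝ, Eu d)) (I' := 𝓘(ℝ, Eu e))
  rw [mfderiv_eq_fderiv] at h1
  exact h1.symm.trans (h3.trans h2)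

/-- The tangent space at `p` is identified with the model space through the preferred chart at `p`
itself, where the inverse chart reads as the identity near the centre. -/
theorem chartDeriv_self (p : X) :
    chartDeriv p (chartAt (Eu d) p p) = ContinuousLinearMap.id ℝ (Eu d) := by
  have hp := mem_chart_source (Eu d) p
  have ht := (chartAt (Eu d) p).map_source hp
  have hm : MDifferentiableAt 𝓘(ℝ, Eu d) 𝓘(ℝ, Eu d) (chartAt (Eu d) p).symm
      (chartAt (Eu d) p p) := (contMDiffAt_chart_symm ht).mdifferentiableAt (by simp)
  have hw : writtenInExtChartAt 𝓘(ℝ, Eu d) 𝓘(ℝ, Eu d) (chartAt (Eu d) p p)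
      (chartAt (Eu d) p).symm =ᶠ[nhds (chartAt (Eu d) p p)] id := by
    filter_upwards [(chartAt (Eu d) p).open_target.mem_nhds ht] with w hw
    simp only [writtenInExtChartAt, mfld_simps]
    exact (chartAt (Eu d) p).right_inv hw
  have h : HasMFDerivAt 𝓘(ℝ, Eu d) 𝓘(ℝ, Eu d) (chartAt (Eu d) p).symm (chartAt (Eu d) p p)
      (ContinuousLinearMap.id ℝ (Eu d)) :=
    ⟨hm.continuousAt, ((hasFDerivAt_id _).congr_of_eventuallyEq hw).hasFDerivWithinAt⟩
  exact h.mfderiv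

end charts

/-! ### Smoothness, pull-back and differential of forms -/

section forms

variable {d e : ℕ} {X : ClosedOriented d} {S : ClosedOriented e} {L L' : GAlg}

/-- Pull-back of forms along a map. -/
def pullMap (i : X → S) (F : S → FormAlg e L) (p : X) : FormAlg d L :=
  pullForm L (mfderiv 𝓘(ℝ, Eu d) 𝓘(ℝ, Eu e) i p) (F (i p))

theorem pullMap_id (F : X → FormAlg d L) : pullMap (X := X) (S := X) id F = F := by
  funext p
  rw [pullMap, mfderiv_id]
  exact pullForm_id _

theorem smoothForm_iff {F : X → FormAlg d L} : SmoothForm X F ↔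
    ∀ x₀ : X, ∀ u ∈ (chartAt (Eu d) x₀).target, VSmoothAt (rep X F x₀) u :=
  forall_congr' fun x₀ => vSmoothAt_iff_contDiffOn (chartAt (Eu d) x₀).open_target

theorem rep_self (F : X → FormAlg d L) (p : X) : rep X F p (chartAt (Eu d) p p) = F p := by
  rw [rep, chartDeriv_self, (chartAt (Eu d) p).left_inv (mem_chart_source _ p), pullForm_id]

theorem rep_pullMap {i : X → S} (hi : ContMDiff 𝓘(ℝ, Eu d) 𝓘(ℝ, Eu e) ∞ i)
    (F : S → FormAlg e L) {x₀ : X} {y₀ : S} {u : Eu d} (hu : u ∈ (chartAt (Eu d) x₀).target)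
    (hy : i ((chartAt (Eu d) x₀).symm u) ∈ (chartAt (Eu e) y₀).source) :
    rep X (pullMap i F) x₀ u =
      pullForm L (fderiv ℝ (inCharts i x₀ y₀) u) (rep S F y₀ (inCharts i x₀ y₀ u)) := by
  have h := chartDeriv_inCharts hi hu hy
  rw [rep, rep, pullMap, ← pullForm_comp, h, pullForm_comp]
  have : (chartAt (Eu e) y₀).symm (inCharts i x₀ y₀ u) = i ((chartAt (Eu d) x₀).symm u) :=
    (chartAt (Eu e) y₀).left_inv hy
  rw [this]

theorem rep_pullMap_eventuallyEq {i : X → S} (hi : ContMDiff 𝓘(ℝ, Eu d) 𝓘(ℝ, Eu e) ∞ i)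
    (F : S → FormAlg e L) {x₀ : X} {y₀ : S} {u : Eu d} (hu : u ∈ (chartAt (Eu d) x₀).target)
    (hy : i ((chartAt (Eu d) x₀).symm u) ∈ (chartAt (Eu e) y₀).source) :
    rep X (pullMap i F) x₀ =ᶠ[nhds u] fun w =>
      pullForm L (fderiv ℝ (inCharts i x₀ y₀) w) (rep S F y₀ (inCharts i x₀ y₀ w)) := by
  have hc := (contMDiffAt_chart_symm hu).continuousAt
  have : ContinuousAt (i ∘ (chartAt (Eu d) x₀).symm) u := hi.continuous.continuousAt.comp hc
  filter_upwards [this.preimage_mem_nhds ((chartAt (Eu e) y₀).open_source.mem_nhds hy),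
    (chartAt (Eu d) x₀).open_target.mem_nhds hu] with w hw hw'
  exact rep_pullMap hi F hw' hw

variable [Module.Finite ℝ L] [Module.Finite ℝ L']

theorem smoothForm_pullMap {i : X → S} (hi : ContMDiff 𝓘(ℝ, Eu d) 𝓘(ℝ, Eu e) ∞ i)
    {F : S → FormAlg e L} (hF : SmoothForm S F) : SmoothForm X (pullMap i F) := by
  rw [smoothForm_iff] at hF ⊢
  intro x₀ u hu
  let y₀ := i ((chartAt (Eu d) x₀).symm u)
  have hy : i ((chartAt (Eu d) x₀).symm u) ∈ (chartAt (Eu e) y₀).source := mem_chart_source _ _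
  have hg := contDiffAt_inCharts hi hu hy
  exact (vSmoothAt_pullForm (vSmoothAt_fderiv hg) ((hF y₀ _
    ((chartAt (Eu e) y₀).map_source hy)).comp hg)).congr (rep_pullMap_eventuallyEq hi F hu hy)

theorem dAt_rep_pullMap {i : X → S} (hi : ContMDiff 𝓘(ℝ, Eu d) 𝓘(ℝ, Eu e) ∞ i)
    {F : S → FormAlg e L} (hF : SmoothForm S F) {x₀ : X} {y₀ : S} {u : Eu d}
    (hu : u ∈ (chartAt (Eu d) x₀).target)
    (hy : i ((chartAt (Eu d) x₀).symm u) ∈ (chartAt (Eu e) y₀).source) :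
    dAt (rep X (pullMap i F) x₀) u = pullForm L (fderiv ℝ (inCharts i x₀ y₀) u)
      (dAt (rep S F y₀) (inCharts i x₀ y₀ u)) := by
  rw [dAt_congr (rep_pullMap_eventuallyEq hi F hu hy)]
  exact dAt_pullForm (contDiffAt_inCharts hi hu hy)
    (smoothForm_iff.1 hF y₀ _ ((chartAt (Eu e) y₀).map_source hy))

/-- `deRham` is defined at each point in that point's own chart. Naturality of the differential for
the identity map, read in two different charts, shows that every chart computes the same form. -/
theorem rep_deRham {F : X → FormAlg d L} (hF : SmoothForm X F) {x₀ : X} {u : Eu d}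
    (hu : u ∈ (chartAt (Eu d) x₀).target) : rep X (deRham X F) x₀ u = dAt (rep X F x₀) u := by
  let p := (chartAt (Eu d) x₀).symm u
  have hp : id p ∈ (chartAt (Eu d) p).source := mem_chart_source _ _
  have h := dAt_rep_pullMap (X := X) (S := X) contMDiff_id hF hu hp
  have h' := chartDeriv_inCharts (X := X) (S := X) contMDiff_id hu hp
  rw [mfderiv_id] at h'
  have h'' : chartDeriv p (inCharts (X := X) (S := X) id x₀ p u) = ContinuousLinearMap.id ℝ (Eu d) :=
    chartDeriv_self p
  rw [h'', ContinuousLinearMap.id_comp] at h'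
  rw [pullMap_id, h'] at h
  rw [h]
  rfl

theorem smoothForm_deRham {F : X → FormAlg d L} (hF : SmoothForm X F) :
    SmoothForm X (deRham X F) := by
  refine smoothForm_iff.2 fun x₀ u hu => (smoothForm_iff.1 hF x₀ u hu).dAt.congr ?_
  filter_upwards [(chartAt (Eu d) x₀).open_target.mem_nhds hu] with w hw
  exact rep_deRham hF hw

theorem deRham_eq_dAt (F : X → FormAlg d L) (p : X) :
    deRham X F p = dAt (rep X F p) (chartAt (Eu d) p p) := rfl

theorem chart_self_mem (p : X) : chartAt (Eu d) p p ∈ (chartAt (Eu d) p).target :=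
  (chartAt (Eu d) p).map_source (mem_chart_source _ p)

theorem deRham_pullMap {i : X → S} (hi : ContMDiff 𝓘(ℝ, Eu d) 𝓘(ℝ, Eu e) ∞ i)
    {F : S → FormAlg e L} (hF : SmoothForm S F) (p : X) :
    deRham X (pullMap i F) p = pullMap i (deRham S F) p := by
  have hs : (chartAt (Eu d) p).symm (chartAt (Eu d) p p) = p :=
    (chartAt (Eu d) p).left_inv (mem_chart_source _ p)
  have hp : i ((chartAt (Eu d) p).symm (chartAt (Eu d) p p)) ∈ (chartAt (Eu e) (i p)).source := by
    rw [hs]; exact mem_chart_source _ _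
  have h' := chartDeriv_inCharts (y₀ := i p) hi (chart_self_mem p) hp
  have hg : inCharts i p (i p) (chartAt (Eu d) p p) = chartAt (Eu e) (i p) (i p) := by
    rw [inCharts, hs]
  rw [hg, chartDeriv_self, chartDeriv_self, hs] at h'
  have h'' : fderiv ℝ (inCharts i p (i p)) (chartAt (Eu d) p p) =
    mfderiv 𝓘(ℝ, Eu d) 𝓘(ℝ, Eu e) i p := h'
  rw [deRham_eq_dAt, dAt_rep_pullMap hi hF (chart_self_mem p) hp, h'', hg]
  rfl

theorem deRham_deRham {F : X → FormAlg d L} (hF : SmoothForm X F) (p : X) :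
    deRham X (deRham X F) p = 0 := by
  rw [deRham_eq_dAt, ← dAt_dAt (smoothForm_iff.1 hF p _ (chart_self_mem p))]
  refine dAt_congr ?_
  filter_upwards [(chartAt (Eu d) p).open_target.mem_nhds (chart_self_mem p)] with w hw
  exact rep_deRham hF hw

theorem rep_lin (T : FormAlg d L →ₗ[ℝ] FormAlg d L')
    (hT : ∀ (A : Eu d →L[ℝ] Eu d) x, pullForm L' A (T x) = T (pullForm L A x))
    (F : X → FormAlg d L) (x₀ : X) (u : Eu d) :
    rep X (fun p => T (F p)) x₀ u = T (rep X F x₀ u) := hT _ _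

theorem rep_add (F G : X → FormAlg d L) (x₀ : X) (u : Eu d) :
    rep X (fun p => F p + G p) x₀ u = rep X F x₀ u + rep X G x₀ u := GAlg.Hom.map_add _ _ _

theorem SmoothForm.add {F G : X → FormAlg d L} (hF : SmoothForm X F) (hG : SmoothForm X G) :
    SmoothForm X fun p => F p + G p := by
  refine smoothForm_iff.2 fun x₀ u hu => ?_
  simpa only [← rep_add] using (smoothForm_iff.1 hF x₀ u hu).add (smoothForm_iff.1 hG x₀ u hu)

theorem SmoothForm.lin {F : X → FormAlg d L} (hF : SmoothForm X F)
    (T : FormAlg d L →ₗ[ℝ] FormAlg d L')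
    (hT : ∀ (A : Eu d →L[ℝ] Eu d) x, pullForm L' A (T x) = T (pullForm L A x)) :
    SmoothForm X fun p => T (F p) := by
  refine smoothForm_iff.2 fun x₀ u hu => ?_
  simpa only [← rep_lin T hT] using (smoothForm_iff.1 hF x₀ u hu).lin T

theorem SmoothForm.coeffDer {F : X → FormAlg d L} (hF : SmoothForm X F) (k : ℤ)
    (D : L →ₗ[ℝ] L') : SmoothForm X fun p => coeffDer d k D (F p) :=
  hF.lin (_root_.coeffDer d k D) (pullForm_coeffDer k D)

theorem SmoothForm.smul {F : X → FormAlg d L} (hF : SmoothForm X F) (c : ℝ) :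
    SmoothForm X fun p => c • F p :=
  smoothForm_iff.2 fun x₀ u hu => (VSmoothAt.smul (c := fun _ => c) contDiffAt_const
    (smoothForm_iff.1 hF x₀ u hu)).congr
      (Filter.Eventually.of_forall fun _ => GAlg.Hom.map_smul _ _ _)

theorem SmoothForm.units {F : X → FormAlg d L} (hF : SmoothForm X F) (u : ℤˣ) :
    SmoothForm X fun p => u • F p := by
  simpa only [units_smul_eq_real] using hF.smul _

theorem SmoothForm.zero : SmoothForm X fun _ => (0 : FormAlg d L) := by
  refine smoothForm_iff.2 fun x₀ u hu => (VSmoothAt.const 0).congr ?_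
  exact Filter.Eventually.of_forall fun w => GAlg.Hom.map_zero _

theorem pullForm_coeffIncl_mul (c : L) (A : Eu d →L[ℝ] Eu e) (x : FormAlg e L) :
    pullForm L A (coeffIncl e c * x) = coeffIncl d c * pullForm L A x := by
  rw [GAlg.Hom.map_mul, coeffIncl_eq, pullForm_mk, map_one]
  rfl

theorem deRham_add {F G : X → FormAlg d L} (hF : SmoothForm X F) (hG : SmoothForm X G) (p : X) :
    deRham X (fun q => F q + G q) p = deRham X F p + deRham X G p := by
  have h := dAt_add (smoothForm_iff.1 hF p _ (chart_self_mem p))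
    (smoothForm_iff.1 hG p _ (chart_self_mem p))
  simp only [← rep_add] at h
  exact h

theorem deRham_coeffMap {F : X → FormAlg d L} (hF : SmoothForm X F) (φ : GAlg.Hom L L') (p : X) :
    deRham X (fun q => coeffMap d φ (F q)) p = coeffMap d φ (deRham X F p) := by
  have h := dAt_coeffMap φ (smoothForm_iff.1 hF p _ (chart_self_mem p))
  simp only [← rep_coeffMap] at h
  exact h

theorem deRham_coeffDer {F : X → FormAlg d L} (hF : SmoothForm X F) {φ : GAlg.Hom L L'} {k : ℤ}
    {D : L →ₗ[ℝ] L'} (hD : IsDer φ k D) (p : X) :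
    deRham X (fun q => coeffDer d k D (F q)) p = k.negOnePow • coeffDer d k D (deRham X F p) := by
  have h := dAt_coeffDer hD (smoothForm_iff.1 hF p _ (chart_self_mem p))
  simp only [← rep_lin (X := X) (coeffDer d k D) (pullForm_coeffDer k D)] at h
  exact h

end forms

end

noncomputable section

/-! ### Integration of forms -/

open FormAlg MeasureTheory

theorem lin_vecIntegral {d : ℕ} {V : Type} [AddCommGroup V] [Module ℝ V] [Module.Finite ℝ V]
    {s : Set (Eu d)} {f : Eu d → V} (hf : ∀ l : V →ₗ[ℝ] ℝ, IntegrableOn (fun u => l (f u)) s)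
    (l : V →ₗ[ℝ] ℝ) : l (vecIntegral s f) = ∫ u in s, l (f u) := by
  let b := Module.Basis.ofVectorSpace ℝ V
  have : Fintype (Module.Basis.ofVectorSpaceIndex ℝ V) := FiniteDimensional.fintypeBasisIndex b
  have h : (fun u => l (f u)) = fun u => ∑ i, b.coord i (f u) * l (b i) :=
    funext fun u => lin_eq_sum b l (f u)
  rw [h, integral_finsetSum _ fun i _ => (hf (b.coord i)).mul_const _, vecIntegral,
    finsum_eq_sum_of_fintype, map_sum]
  refine Finset.sum_congr rfl fun i _ => ?_
  rw [map_smul, integral_mul_const]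
  rfl

theorem integrableOn_of_compact {d : ℕ} {U K : Set (Eu d)} (hU : IsOpen U) (hK : IsCompact K)
    (hKU : K ⊆ U) {f : Eu d → ℝ} (hf : ContinuousOn f U) (h0 : ∀ u ∈ U \ K, f u = 0) :
    IntegrableOn f U :=
  ((hf.mono hKU).integrableOn_compact hK).of_forall_diff_eq_zero hU.measurableSet h0

theorem VSmoothAt.continuousAt {m : ℕ} {V : Type} [AddCommGroup V] [Module ℝ V] {f : Eu m → V}
    {u : Eu m} (hf : VSmoothAt f u) (l : V →ₗ[ℝ] ℝ) : ContinuousAt (fun w => l (f w)) u :=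
  (hf l).continuousAt

section integration

variable {d : ℕ} {X : ClosedOriented d} {L L' : GAlg}

theorem chartSign_mem (sgn : X → ℤˣ) (x₀ : X) (u : Eu d) :
    chartSign sgn x₀ u ∈ ({-1, 0, 1} : Set ℝ) := by
  unfold chartSign
  rcases Int.units_eq_one_or (sgn ((chartAt (Eu d) x₀).symm u)) with h | h <;>
  rcases Real.sign_apply_eq (LinearMap.det (chartDeriv x₀ u : Eu d →ₗ[ℝ] Eu d)) with h' | h' | h' <;>
  simp [h, h']

/-- A continuous function with values in `{-1, 0, 1}` is locally constant: distinct values are at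
distance at least `1`. -/
theorem chartSign_eventually {x₀ : X} {u : Eu d} (hu : u ∈ (chartAt (Eu d) x₀).target) :
    chartSign X.sgn x₀ =ᶠ[nhds u] fun _ => chartSign X.sgn x₀ u := by
  have hc := (X.sgn_locally_constant x₀).continuousAt
    ((chartAt (Eu d) x₀).open_target.mem_nhds hu)
  have : Metric.ball (chartSign X.sgn x₀ u) 1 ∈ nhds (chartSign X.sgn x₀ u) :=
    Metric.ball_mem_nhds _ one_pos
  filter_upwards [hc.preimage_mem_nhds this] with w hw
  have h := Metric.mem_ball.1 hw
  rw [Real.dist_eq] at h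
  have h1 := chartSign_mem X.sgn x₀ u
  have h2 := chartSign_mem X.sgn x₀ w
  simp only [Set.mem_insert_iff, Set.mem_singleton_iff] at h1 h2
  rcases h1 with h1 | h1 | h1 <;> rcases h2 with h2 | h2 | h2 <;> rw [h1, h2] at h ⊢ <;>
    norm_num at h

/-- The integrand in the chart at `x₀`, weighted by a function and tested on a linear
functional. -/
def integrand (l : L →ₗ[ℝ] ℝ) (F : X → FormAlg d L) (c : X → ℝ) (x₀ : X) (u : Eu d) : ℝ :=
  c ((chartAt (Eu d) x₀).symm u) * chartSign X.sgn x₀ u * l (topCoeff d L (rep X F x₀ u))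

theorem rep_eq_zero {F : X → FormAlg d L} {x₀ : X} {u : Eu d}
    (h : F ((chartAt (Eu d) x₀).symm u) = 0) : rep X F x₀ u = 0 := by
  rw [rep, h, GAlg.Hom.map_zero]

theorem integrand_eq_zero {l : L →ₗ[ℝ] ℝ} {F : X → FormAlg d L} {c : X → ℝ} {x₀ : X} {u : Eu d}
    (h : c ((chartAt (Eu d) x₀).symm u) = 0 ∨ F ((chartAt (Eu d) x₀).symm u) = 0) :
    integrand l F c x₀ u = 0 := by
  rcases h with h | h
  · rw [integrand, h, zero_mul, zero_mul]
  · rw [integrand, rep_eq_zero h, map_zero, map_zero, mul_zero]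

theorem integrand_continuousOn (l : L →ₗ[ℝ] ℝ) {F : X → FormAlg d L} (hF : SmoothForm X F)
    {c : X → ℝ} (hc : Continuous c) (x₀ : X) :
    ContinuousOn (integrand l F c x₀) (chartAt (Eu d) x₀).target :=
  ((hc.comp_continuousOn (chartAt (Eu d) x₀).continuousOn_symm).mul
    (X.sgn_locally_constant x₀)).mul (hF x₀ (l ∘ₗ topCoeff d L)).continuousOn

theorem image_chart_compact {x₀ : X} {K : Set X} (hK : IsCompact K)
    (hKs : K ⊆ (chartAt (Eu d) x₀).source) : IsCompact (chartAt (Eu d) x₀ '' K) :=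
  hK.image_of_continuousOn ((chartAt (Eu d) x₀).continuousOn.mono hKs)

theorem image_chart_subset {x₀ : X} {K : Set X} (hKs : K ⊆ (chartAt (Eu d) x₀).source) :
    chartAt (Eu d) x₀ '' K ⊆ (chartAt (Eu d) x₀).target := by
  rintro _ ⟨p, hp, rfl⟩
  exact (chartAt (Eu d) x₀).map_source (hKs hp)

theorem symm_notMem {x₀ : X} {K : Set X} {u : Eu d} (hu : u ∈ (chartAt (Eu d) x₀).target)
    (h : u ∉ chartAt (Eu d) x₀ '' K) : (chartAt (Eu d) x₀).symm u ∉ K := fun h' =>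
  h ⟨_, h', (chartAt (Eu d) x₀).right_inv hu⟩

theorem integrand_integrableOn (l : L →ₗ[ℝ] ℝ) {F : X → FormAlg d L} (hF : SmoothForm X F)
    {c : X → ℝ} (hc : Continuous c) {x₀ : X} {K : Set X} (hK : IsCompact K)
    (hKs : K ⊆ (chartAt (Eu d) x₀).source) (h0 : ∀ p, p ∉ K → c p = 0 ∨ F p = 0) :
    IntegrableOn (integrand l F c x₀) (chartAt (Eu d) x₀).target :=
  integrableOn_of_compact (chartAt (Eu d) x₀).open_target (image_chart_compact hK hKs)
    (image_chart_subset hKs) (integrand_continuousOn l hF hc x₀)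
    fun _ hu => integrand_eq_zero (h0 _ (symm_notMem hu.1 hu.2))

theorem sign_mul_mul_self (a b : ℝ) : Real.sign (a * b) * b = |b| * Real.sign a := by
  rcases lt_trichotomy a 0 with ha | rfl | ha <;> rcases lt_trichotomy b 0 with hb | rfl | hb <;>
    simp [Real.sign_of_neg, Real.sign_of_pos, abs_of_neg, abs_of_pos, mul_pos_of_neg_of_neg,
      mul_neg_of_neg_of_pos, mul_neg_of_pos_of_neg, *]

/-- Signs of Jacobians multiply, and a determinant times its sign is its absolute value. The
orientation sign thus converts the determinant by which top forms transform into the absolute value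
in the change of variables formula. -/
theorem chartSign_mul_det {x₀ x₁ : X} {u : Eu d} (hu : u ∈ (chartAt (Eu d) x₀).target)
    (hy : (chartAt (Eu d) x₀).symm u ∈ (chartAt (Eu d) x₁).source) :
    chartSign X.sgn x₀ u * LinearMap.det
      (fderiv ℝ (inCharts (X := X) (S := X) id x₀ x₁) u : Eu d →ₗ[ℝ] Eu d) =
    |LinearMap.det (fderiv ℝ (inCharts (X := X) (S := X) id x₀ x₁) u : Eu d →ₗ[ℝ] Eu d)| *
      chartSign X.sgn x₁ (inCharts (X := X) (S := X) id x₀ x₁ u) := by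
  have h := chartDeriv_inCharts (X := X) (S := X) (y₀ := x₁) contMDiff_id hu hy
  rw [mfderiv_id] at h
  have h' : chartDeriv x₀ u = (chartDeriv x₁ (inCharts (X := X) (S := X) id x₀ x₁ u)).comp
      (fderiv ℝ (inCharts (X := X) (S := X) id x₀ x₁) u) := by
    rw [h]; rfl
  have hs : (chartAt (Eu d) x₁).symm (inCharts (X := X) (S := X) id x₀ x₁ u) =
    (chartAt (Eu d) x₀).symm u := (chartAt (Eu d) x₁).left_inv hy
  have hd : LinearMap.det (chartDeriv x₀ u : Eu d →ₗ[ℝ] Eu d) =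
      LinearMap.det (chartDeriv x₁ (inCharts (X := X) (S := X) id x₀ x₁ u) : Eu d →ₗ[ℝ] Eu d) *
      LinearMap.det (fderiv ℝ (inCharts (X := X) (S := X) id x₀ x₁) u : Eu d →ₗ[ℝ] Eu d) := by
    rw [h', ← LinearMap.det_comp]
    rfl
  rw [chartSign, chartSign, hs, hd, mul_assoc, sign_mul_mul_self]
  ring

/-- Outside the overlap of the two charts the integrand vanishes; on the overlap this is the change
of variables formula together with `chartSign_mul_det`. -/
theorem setIntegral_integrand_change (l : L →ₗ[ℝ] ℝ) (F : X → FormAlg d L) (c : X → ℝ)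
    {x₀ x₁ : X} (h₀ : ∀ p, p ∉ (chartAt (Eu d) x₀).source → c p = 0 ∨ F p = 0)
    (h₁ : ∀ p, p ∉ (chartAt (Eu d) x₁).source → c p = 0 ∨ F p = 0) :
    ∫ u in (chartAt (Eu d) x₀).target, integrand l F c x₀ u =
      ∫ u in (chartAt (Eu d) x₁).target, integrand l F c x₁ u := by
  let g := inCharts (X := X) (S := X) id x₀ x₁
  let O : X → X → Set (Eu d) := fun a b =>
    (chartAt (Eu d) a).target ∩ (chartAt (Eu d) a).symm ⁻¹' (chartAt (Eu d) b).source
  have hO : ∀ a b, IsOpen (O a b) := fun a b =>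
    (chartAt (Eu d) a).isOpen_inter_preimage_symm (chartAt (Eu d) b).open_source
  have hres : ∀ a b, (∀ p, p ∉ (chartAt (Eu d) b).source → c p = 0 ∨ F p = 0) →
      ∫ u in (chartAt (Eu d) a).target, integrand l F c a u = ∫ u in O a b, integrand l F c a u := by
    intro a b hb
    refine setIntegral_eq_of_subset_of_forall_diff_eq_zero
      (chartAt (Eu d) a).open_target.measurableSet Set.inter_subset_left fun u hu => ?_
    exact integrand_eq_zero (hb _ fun h => hu.2 ⟨hu.1, h⟩)
  rw [hres x₀ x₁ h₁, hres x₁ x₀ h₀]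
  have himg : g '' O x₀ x₁ = O x₁ x₀ := by
    ext w
    constructor
    · rintro ⟨u, ⟨hu, hu'⟩, rfl⟩
      refine ⟨(chartAt (Eu d) x₁).map_source hu', ?_⟩
      change (chartAt (Eu d) x₁).symm (chartAt (Eu d) x₁ ((chartAt (Eu d) x₀).symm u)) ∈
        (chartAt (Eu d) x₀).source
      rw [(chartAt (Eu d) x₁).left_inv hu']
      exact (chartAt (Eu d) x₀).map_target hu
    · rintro ⟨hw, hw'⟩
      refine ⟨chartAt (Eu d) x₀ ((chartAt (Eu d) x₁).symm w),
        ⟨(chartAt (Eu d) x₀).map_source hw', ?_⟩, ?_⟩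
      · change (chartAt (Eu d) x₀).symm (chartAt (Eu d) x₀ ((chartAt (Eu d) x₁).symm w)) ∈
          (chartAt (Eu d) x₁).source
        rw [(chartAt (Eu d) x₀).left_inv hw']
        exact (chartAt (Eu d) x₁).map_target hw
      · change chartAt (Eu d) x₁ ((chartAt (Eu d) x₀).symm _) = w
        rw [(chartAt (Eu d) x₀).left_inv hw', (chartAt (Eu d) x₁).right_inv hw]
  have hinj : Set.InjOn g (O x₀ x₁) := by
    rintro u ⟨hu, hu'⟩ w ⟨hw, hw'⟩ h
    exact (chartAt (Eu d) x₀).symm.injOn hu hw ((chartAt (Eu d) x₁).injOn hu' hw' h)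
  have hder : ∀ u ∈ O x₀ x₁, HasFDerivWithinAt g (fderiv ℝ g u) (O x₀ x₁) u := fun u hu =>
    ((contDiffAt_inCharts (X := X) (S := X) contMDiff_id hu.1 hu.2).differentiableAt
      (by simp)).hasFDerivAt.hasFDerivWithinAt
  rw [← himg, integral_image_eq_integral_abs_det_fderiv_smul volume (hO x₀ x₁).measurableSet hder
    hinj]
  refine setIntegral_congr_fun (hO x₀ x₁).measurableSet fun u hu => ?_
  have hs : (chartAt (Eu d) x₁).symm (g u) = (chartAt (Eu d) x₀).symm u :=
    (chartAt (Eu d) x₁).left_inv hu.2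
  have hr := rep_pullMap (X := X) (S := X) contMDiff_id F hu.1 hu.2
  rw [pullMap_id] at hr
  have hdet := chartSign_mul_det (X := X) hu.1 hu.2
  simp only [integrand, smul_eq_mul]
  rw [hr, topCoeff_pullForm, map_smul, smul_eq_mul, hs]
  change _ = |LinearMap.det (fderiv ℝ g u : Eu d →ₗ[ℝ] Eu d)| * _
  calc _ = c ((chartAt (Eu d) x₀).symm u) * (chartSign X.sgn x₀ u * LinearMap.det
      (fderiv ℝ g u : Eu d →ₗ[ℝ] Eu d)) * l (topCoeff d L (rep X F x₁ (g u))) := by ring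
    _ = _ := by rw [hdet]; ring

/-! ### Partitions of unity -/

theorem partition_subordinate (x₀ : X) :
    tsupport (partition X x₀) ⊆ (chartAt (Eu d) x₀).source :=
  (SmoothPartitionOfUnity.exists_isSubordinate_chartAt_source 𝓘(ℝ, Eu d) X).choose_spec x₀

theorem partition_finite : {x₀ : X | (Function.support (partition X x₀)).Nonempty}.Finite :=
  (partition X).locallyFinite.finite_nonempty_of_compact

variable (X) in
/-- The charts that contribute to the partition of unity. -/
def chartIndex : Finset X := (partition_finite (X := X)).toFinset

theorem partition_eq_zero {x₀ : X} (h : x₀ ∉ chartIndex X) (p : X) : partition X x₀ p = 0 := by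
  by_contra hp
  exact h ((partition_finite (X := X)).mem_toFinset.2 ⟨p, hp⟩)

theorem sum_partition (p : X) : ∑ x₀ ∈ chartIndex X, partition X x₀ p = 1 := by
  rw [← (partition X).sum_eq_one (Set.mem_univ p)]
  refine (finsum_eq_sum_of_support_subset _ fun x₀ hx₀ => ?_).symm
  by_contra h
  exact hx₀ (partition_eq_zero h p)

theorem partition_continuous (x₀ : X) : Continuous (partition X x₀) :=
  (partition X x₀).contMDiff.continuous

theorem partition_integrable (l : L →ₗ[ℝ] ℝ) {F : X → FormAlg d L} (hF : SmoothForm X F) (x₀ : X) :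
    IntegrableOn (integrand l F (partition X x₀) x₀) (chartAt (Eu d) x₀).target :=
  integrand_integrableOn l hF (partition_continuous x₀) (isClosed_tsupport _).isCompact
    (partition_subordinate x₀) fun _ hp => Or.inl (image_eq_zero_of_notMem_tsupport hp)

variable [Module.Finite ℝ L] [Module.Finite ℝ L']

/-- By compactness only finitely many members of the partition are non-zero, and functionals reduce
the vector-valued integral to scalar ones. -/
theorem lin_fiberIntegral {F : X → FormAlg d L} (hF : SmoothForm X F) (l : L →ₗ[ℝ] ℝ) :
    l (fiberIntegral X F) = ∑ x₀ ∈ chartIndex X, ∫ u in (chartAt (Eu d) x₀).target,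
      integrand l F (partition X x₀) x₀ u := by
  have h0 : ∀ x₀ : X, x₀ ∉ chartIndex X → vecIntegral (chartAt (Eu d) x₀).target (fun u =>
      (partition X x₀ ((chartAt (Eu d) x₀).symm u) * chartSign X.sgn x₀ u) •
        topCoeff d L (rep X F x₀ u)) = 0 := by
    intro x₀ hx₀
    refine finsum_eq_zero_of_forall_eq_zero fun b => ?_
    simp [partition_eq_zero hx₀]
  rw [fiberIntegral, finsum_eq_sum_of_support_subset (s := chartIndex X) _ (by
    intro x₀ hx₀
    by_contra h
    exact hx₀ (h0 x₀ h)), map_sum]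
  refine Finset.sum_congr rfl fun x₀ _ => ?_
  have hl : ∀ (l : L →ₗ[ℝ] ℝ), (fun u => l ((partition X x₀ ((chartAt (Eu d) x₀).symm u) *
      chartSign X.sgn x₀ u) • topCoeff d L (rep X F x₀ u))) =
      integrand l F (partition X x₀) x₀ := fun l => by
    funext u
    rw [map_smul, smul_eq_mul, integrand]
  rw [lin_vecIntegral (fun l => by rw [hl]; exact partition_integrable l hF x₀), hl]

theorem fiberIntegral_add {F G : X → FormAlg d L} (hF : SmoothForm X F) (hG : SmoothForm X G) :
    fiberIntegral X (fun p => F p + G p) = fiberIntegral X F + fiberIntegral X G := by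
  refine vec_ext fun l => ?_
  rw [map_add, lin_fiberIntegral (hF.add hG), lin_fiberIntegral hF, lin_fiberIntegral hG,
    ← Finset.sum_add_distrib]
  refine Finset.sum_congr rfl fun x₀ _ => ?_
  rw [← integral_add (partition_integrable l hF x₀) (partition_integrable l hG x₀)]
  refine integral_congr_ae (Filter.Eventually.of_forall fun u => ?_)
  simp only [integrand, rep_add, map_add, mul_add]

/-- Common source of the rules for coefficient operations: an operation that commutes with
pull-backs and induces `t` on top coefficients passes through the integral as `t`. The signs of
integration enter through `ht`. -/
theorem fiberIntegral_lin {F : X → FormAlg d L} (hF : SmoothForm X F)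
    (T : FormAlg d L →ₗ[ℝ] FormAlg d L') (t : L →ₗ[ℝ] L')
    (hT : ∀ (A : Eu d →L[ℝ] Eu d) x, pullForm L' A (T x) = T (pullForm L A x))
    (ht : ∀ x, topCoeff d L' (T x) = t (topCoeff d L x)) :
    fiberIntegral X (fun p => T (F p)) = t (fiberIntegral X F) := by
  refine vec_ext fun l => ?_
  have h := lin_fiberIntegral hF (l ∘ₗ t)
  rw [LinearMap.comp_apply] at h
  rw [h, lin_fiberIntegral (hF.lin T hT)]
  refine Finset.sum_congr rfl fun x₀ _ => ?_
  refine integral_congr_ae (Filter.Eventually.of_forall fun u => ?_)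
  simp only [integrand, rep_lin T hT, ht, LinearMap.comp_apply]

theorem fiberIntegral_coeffMap {F : X → FormAlg d L} (hF : SmoothForm X F) (φ : GAlg.Hom L L') :
    fiberIntegral X (fun p => coeffMap d φ (F p)) = φ (fiberIntegral X F) :=
  fiberIntegral_lin hF (coeffMap d φ).toAlgHom.toLinearMap φ.toAlgHom.toLinearMap
    (pullForm_coeffMap φ) (topCoeff_coeffMap φ)

theorem fiberIntegral_coeffDer {F : X → FormAlg d L} (hF : SmoothForm X F) (k : ℤ)
    (D : L →ₗ[ℝ] L') : fiberIntegral X (fun p => coeffDer d k D (F p)) =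
      (k * d).negOnePow • D (fiberIntegral X F) := by
  rw [units_smul_eq_real]
  exact fiberIntegral_lin hF (coeffDer d k D) ((((k * d).negOnePow : ℤ) : ℝ) • D)
    (pullForm_coeffDer k D) fun x => by
      rw [topCoeff_coeffDer, LinearMap.smul_apply, units_smul_eq_real]

theorem fiberIntegral_coeffIncl {F : X → FormAlg d L} (hF : SmoothForm X F) {j : ℤ} {c : L}
    (hc : c ∈ L.gr j) : fiberIntegral X (fun p => coeffIncl d c * F p) =
      (j * d).negOnePow • (c * fiberIntegral X F) := by
  rw [units_smul_eq_real]
  exact fiberIntegral_lin hF (LinearMap.mulLeft ℝ (coeffIncl d c))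
    ((((j * d).negOnePow : ℤ) : ℝ) • LinearMap.mulLeft ℝ c) (pullForm_coeffIncl_mul c) fun x => by
      rw [LinearMap.mulLeft_apply, topCoeff_coeffIncl hc, LinearMap.smul_apply,
        units_smul_eq_real, LinearMap.mulLeft_apply]

theorem fiberIntegral_smul {F : X → FormAlg d L} (hF : SmoothForm X F) (c : ℝ) :
    fiberIntegral X (fun p => c • F p) = c • fiberIntegral X F :=
  fiberIntegral_lin hF (LinearMap.lsmul ℝ (FormAlg d L) c) (LinearMap.lsmul ℝ L c)
    (fun A x => GAlg.Hom.map_smul _ _ _) fun x => map_smul _ _ _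

theorem fiberIntegral_units {F : X → FormAlg d L} (hF : SmoothForm X F) (u : ℤˣ) :
    fiberIntegral X (fun p => u • F p) = u • fiberIntegral X F := by
  simp only [units_smul_eq_real]
  exact fiberIntegral_smul hF _

theorem fiberIntegral_zero : fiberIntegral X (fun _ => (0 : FormAlg d L)) = 0 := by
  have := fiberIntegral_smul (X := X) (SmoothForm.zero (L := L)) 0
  simpa using this

/-- Extracting the top coefficient lowers the total degree by `d`; with `d = n + 1` this produces
the degrees `-1` and `0` of BV theory. -/
theorem fiberIntegral_mem {F : X → FormAlg d L} (hF : SmoothForm X F) {m : ℤ}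
    (h : ∀ p, F p ∈ (FormAlg d L).gr m) : fiberIntegral X F ∈ L.gr (m - d) := by
  refine mem_of_dual fun l hl => ?_
  rw [lin_fiberIntegral hF]
  refine Finset.sum_eq_zero fun x₀ _ => ?_
  refine integral_eq_zero_of_ae (Filter.Eventually.of_forall fun u => ?_)
  have hr : rep X F x₀ u ∈ (FormAlg d L).gr m := (pullForm L _).map_gr (h _)
  rw [integrand, hl _ (topCoeff_mem hr), mul_zero]
  rfl

/-- The integral of a form supported in a chart is computed in that chart. -/
theorem lin_fiberIntegral_chart {F : X → FormAlg d L} (hF : SmoothForm X F) {x₁ : X} {K : Set X}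
    (hK : IsCompact K) (hKs : K ⊆ (chartAt (Eu d) x₁).source) (h0 : ∀ p, p ∉ K → F p = 0)
    (l : L →ₗ[ℝ] ℝ) : l (fiberIntegral X F) = ∫ u in (chartAt (Eu d) x₁).target,
      chartSign X.sgn x₁ u * l (topCoeff d L (rep X F x₁ u)) := by
  rw [lin_fiberIntegral hF]
  -- Each weighted integrand is supported in both charts, so all terms can be moved to the chart at
  -- `x₁`, where the weights sum to one.
  have h : ∀ x₀ : X, ∫ u in (chartAt (Eu d) x₀).target, integrand l F (partition X x₀) x₀ u =
      ∫ u in (chartAt (Eu d) x₁).target, integrand l F (partition X x₀) x₁ u := fun x₀ =>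
    setIntegral_integrand_change l F _
      (fun p hp => Or.inl (image_eq_zero_of_notMem_tsupport fun h =>
        hp (partition_subordinate x₀ h)))
      (fun p hp => Or.inr (h0 p fun h => hp (hKs h)))
  rw [Finset.sum_congr rfl fun x₀ _ => h x₀, ← integral_finsetSum _ fun x₀ _ =>
    integrand_integrableOn l hF (partition_continuous x₀) hK hKs fun p hp => Or.inr (h0 p hp)]
  refine integral_congr_ae (Filter.Eventually.of_forall fun u => ?_)
  simp only [integrand]
  rw [← Finset.sum_mul, ← Finset.sum_mul, sum_partition, one_mul]

end integration

end

noncomputable section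

/-! ### Stokes' theorem -/

open FormAlg MeasureTheory

theorem contDiff_indicator {d : ℕ} {U K : Set (Eu d)} (hU : IsOpen U) (hK : IsCompact K)
    (hKU : K ⊆ U) {f : Eu d → ℝ} (hf : ∀ u ∈ U, ContDiffAt ℝ ∞ f u)
    (h0 : ∀ u ∈ U \ K, f u = 0) : ContDiff ℝ ∞ (U.indicator f) := by
  refine contDiff_iff_contDiffAt.2 fun u => ?_
  by_cases hu : u ∈ U
  · refine (hf u hu).congr_of_eventuallyEq ?_
    filter_upwards [hU.mem_nhds hu] with w hw
    exact Set.indicator_of_mem hw f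
  · refine (contDiffAt_const (c := (0 : ℝ))).congr_of_eventuallyEq ?_
    filter_upwards [hK.isClosed.isOpen_compl.mem_nhds fun h => hu (hKU h)] with w hw
    by_cases hwU : w ∈ U
    · rw [Set.indicator_of_mem hwU, h0 w ⟨hwU, hw⟩]
    · exact Set.indicator_of_notMem hwU f

/-- Integration by parts against the constant function `1`. -/
theorem integral_fderiv_eq_zero {d : ℕ} {f : Eu d → ℝ} (hf : ContDiff ℝ ∞ f)
    (hs : HasCompactSupport f) (v : Eu d) : ∫ u, fderiv ℝ f u v = 0 := by
  have hc : Continuous fun u => fderiv ℝ f u v :=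
    (hf.continuous_fderiv (by simp)).clm_apply continuous_const
  have hi : Integrable fun u => fderiv ℝ f u v :=
    hc.integrable_of_hasCompactSupport ((hs.fderiv ℝ).mono fun u hu h => hu (by simp [h]))
  have h := integral_mul_fderiv_eq_neg_fderiv_mul_of_integrable (𝕜 := ℝ) (μ := volume)
    (f := fun _ : Eu d => (1 : ℝ)) (g := f) (v := v) (by simp) (by simpa using hi)
    (by simpa using hf.continuous.integrable_of_hasCompactSupport hs)
    (fun _ _ => differentiableAt_const _) (fun u _ => hf.differentiable (by simp) u)
  simpa using h

theorem setIntegral_fderiv_eq_zero {d : ℕ} {U K : Set (Eu d)} (hU : IsOpen U) (hK : IsCompact K)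
    (hKU : K ⊆ U) {f : Eu d → ℝ} (hf : ∀ u ∈ U, ContDiffAt ℝ ∞ f u)
    (h0 : ∀ u ∈ U \ K, f u = 0) (v : Eu d) : ∫ u in U, fderiv ℝ f u v = 0 := by
  have hsupp : Function.support (U.indicator f) ⊆ K := by
    intro u hu
    by_contra h
    by_cases hU' : u ∈ U
    · exact hu (by rw [Set.indicator_of_mem hU', h0 u ⟨hU', h⟩])
    · exact hu (Set.indicator_of_notMem hU' f)
  have hts : tsupport (U.indicator f) ⊆ K := closure_minimal hsupp hK.isClosed
  rw [← integral_fderiv_eq_zero (contDiff_indicator hU hK hKU hf h0)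
    (hK.of_isClosed_subset (isClosed_tsupport _) hts) v,
    ← setIntegral_eq_integral_of_forall_compl_eq_zero (μ := volume) (s := U)
      (f := fun u => fderiv ℝ (U.indicator f) u v) fun u hu => by
      rw [image_eq_zero_of_notMem_tsupport (f := fderiv ℝ (U.indicator f)) fun h =>
        hu (hKU (hts (tsupport_fderiv_subset ℝ h)))]
      rfl]
  refine setIntegral_congr_fun hU.measurableSet fun u hu => ?_
  have : f =ᶠ[nhds u] U.indicator f := by
    filter_upwards [hU.mem_nhds hu] with w hw
    rw [Set.indicator_of_mem hw]
  simp only [this.fderiv_eq]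

section stokes

variable {d : ℕ} {X : ClosedOriented d} {L : GAlg}

theorem rep_fsmul (c : X → ℝ) (F : X → FormAlg d L) (x₀ : X) (u : Eu d) :
    rep X (fun p => c p • F p) x₀ u = c ((chartAt (Eu d) x₀).symm u) • rep X F x₀ u :=
  GAlg.Hom.map_smul _ _ _

variable [Module.Finite ℝ L]

theorem SmoothForm.fsmul {c : X → ℝ} (hc : ContMDiff 𝓘(ℝ, Eu d) 𝓘(ℝ, ℝ) ∞ c)
    {F : X → FormAlg d L} (hF : SmoothForm X F) : SmoothForm X fun p => c p • F p := by
  refine smoothForm_iff.2 fun x₀ u hu => ?_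
  have h : rep X (fun p => c p • F p) x₀ = fun w =>
    c ((chartAt (Eu d) x₀).symm w) • rep X F x₀ w := funext fun w => rep_fsmul c F x₀ w
  rw [h]
  refine VSmoothAt.smul ?_ (smoothForm_iff.1 hF x₀ u hu)
  exact (hc.contMDiffAt.comp u (contMDiffAt_chart_symm hu)).contDiffAt

theorem deRham_congr {F G : X → FormAlg d L} {p : X} (h : F =ᶠ[nhds p] G) :
    deRham X F p = deRham X G p := by
  refine dAt_congr ?_
  have hc := ((chartAt (Eu d) p).continuousOn_symm.continuousAt
    ((chartAt (Eu d) p).open_target.mem_nhds (chart_self_mem p)))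
  rw [ContinuousAt, (chartAt (Eu d) p).left_inv (mem_chart_source _ p)] at hc
  filter_upwards [hc.eventually h] with w hw
  rw [rep, hw, rep]

theorem deRham_zero (p : X) : deRham X (fun _ => (0 : FormAlg d L)) p = 0 := by
  have h : rep X (fun _ => (0 : FormAlg d L)) p = fun _ => 0 :=
    funext fun u => GAlg.Hom.map_zero _
  rw [deRham_eq_dAt, h, dAt_const]

theorem SmoothForm.sum {ι : Type} {s : Finset ι} {F : ι → X → FormAlg d L}
    (hF : ∀ j, SmoothForm X (F j)) : SmoothForm X fun p => ∑ j ∈ s, F j p := by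
  induction s using Finset.cons_induction with
  | empty => simpa using SmoothForm.zero
  | cons a s ha h => simpa [Finset.sum_cons] using (hF a).add h

theorem deRham_sum {ι : Type} {s : Finset ι} {F : ι → X → FormAlg d L}
    (hF : ∀ j, SmoothForm X (F j)) (p : X) :
    deRham X (fun q => ∑ j ∈ s, F j q) p = ∑ j ∈ s, deRham X (F j) p := by
  induction s using Finset.cons_induction with
  | empty => simpa using deRham_zero p
  | cons a s ha h =>
    simp only [Finset.sum_cons]
    rw [deRham_add (hF a) (SmoothForm.sum hF), h]

theorem fiberIntegral_sum {ι : Type} {s : Finset ι} {F : ι → X → FormAlg d L}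
    (hF : ∀ j, SmoothForm X (F j)) :
    fiberIntegral X (fun q => ∑ j ∈ s, F j q) = ∑ j ∈ s, fiberIntegral X (F j) := by
  induction s using Finset.cons_induction with
  | empty => simpa using fiberIntegral_zero
  | cons a s ha h =>
    simp only [Finset.sum_cons]
    rw [fiberIntegral_add (hF a) (SmoothForm.sum hF), h]

/-- In the chart the integrand is a sum of partial derivatives of compactly supported functions,
since the locally constant orientation sign may be moved inside the derivative. -/
theorem fiberIntegral_deRham_chart {F : X → FormAlg d L} (hF : SmoothForm X F) {x₁ : X} {K : Set X}
    (hK : IsCompact K) (hKs : K ⊆ (chartAt (Eu d) x₁).source) (h0 : ∀ p, p ∉ K → F p = 0) :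
    fiberIntegral X (deRham X F) = 0 := by
  refine vec_ext fun l => ?_
  rw [map_zero, lin_fiberIntegral_chart (smoothForm_deRham hF) hK hKs (fun p hp => by
    rw [← deRham_zero p]
    refine deRham_congr ?_
    filter_upwards [hK.isClosed.isOpen_compl.mem_nhds hp] with q hq
    exact h0 q hq)]
  have hrep := smoothForm_iff.1 hF x₁
  let T : Fin d → FormAlg d L →ₗ[ℝ] ℝ := fun i =>
    l ∘ₗ topCoeff d L ∘ₗ LinearMap.mulLeft ℝ (coframe d L i)
  let f : Fin d → Eu d → ℝ := fun i u => chartSign X.sgn x₁ u * T i (rep X F x₁ u)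
  have hsign : ∀ u ∈ (chartAt (Eu d) x₁).target, ContDiffAt ℝ ∞ (chartSign X.sgn x₁) u :=
    fun u hu => contDiffAt_const.congr_of_eventuallyEq (chartSign_eventually hu)
  have hf : ∀ i, ∀ u ∈ (chartAt (Eu d) x₁).target, ContDiffAt ℝ ∞ (f i) u := fun i u hu =>
    (hsign u hu).mul (hrep u hu (T i))
  have hf0 : ∀ i, ∀ u ∈ (chartAt (Eu d) x₁).target \ (chartAt (Eu d) x₁ '' K), f i u = 0 :=
    fun i u hu => by
      simp only [f, rep_eq_zero (h0 _ (symm_notMem hu.1 hu.2)), map_zero, mul_zero]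
  have hder : ∀ i, ∀ u ∈ (chartAt (Eu d) x₁).target,
      fderiv ℝ (f i) u (EuclideanSpace.single i 1) = chartSign X.sgn x₁ u *
        l (topCoeff d L (coframe d L i * vecDeriv (rep X F x₁) u (EuclideanSpace.single i 1))) := by
    intro i u hu
    have he : f i =ᶠ[nhds u] fun w => chartSign X.sgn x₁ u * T i (rep X F x₁ w) := by
      filter_upwards [chartSign_eventually hu] with w hw
      simp only [f, hw]
    rw [he.fderiv_eq, fderiv_const_mul ((hrep u hu).differentiableAt (T i)),
      ContinuousLinearMap.smul_apply, ← lin_vecDeriv (hrep u hu).differentiableAt]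
    rfl
  have hcong : ∀ u ∈ (chartAt (Eu d) x₁).target,
      chartSign X.sgn x₁ u * l (topCoeff d L (rep X (deRham X F) x₁ u)) =
        ∑ i, fderiv ℝ (f i) u (EuclideanSpace.single i 1) := by
    intro u hu
    rw [rep_deRham hF hu, dAt, map_sum, map_sum, Finset.mul_sum]
    exact Finset.sum_congr rfl fun i _ => (hder i u hu).symm
  have hopen := (chartAt (Eu d) x₁).open_target
  have hKc := image_chart_compact hK hKs
  have hKt := image_chart_subset hKs
  rw [setIntegral_congr_fun hopen.measurableSet hcong, integral_finsetSum]
  · exact Finset.sum_eq_zero fun i _ => setIntegral_fderiv_eq_zero hopen hKc hKt (hf i) (hf0 i) _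
  · intro i _
    refine integrableOn_of_compact hopen hKc hKt (fun u hu => ?_) fun u hu => ?_
    · exact (((hf i u hu).fderiv_right (m := 0) (by simp)).continuousAt.clm_apply
        continuousAt_const).continuousWithinAt
    · have : f i =ᶠ[nhds u] fun _ => 0 := by
        filter_upwards [(hopen.sdiff hKc.isClosed).mem_nhds hu] with w hw
        exact hf0 i w hw
      rw [this.fderiv_eq]
      simp

/-- Stokes' theorem on a closed manifold. -/
theorem fiberIntegral_deRham {F : X → FormAlg d L} (hF : SmoothForm X F) :
    fiberIntegral X (deRham X F) = 0 := by
  -- The form itself is cut up rather than its differential, so that each piece of `dF` is the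
  -- differential of a form supported in a single chart.
  have hs : ∀ x₀ : X, SmoothForm X fun p => partition X x₀ p • F p := fun x₀ =>
    hF.fsmul (partition X x₀).contMDiff
  have h : F = fun p => ∑ x₀ ∈ chartIndex X, partition X x₀ p • F p := by
    funext p
    rw [← Finset.sum_smul, sum_partition, one_smul]
  have h' : deRham X F = fun p => ∑ x₀ ∈ chartIndex X,
      deRham X (fun p => partition X x₀ p • F p) p := by
    conv_lhs => rw [h]
    exact funext fun p => deRham_sum hs p
  rw [h', fiberIntegral_sum fun x₀ => smoothForm_deRham (hs x₀)]
  refine Finset.sum_eq_zero fun x₀ _ => fiberIntegral_deRham_chart (hs x₀)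
    (isClosed_tsupport _).isCompact (partition_subordinate x₀) fun p hp => ?_
  rw [image_eq_zero_of_notMem_tsupport hp, zero_smul]

end stokes

end

noncomputable section

/-! ### Forms and vector fields along families of points -/

theorem IsDer.map_units {A R : GAlg} {φ : GAlg.Hom A R} {k : ℤ} {D : A → R} (h : IsDer φ k D)
    (u : ℤˣ) (a : A) : D (u • a) = u • D a :=
  map_units_smul h.toLin u a

theorem IsDer.vel {A R : GAlg} {k : ℤ} {δ : R → R} (hδ : IsDer (GAlg.Hom.id R) k δ)
    (x : GAlg.Hom A R) : IsDer x k (fun a => δ (x a)) :=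
  hδ.hom_comp x

namespace GAlg

/-! ### Derivations of square-zero extensions -/

section sqDer

variable {S : GAlg} {ι : Type} [Fintype ι] {κ : ι → ℤ}

/-- The extension of a derivation of degree one to a square-zero extension. -/
def sqLift (κ : ι → ℤ) {δ : S → S} (hδ : IsDer (Hom.id S) 1 δ) : sq S κ →ₗ[ℝ] sq S κ :=
  (hδ.toLin.comp (LinearMap.fst ℝ S (ι → S))).prod (LinearMap.pi fun i =>
    (((κ i).negOnePow : ℤ) : ℝ) • hδ.toLin.comp (LinearMap.proj i ∘ₗ LinearMap.snd ℝ S (ι → S)))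

theorem sqFst_lift {δ : S → S} (hδ : IsDer (Hom.id S) 1 δ) (x : sq S κ) :
    sqFst S κ (sqLift κ hδ x) = δ (sqFst S κ x) := rfl

theorem sqSnd_lift {δ : S → S} (hδ : IsDer (Hom.id S) 1 δ) (i : ι) (x : sq S κ) :
    sqSnd S κ i (sqLift κ hδ x) = (κ i).negOnePow • δ (sqSnd S κ i x) := by
  rw [units_smul_eq_real]
  rfl

theorem sqSnd_mul (i : ι) (a b : sq S κ) : sqSnd S κ i (a * b) =
    sqSnd S κ i a * sqFst S κ b + twist S (κ i) (sqFst S κ a) * sqSnd S κ i b := rfl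

/-- The lift treats the parameters as constants; its sign `(-1)^{κ i}` is that of moving an odd
derivation past `εᵢ`. -/
theorem sqLift_isDer {δ : S → S} (hδ : IsDer (Hom.id S) 1 δ) :
    IsDer (Hom.id (sq S κ)) 1 (sqLift κ hδ) where
  map_add := map_add _
  map_smul := map_smul _
  map_gr {p x} hx := by
    refine (⟨hδ.map_gr hx.1, fun i => ?_⟩ : _ ∈ S.gr (1 + p) ∧ ∀ i, _ ∈ S.gr (κ i + (1 + p)))
    rw [add_left_comm]
    exact Submodule.smul_mem _ _ (hδ.map_gr (hx.2 i))
  leibniz {p a} b ha := by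
    have ha1 : sqFst S κ a ∈ S.gr p := ha.1
    have ha2 : ∀ i, sqSnd S κ i a ∈ S.gr (κ i + p) := ha.2
    change sqLift κ hδ (a * b) = sqLift κ hδ a * b + (1 * p).negOnePow • (a * sqLift κ hδ b)
    refine sq_hext ?_ fun i => ?_
    · rw [sqFst_lift, Hom.map_mul, hδ.leibniz _ ha1, Hom.map_add, Hom.map_mul, Hom.map_units,
        Hom.map_mul, sqFst_lift, sqFst_lift]
      rfl
    · have e1 : ((κ i).negOnePow * (1 * (κ i + p)).negOnePow : ℤˣ) = (1 * p).negOnePow := by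
        rw [← Int.negOnePow_add]; exact negOnePow_congr (k := κ i) (by ring)
      have e2 : ((κ i).negOnePow * (κ i * p).negOnePow : ℤˣ) = (κ i * (1 + p)).negOnePow := by
        rw [← Int.negOnePow_add]; exact congrArg _ (by ring)
      rw [sqSnd_lift, sqSnd_mul, hδ.map_add, hδ.leibniz _ (ha2 i), twist_apply _ ha1,
        smul_mul_assoc, hδ.map_units, hδ.leibniz _ ha1, map_add, map_units_smul, sqSnd_mul,
        sqSnd_mul, sqFst_lift, sqFst_lift, sqSnd_lift, sqSnd_lift, twist_apply _ ha1,
        twist_apply _ (hδ.map_gr ha1), smul_mul_assoc, smul_mul_assoc, smul_mul_assoc,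
        mul_smul_comm, smul_add, smul_add, smul_add, smul_add, smul_smul, smul_smul, smul_smul,
        smul_smul, smul_smul, e1, e2]
      have e3 : ((κ i * (1 + p)).negOnePow * (1 * p).negOnePow : ℤˣ) =
          (1 * p).negOnePow * ((κ i * p).negOnePow * (κ i).negOnePow) := by
        simp only [← Int.negOnePow_add]; exact congrArg _ (by ring)
      rw [e3, smul_add, ← smul_smul (1 * p).negOnePow]
      change _ + (1 * p).negOnePow • (sqSnd S κ i a * δ (sqFst S κ b)) + (_ + _) = _
      exact add_add_add_comm _ _ _ _

/-- The degrees of two square-zero parameters, of degrees `-k` and `0`. -/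
def pairDeg (k : ℤ) (b : Bool) : ℤ := bif b then k else 0

/-- The derivation `θ ∂_ε`, where `ε` has degree `-k` and `θ` has degree zero. -/
def sqSwap (S : GAlg) (k : ℤ) : sq S (pairDeg k) →ₗ[ℝ] sq S (pairDeg k) :=
  (0 : S × (Bool → S) →ₗ[ℝ] S).prod
    (LinearMap.pi fun b => bif b then 0 else sqSnd S (pairDeg k) true)

theorem sqFst_swap (k : ℤ) (x : sq S (pairDeg k)) : sqFst S (pairDeg k) (sqSwap S k x) = 0 := rfl

theorem sqSnd_swap_true (k : ℤ) (x : sq S (pairDeg k)) :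
    sqSnd S (pairDeg k) true (sqSwap S k x) = 0 := rfl

theorem sqSnd_swap_false (k : ℤ) (x : sq S (pairDeg k)) :
    sqSnd S (pairDeg k) false (sqSwap S k x) = sqSnd S (pairDeg k) true x := rfl

theorem sqSwap_isDer (k : ℤ) : IsDer (Hom.id (sq S (pairDeg k))) k (sqSwap S k) where
  map_add := map_add _
  map_smul := map_smul _
  map_gr {p x} hx := by
    refine (⟨Submodule.zero_mem _, fun b => ?_⟩ :
      _ ∈ S.gr (k + p) ∧ ∀ b, _ ∈ S.gr (pairDeg k b + (k + p)))
    cases b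
    · have : sqSnd S (pairDeg k) true x ∈ S.gr (k + p) := hx.2 true
      rw [← zero_add (k + p)] at this
      exact this
    · exact Submodule.zero_mem _
  leibniz {p a} b ha := by
    have ha1 : sqFst S (pairDeg k) a ∈ S.gr p := ha.1
    change sqSwap S k (a * b) = sqSwap S k a * b + (k * p).negOnePow • (a * sqSwap S k b)
    refine sq_hext ?_ fun i => ?_
    · rw [Hom.map_add, Hom.map_units, Hom.map_mul, Hom.map_mul]
      simp only [sqFst_swap, zero_mul, mul_zero, smul_zero, add_zero]
    · rw [map_add, map_units_smul, sqSnd_mul, sqSnd_mul]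
      cases i
      · rw [sqSnd_swap_false, sqSnd_swap_false, sqSnd_swap_false, sqFst_swap, sqFst_swap,
          sqSnd_mul, Hom.map_zero, zero_mul, mul_zero, add_zero, zero_add, twist_apply _ ha1,
          twist_apply _ ha1, smul_mul_assoc, smul_mul_assoc, smul_smul, ← Int.negOnePow_add]
        refine congrArg₂ _ rfl (congrArg₂ _ (congrArg _ ?_) rfl)
        simp [pairDeg]
      · simp only [sqSnd_swap_true, sqFst_swap, Hom.map_zero, zero_mul, mul_zero, add_zero,
          smul_zero]

/-- `δ` treats `ε` and `θ` as constants, so its graded commutator with `θ ∂_ε` vanishes; this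
removes the bracket term from Cartan's formula. -/
theorem sqLift_swap (k : ℤ) {δ : S → S} (hδ : IsDer (Hom.id S) 1 δ) (x : sq S (pairDeg k)) :
    sqLift (pairDeg k) hδ (sqSwap S k x) =
      k.negOnePow • sqSwap S k (sqLift (pairDeg k) hδ x) := by
  refine sq_hext ?_ fun b => ?_
  · rw [Hom.map_units, sqFst_lift, sqFst_swap, sqFst_swap, hδ.map_zero, smul_zero]
  · rw [map_units_smul, sqSnd_lift]
    cases b
    · rw [sqSnd_swap_false, sqSnd_swap_false, sqSnd_lift, smul_smul]
      change (0 : ℤ).negOnePow • _ = (k.negOnePow * k.negOnePow) • _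
      rw [units_mul_self, Int.negOnePow_zero]
    · rw [sqSnd_swap_true, sqSnd_swap_true, hδ.map_zero, smul_zero, smul_zero]

end sqDer

end GAlg

namespace PtSpace

variable {A : GAlg} {n : ℤ} {α : (spec A).Form1} {ϖ : (spec A).Form2}

theorem IsForm1.map_zero {P : GAlg → Prop} {X : PtSpace P} {α : X.Form1} (hα : IsForm1 n α)
    {R : Test P} {x : X.Pt R} {k : ℤ} (h0 : X.IsTan x k 0) : α R x k 0 = 0 := by
  simpa using hα.add h0 h0

theorem IsForm2.map_zero {P : GAlg → Prop} {X : PtSpace P} {ϖ : X.Form2} (hϖ : IsForm2 n ϖ)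
    {R : Test P} {x : X.Pt R} {k l : ℤ} {v : X.Vec R} (hv : X.IsTan x k v) (h0 : X.IsTan x l 0) :
    ϖ R x k v l 0 = 0 := by
  simpa using hϖ.add hv h0 h0

theorem IsForm2.add_left {P : GAlg → Prop} {X : PtSpace P} {ϖ : X.Form2} (hϖ : IsForm2 n ϖ)
    {R : Test P} {x : X.Pt R} {k l : ℤ} {v v' w : X.Vec R} (hv : X.IsTan x k v)
    (hv' : X.IsTan x k v') (hvv : X.IsTan x k (v + v')) (hw : X.IsTan x l w) :
    ϖ R x k (v + v') l w = ϖ R x k v l w + ϖ R x k v' l w := by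
  rw [hϖ.symm hvv hw, hϖ.add hw hv hv', smul_add, ← hϖ.symm hv hw, ← hϖ.symm hv' hw]

/-- Cartan's formula for a derivation along a morphism that commutes with differentials. -/
theorem form2_along (hα : IsForm1 n α) (hϖ : IsForm2 n ϖ) (hext : IsExtDeriv α ϖ)
    {R S : Test GAlg.IsSmooth} {φ : GAlg.Hom R.1 S.1} {k : ℤ} {D : R.1 → S.1} (hD : IsDer φ k D)
    {δ : R.1 → R.1} (hδ : IsDer (GAlg.Hom.id R.1) 1 δ) {δ' : S.1 → S.1}
    (hδ' : IsDer (GAlg.Hom.id S.1) 1 δ') (hφ : ∀ r, φ (δ r) = δ' (φ r))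
    (hDδ : ∀ r, D (δ r) = k.negOnePow • δ' (D r)) (y : GAlg.Hom A R.1) :
    ϖ S (φ.comp y) 1 (fun a => δ' (φ (y a))) k (fun a => D (y a)) =
      (k - 1).negOnePow • δ' (α S (φ.comp y) k (fun a => D (y a))) +
        D (α R y 1 (fun a => δ (y a))) := by
  classical
  -- Exactness speaks of two derivations of one algebra, whereas `D` maps `R` to `S`. Over `T = S[ε,
  -- θ]`, where all products of parameters vanish, the point `Ψ ∘ y` with `Ψ = φ + εD` stores `D`,
  -- and the derivation `E = θ ∂_ε` of `T` recovers it as the velocity `θ D`.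
  let κ := GAlg.pairDeg k
  let T : Test GAlg.IsSmooth := sqTest S κ
  let T₀ : Test GAlg.IsSmooth := sqTest S fun _ : Unit => (0 : ℤ)
  have hΨ : ∀ b, IsDer φ (κ b) ((bif b then D else fun _ => 0) : R.1 → S.1) := by
    intro b; cases b
    · exact IsDer.zero
    · exact hD
  let Ψ : GAlg.Hom R.1 T.1 := GAlg.sqMk φ (fun b => bif b then D else fun _ => 0) hΨ
  -- `π` sets `ε = 0`. The point becomes `φ ∘ y`, while the velocity along `E` is still `θ D y`; the
  -- factor `θ` can then be extracted by linearity of the forms.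
  let π : GAlg.Hom T.1 T₀.1 := GAlg.sqMk (κ := fun _ : Unit => (0 : ℤ)) (GAlg.sqFst S.1 κ)
    (fun _ => GAlg.sqSnd S.1 κ false) (fun _ => GAlg.sqSnd_isDer (κ := κ) (GAlg.Hom.id S.1) false)
  let ι : GAlg.Hom S.1 T₀.1 := GAlg.sqMk (κ := fun _ : Unit => (0 : ℤ)) (GAlg.Hom.id S.1)
    (fun _ _ => 0) (fun _ => IsDer.zero)
  let q : T.1 →ₗ[ℝ] S.1 := GAlg.sqSnd S.1 κ false
  let q₀ : T₀.1 →ₗ[ℝ] S.1 := GAlg.sqSnd S.1 (fun _ : Unit => (0 : ℤ)) ()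
  let θ : T₀.1 := ((0 : S.1), fun _ => (1 : S.1))
  have hθ : θ ∈ T₀.1.gr 0 := by
    refine (⟨Submodule.zero_mem _, fun _ => ?_⟩ : (0 : S.1) ∈ S.1.gr 0 ∧
      ∀ _ : Unit, (1 : S.1) ∈ S.1.gr (0 + 0))
    exact SetLike.GradedOne.one_mem (A := S.1.gr)
  have hq₀ : ∀ s, q₀ (θ * ι s) = s := fun s => by
    refine (GAlg.sqSnd_mul (κ := fun _ : Unit => (0 : ℤ)) () θ (ι s)).trans ?_
    change 1 * s + _ * 0 = s
    rw [one_mul, mul_zero, add_zero]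
  let x : GAlg.Hom A T.1 := Ψ.comp y
  let y' : GAlg.Hom A S.1 := φ.comp y
  let δT : T.1 →ₗ[ℝ] T.1 := GAlg.sqLift κ hδ'
  have hδT : IsDer (GAlg.Hom.id T.1) 1 δT := GAlg.sqLift_isDer hδ'
  let E : T.1 →ₗ[ℝ] T.1 := GAlg.sqSwap S.1 k
  have hE : IsDer (GAlg.Hom.id T.1) k E := GAlg.sqSwap_isDer k
  -- The `ε`-component of this identity is the commutation rule `hDδ`.
  have hΨδ : ∀ r, δT (Ψ r) = Ψ (δ r) := fun r => by
    refine GAlg.sq_hext (hφ r).symm fun b => ?_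
    refine (GAlg.sqSnd_lift hδ' b (Ψ r)).trans ?_
    cases b
    · change (0 : ℤ).negOnePow • δ' 0 = 0
      rw [hδ'.map_zero, smul_zero]
    · exact (hDδ r).symm
  have hqδ : ∀ t, q (δT t) = δ' (q t) := fun t => by
    refine (GAlg.sqSnd_lift hδ' false t).trans ?_
    change (0 : ℤ).negOnePow • _ = _
    rw [Int.negOnePow_zero, one_smul]
    rfl
  have hπx : π.comp x = ι.comp y' :=
    GAlg.Hom.ext fun a => GAlg.sq_hext rfl fun _ => rfl
  have hπδ : (fun a => π (δT (x a))) = fun a => ι (δ' (y' a)) := by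
    funext a
    refine GAlg.sq_hext rfl fun _ => (hqδ (x a)).trans ?_
    exact hδ'.map_zero
  have hπE : (fun a => π (E (x a))) = fun a => θ * ι (D (y a)) := by
    funext a
    refine GAlg.sq_hext ?_ fun _ => (hq₀ _).symm
    change (0 : S.1) = 0 * _
    rw [zero_mul]
  have hDy : IsDer y' k (fun a => D (y a)) := hD.hom_comp y
  have hδy : IsDer y' 1 (fun a => δ' (y' a)) := hδ'.vel y'
  have hιD : IsDer (ι.comp y') k (fun a => ι (D (y a))) := hDy.comp_hom ι
  have hιδ : IsDer (ι.comp y') 1 (fun a => ι (δ' (y' a))) := hδy.comp_hom ι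
  have hω : q (ϖ T x 1 (fun a => δT (x a)) k (fun a => E (x a))) =
      ϖ S y' 1 (fun a => δ' (y' a)) k (fun a => D (y a)) := by
    have h1 := hϖ.natural (R := T) (S := T₀) π (x := x) (hδT.vel x) (hE.vel x)
    have h2 : ϖ T₀ (π.comp x) 1 (fun a => π (δT (x a))) k (fun a => π (E (x a))) =
        θ * ι (ϖ S y' 1 (fun a => δ' (y' a)) k (fun a => D (y a))) := by
      rw [hπx, hπδ, hπE]
      have h3 := hϖ.smul (R := T₀) (x := ι.comp y') (r := θ) hιδ hιD hθ
      rw [zero_add] at h3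
      refine h3.trans (congrArg (θ * ·) ?_)
      exact hϖ.natural (R := S) (S := T₀) ι (x := y') hδy hDy
    exact (congrArg q₀ (h1.symm.trans h2)).trans (hq₀ _)
  have hαE : q (α T x k (fun a => E (x a))) = α S y' k (fun a => D (y a)) := by
    have h1 := hα.natural (R := T) (S := T₀) π (x := x) (hE.vel x)
    have h2 : α T₀ (π.comp x) k (fun a => π (E (x a))) = θ * ι (α S y' k (fun a => D (y a))) := by
      rw [hπx, hπE]
      have h3 := hα.smul (R := T₀) (x := ι.comp y') (r := θ) hιD hθ
      rw [zero_add] at h3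
      refine h3.trans (congrArg (θ * ·) ?_)
      exact hα.natural (R := S) (S := T₀) ι (x := y') hDy
    exact (congrArg q₀ (h1.symm.trans h2)).trans (hq₀ _)
  -- Here `ε` must be kept: the form is evaluated over `R` and transported by `Ψ`, whose
  -- `ε`-coefficient is `D`.
  have hαδ : q (E (α T x 1 (fun a => δT (x a)))) = D (α R y 1 (fun a => δ (y a))) := by
    have h1 : (fun a => δT (x a)) = fun a => Ψ (δ (y a)) := funext fun a => hΨδ (y a)
    rw [h1]
    have h2 := hα.natural (R := R) (S := T) Ψ (x := y) (hδ.vel y)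
    exact congrArg (GAlg.sqSnd S.1 κ true) h2
  have hcomm : (fun a => (δT ∘ₗ E - (1 * k).negOnePow • (E ∘ₗ δT)) (x a)) = fun _ => 0 := by
    funext a
    rw [one_mul, LinearMap.sub_apply, sub_eq_zero]
    refine (GAlg.sqLift_swap k hδ' (x a)).trans ?_
    rw [units_smul_eq_real, units_smul_eq_real]
    rfl
  -- The claim is the `θ`-coefficient of Cartan's formula for `δT` and `E` at the point `Ψ ∘ y`.
  have h := congrArg q (hext (R := T) x δT E hδT hE)
  change q (ϖ T x 1 (fun a => δT (x a)) k (fun a => E (x a))) =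
    q ((1 * (k - 1)).negOnePow • (δT (α T x k (fun a => E (x a))) -
      α T x (1 + k) (fun a => (δT ∘ₗ E - (1 * k).negOnePow • (E ∘ₗ δT)) (x a))) -
      (1 : ℤ).negOnePow • E (α T x 1 (fun a => δT (x a)))) at h
  have hα0 : α T x (1 + k) (fun _ => 0) = 0 := hα.map_zero (X := spec A) (x := x) IsDer.zero
  rw [hcomm, hα0, sub_zero, hω, map_sub,
    map_units_smul, map_units_smul, hqδ, hαE, hαδ, one_mul] at h
  rw [Int.negOnePow_one, Units.neg_smul, one_smul, sub_neg_eq_add] at h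
  exact h

end PtSpace

end

noncomputable section

/-! ### Fields as points over algebras of smooth functions -/

open FormAlg

section localForm

variable {d : ℕ} {X : ClosedOriented d} {L : GAlg} [Module.Finite ℝ L]

/-- The image of the preferred chart at `x₀`. -/
def chartOpens (x₀ : X) : Opens (Eu d) :=
  ⟨(chartAt (Eu d) x₀).target, (chartAt (Eu d) x₀).open_target⟩

/-- The base point of the preferred chart. -/
def chartCenter (p : X) : chartOpens p := ⟨chartAt (Eu d) p p, chart_self_mem p⟩

/-- A form in the chart at `x₀`. -/
def localForm {F : X → FormAlg d L} (hF : SmoothForm X F) (x₀ : X) :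
    GAlg.smooth (chartOpens x₀) (FormAlg d L) :=
  GAlg.smoothMk (rep X F x₀) (smoothForm_iff.1 hF x₀)

theorem smoothForm_of_local {F : X → FormAlg d L}
    (g : ∀ x₀ : X, GAlg.smooth (chartOpens x₀) (FormAlg d L))
    (h : ∀ (x₀ : X) (u : chartOpens x₀), GAlg.ev u (g x₀) = rep X F x₀ u) : SmoothForm X F :=
  smoothForm_iff.2 fun x₀ u hu =>
    (GAlg.fn_smooth (g x₀) (u := u) hu).congr (GAlg.fn_eventuallyEq (h x₀) hu).symm

theorem ev_dSmooth_local {F : X → FormAlg d L} {p : X}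
    {g : GAlg.smooth (chartOpens p) (FormAlg d L)}
    (h : ∀ u : chartOpens p, GAlg.ev u g = rep X F p u) :
    GAlg.ev (chartCenter p) (GAlg.dSmooth g) = deRham X F p := by
  rw [GAlg.ev_dSmooth, deRham_eq_dAt]
  exact dAt_congr (GAlg.fn_eventuallyEq h (chart_self_mem p))

theorem ev_dSmooth_rep {F : X → FormAlg d L} (hF : SmoothForm X F) {x₀ : X}
    {g : GAlg.smooth (chartOpens x₀) (FormAlg d L)}
    (h : ∀ u : chartOpens x₀, GAlg.ev u g = rep X F x₀ u) (u : chartOpens x₀) :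
    GAlg.ev u (GAlg.dSmooth g) = rep X (deRham X F) x₀ u := by
  rw [GAlg.ev_dSmooth, rep_deRham hF u.2]
  exact dAt_congr (GAlg.fn_eventuallyEq h u.2)

end localForm

namespace PtSpace

variable {d : ℕ} {X : ClosedOriented d} {A B : GAlg} {L L' : Test GAlg.IsFinite}

/-- The algebra of forms on the image of a chart, as a parameter algebra. -/
abbrev chartTest (L : Test GAlg.IsFinite) (x₀ : X) : Test GAlg.IsSmooth :=
  smoothTest (chartOpens x₀) (FormAlg d L.1)

/-- A field in the chart at `x₀`. -/
def localPt (Y : (mapSpace X A).Pt L) (x₀ : X) : GAlg.Hom A (chartTest L x₀).1 :=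
  GAlg.smoothHom (fun u => (pullForm L.1 (chartDeriv x₀ u)).comp (Y.1 ((chartAt (Eu d) x₀).symm u)))
    fun a => smoothForm_iff.1 (Y.2 a) x₀

theorem ev_localPt (Y : (mapSpace X A).Pt L) (x₀ : X) (u : chartOpens x₀) :
    GAlg.Hom.comp (GAlg.ev u) (localPt Y x₀) =
      (pullForm L.1 (chartDeriv x₀ u)).comp (Y.1 ((chartAt (Eu d) x₀).symm u)) :=
  GAlg.ev_smoothHom _ _ u

theorem ev_localPt_apply (Y : (mapSpace X A).Pt L) (x₀ : X) (u : chartOpens x₀) (a : A) :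
    GAlg.ev u (localPt Y x₀ a) = rep X (fun p => Y.1 p a) x₀ u := rfl

theorem ev_localPt_center (Y : (mapSpace X A).Pt L) (p : X) :
    GAlg.Hom.comp (GAlg.ev (chartCenter p)) (localPt Y p) = Y.1 p :=
  GAlg.Hom.ext fun a => rep_self (fun q => Y.1 q a) p

/-- A tangent vector in the chart at `x₀`. -/
def localVec {Y : (mapSpace X A).Pt L} {k : ℤ} {v : (mapSpace X A).Vec L}
    (hv : (mapSpace X A).IsTan Y k v) (x₀ : X) (a : A) : (chartTest L x₀).1 :=
  localForm (hv.2 a) x₀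

theorem ev_localVec_center {Y : (mapSpace X A).Pt L} {k : ℤ} {v : (mapSpace X A).Vec L}
    (hv : (mapSpace X A).IsTan Y k v) (p : X) (a : A) :
    GAlg.ev (chartCenter p) (localVec hv p a) = v p a :=
  rep_self (fun q => v q a) p

theorem localVec_isDer {Y : (mapSpace X A).Pt L} {k : ℤ} {v : (mapSpace X A).Vec L}
    (hv : (mapSpace X A).IsTan Y k v) (x₀ : X) : IsDer (localPt Y x₀) k (localVec hv x₀) := by
  refine GAlg.smooth_isDer fun u => ?_
  rw [ev_localPt]
  exact (hv.1 _).comp_hom (pullForm L.1 (chartDeriv x₀ u))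

theorem ev_isDer_dSmooth {x₀ : X} (u : chartOpens x₀) :
    IsDer (GAlg.ev u) 1 (fun f : GAlg.smooth (chartOpens x₀) (FormAlg d L.1) =>
      GAlg.ev u (GAlg.dSmooth f)) :=
  GAlg.dSmooth_isDer.comp_hom (GAlg.ev u)

/-- At the centre of the chart of `p`, the lift is the de Rham derivation of the chart algebra
composed with the local field. -/
theorem dLift_isTan (Y : (mapSpace X A).Pt L) : (mapSpace X A).IsTan Y 1 (dLift X L Y) := by
  refine ⟨fun p => ?_, fun a => smoothForm_deRham (Y.2 a)⟩
  have h := (ev_isDer_dSmooth (L := L) (chartCenter p)).hom_comp (localPt Y p)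
  rw [ev_localPt_center] at h
  have e : (fun a => GAlg.ev (chartCenter p) (GAlg.dSmooth (localPt Y p a))) = dLift X L Y p :=
    funext fun a => ev_dSmooth_local (ev_localPt_apply Y p · a)
  exact e ▸ h

theorem ev_dSmooth_localPt (Y : (mapSpace X A).Pt L) (x₀ : X) (u : chartOpens x₀) (a : A) :
    GAlg.ev u (GAlg.dSmooth (localPt Y x₀ a)) =
      pullForm L.1 (chartDeriv x₀ u) (dLift X L Y ((chartAt (Eu d) x₀).symm u) a) :=
  ev_dSmooth_rep (Y.2 a) (ev_localPt_apply Y x₀ · a) u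

section functions

variable {f : ((spec A).prod (spec B)).Fn} (x : (mapSpace X A).Pt L) (y : (mapSpace X B).Pt L)

/-- Naturality is used twice: for evaluation at `u`, and for pull-back of forms by the derivative of
the inverse chart. -/
theorem ev_fn (hf : IsNatural f) (x₀ : X) (u : chartOpens x₀) :
    GAlg.ev u (f (chartTest L x₀) (localPt x x₀, localPt y x₀)) =
      rep X (fun p => f (formTest d L) (x.1 p, y.1 p)) x₀ u := by
  have h₁ := hf (R := chartTest L x₀) (S := formTest d L) (GAlg.ev u) (localPt x x₀, localPt y x₀)
  have h₂ := hf (R := formTest d L) (S := formTest d L) (pullForm L.1 (chartDeriv x₀ u))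
    (x.1 ((chartAt (Eu d) x₀).symm u), y.1 ((chartAt (Eu d) x₀).symm u))
  refine h₁.symm.trans (Eq.trans (congrArg (f (formTest d L)) ?_) h₂)
  exact Prod.ext (ev_localPt x x₀ u) (ev_localPt y x₀ u)

/-- Evaluated on the field in a chart, `f` takes its value in an algebra of smooth forms, so
smoothness of the density comes for free. -/
theorem smoothForm_fn (hf : IsNatural f) : SmoothForm X fun p => f (formTest d L) (x.1 p, y.1 p) :=
  smoothForm_of_local _ (ev_fn x y hf)

theorem dir_congr {S : Test GAlg.IsSmooth} {k : ℤ} {z z' : ((spec A).prod (spec B)).Pt S}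
    {v v' : ((spec A).prod (spec B)).Vec S} (hv : ((spec A).prod (spec B)).IsTan z k v)
    (hv' : ((spec A).prod (spec B)).IsTan z' k v') (hz : z = z') (hvv : v = v') :
    dir f z v hv = dir f z' v' hv' := by
  subst hz hvv
  rfl

theorem smoothForm_dir (hf : IsNatural f) {k : ℤ} {v : (mapSpace X A).Vec L} {w : (mapSpace X B).Vec L}
    (hv : (mapSpace X A).IsTan x k v) (hw : (mapSpace X B).IsTan y k w) :
    SmoothForm X fun p => dir f (S := formTest d L) (x.1 p, y.1 p) (v p, w p)
      ⟨hv.1 p, hw.1 p⟩ := by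
  refine smoothForm_of_local (fun x₀ => dir f (S := chartTest L x₀)
    (localPt x x₀, localPt y x₀) (localVec hv x₀, localVec hw x₀)
    ⟨localVec_isDer hv x₀, localVec_isDer hw x₀⟩) fun x₀ u => ?_
  have hvx := localVec_isDer hv x₀
  have hwy := localVec_isDer hw x₀
  have h₁ := dir_map (R := chartTest L x₀) (S := formTest d L) hf (GAlg.ev u)
    (z := (localPt x x₀, localPt y x₀)) (v := (localVec hv x₀, localVec hw x₀)) ⟨hvx, hwy⟩
    ⟨hvx.comp_hom (GAlg.ev u), hwy.comp_hom (GAlg.ev u)⟩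
  have h₂ := dir_map (R := formTest d L) (S := formTest d L) hf (pullForm L.1 (chartDeriv x₀ u))
    (z := (x.1 ((chartAt (Eu d) x₀).symm u), y.1 ((chartAt (Eu d) x₀).symm u)))
    (v := (v ((chartAt (Eu d) x₀).symm u), w ((chartAt (Eu d) x₀).symm u))) ⟨hv.1 _, hw.1 _⟩
    ⟨(hv.1 _).comp_hom (pullForm L.1 (chartDeriv x₀ u)),
      (hw.1 _).comp_hom (pullForm L.1 (chartDeriv x₀ u))⟩
  refine h₁.symm.trans (Eq.trans ?_ h₂)
  exact dir_congr _ _ (Prod.ext (ev_localPt x x₀ u) (ev_localPt y x₀ u)) rfl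

/-- The chain rule `dir_eq` for the derivation that applies `d` on the chart algebra and evaluates
at the centre. -/
theorem deRham_fn (hf : IsNatural f) (p : X) : deRham X (fun q => f (formTest d L) (x.1 q, y.1 q)) p =
    dir f (S := formTest d L) (x.1 p, y.1 p) (dLift X L x p, dLift X L y p)
      ⟨(dLift_isTan x).1 p, (dLift_isTan y).1 p⟩ := by
  have h := ev_dSmooth_local (ev_fn x y hf p)
  refine h.symm.trans (dir_eq (R := chartTest L p) (S := formTest d L) (φ := GAlg.ev (chartCenter p))
    (x := localPt x p) (y := localPt y p) (z' := (x.1 p, y.1 p)) hf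
    (ev_isDer_dSmooth (L := L) (chartCenter p)) (v := dLift X L x p) (w := dLift X L y p) _
    ?_ (fun a => ?_) fun a => ?_).symm
  · exact Prod.ext (ev_localPt_center x p) (ev_localPt_center y p)
  · exact ev_dSmooth_local (ev_localPt_apply x p · a)
  · exact ev_dSmooth_local (ev_localPt_apply y p · a)

end functions

section forms

variable {n : ℤ} {α : (spec A).Form1} {ϖ : (spec A).Form2} (Y : (mapSpace X A).Pt L)

theorem ev_form1 (hα : IsForm1 n α) {k : ℤ} {v : (mapSpace X A).Vec L}
    (hv : (mapSpace X A).IsTan Y k v) (x₀ : X) (u : chartOpens x₀) :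
    GAlg.ev u (α (chartTest L x₀) (localPt Y x₀) k (localVec hv x₀)) =
      rep X (fun p => α (formTest d L) (Y.1 p) k (v p)) x₀ u := by
  have h₁ := hα.natural (R := chartTest L x₀) (S := formTest d L) (GAlg.ev u)
    (x := localPt Y x₀) (localVec_isDer hv x₀)
  have h₂ := hα.natural (R := formTest d L) (S := formTest d L) (pullForm L.1 (chartDeriv x₀ u))
    (x := Y.1 ((chartAt (Eu d) x₀).symm u)) (hv.1 _)
  refine h₁.symm.trans (Eq.trans ?_ h₂)
  exact congrArg (fun z => α (formTest d L) z k _) (ev_localPt Y x₀ u)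

theorem smoothForm_form1 (hα : IsForm1 n α) {k : ℤ} {v : (mapSpace X A).Vec L}
    (hv : (mapSpace X A).IsTan Y k v) : SmoothForm X fun p => α (formTest d L) (Y.1 p) k (v p) :=
  smoothForm_of_local _ (ev_form1 Y hα hv)

theorem ev_form2 (hϖ : IsForm2 n ϖ) {k l : ℤ} {v w : (mapSpace X A).Vec L}
    (hv : (mapSpace X A).IsTan Y k v) (hw : (mapSpace X A).IsTan Y l w) (x₀ : X)
    (u : chartOpens x₀) :
    GAlg.ev u (ϖ (chartTest L x₀) (localPt Y x₀) k (localVec hv x₀) l (localVec hw x₀)) =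
      rep X (fun p => ϖ (formTest d L) (Y.1 p) k (v p) l (w p)) x₀ u := by
  have h₁ := hϖ.natural (R := chartTest L x₀) (S := formTest d L) (GAlg.ev u)
    (x := localPt Y x₀) (localVec_isDer hv x₀) (localVec_isDer hw x₀)
  have h₂ := hϖ.natural (R := formTest d L) (S := formTest d L) (pullForm L.1 (chartDeriv x₀ u))
    (x := Y.1 ((chartAt (Eu d) x₀).symm u)) (hv.1 _) (hw.1 _)
  refine h₁.symm.trans (Eq.trans ?_ h₂)
  exact congrArg (fun z => ϖ (formTest d L) z k _ l _) (ev_localPt Y x₀ u)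

theorem smoothForm_form2 (hϖ : IsForm2 n ϖ) {k l : ℤ} {v w : (mapSpace X A).Vec L}
    (hv : (mapSpace X A).IsTan Y k v) (hw : (mapSpace X A).IsTan Y l w) :
    SmoothForm X fun p => ϖ (formTest d L) (Y.1 p) k (v p) l (w p) :=
  smoothForm_of_local _ (ev_form2 Y hϖ hv hw)

theorem vel_isTan {φ : GAlg.Hom L.1 L'.1} {k : ℤ} {D : L.1 →ₗ[ℝ] L'.1} (hD : IsDer φ k D) :
    (mapSpace X A).IsTan ((mapSpace X A).map φ Y) k ((mapSpace X A).vel (S := L') k D Y) :=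
  ⟨fun p => (coeffDer_isDer hD).hom_comp (Y.1 p), fun a => (Y.2 a).coeffDer k D⟩

end forms

end PtSpace

end

noncomputable section

open FormAlg

namespace PtSpace

/-! ### Cartan's formula for fields -/

section fields

variable {d : ℕ} {X : ClosedOriented d} {A B : GAlg} {L L' : Test GAlg.IsFinite}
  {n : ℤ} {α : (spec A).Form1} {ϖ : (spec A).Form2}

theorem localVec_dLift (Y : (mapSpace X A).Pt L) (x₀ : X) :
    localVec (dLift_isTan Y) x₀ = fun a => GAlg.dSmooth (localPt Y x₀ a) :=
  funext fun a => GAlg.smooth_ext fun u => (ev_dSmooth_localPt Y x₀ u a).symm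

theorem localPt_map (φ : GAlg.Hom L.1 L'.1) (Y : (mapSpace X A).Pt L) (x₀ : X) :
    localPt ((mapSpace X A).map (S := L') φ Y) x₀ =
      (GAlg.smoothMap (chartOpens x₀) (coeffMap d φ)).comp (localPt Y x₀) :=
  GAlg.Hom.ext fun _ => GAlg.smooth_ext fun _ => pullForm_coeffMap φ _ _

theorem localVec_vel {φ : GAlg.Hom L.1 L'.1} {k : ℤ} {D : L.1 →ₗ[ℝ] L'.1} (hD : IsDer φ k D)
    (Y : (mapSpace X A).Pt L) (x₀ : X) : localVec (vel_isTan Y hD) x₀ =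
      fun a => GAlg.smoothApp (chartOpens x₀) (coeffDer d k D) (localPt Y x₀ a) :=
  funext fun _ => GAlg.smooth_ext fun _ => pullForm_coeffDer k D _ _

theorem ev_form1_center (hα : IsForm1 n α) (Y : (mapSpace X A).Pt L) {k : ℤ}
    {v : (mapSpace X A).Vec L} (hv : (mapSpace X A).IsTan Y k v) (p : X) :
    GAlg.ev (chartCenter p) (α (chartTest L p) (localPt Y p) k (localVec hv p)) =
      α (formTest d L) (Y.1 p) k (v p) :=
  (ev_form1 Y hα hv p (chartCenter p)).trans (rep_self _ p)

theorem ev_form2_center (hϖ : IsForm2 n ϖ) (Y : (mapSpace X A).Pt L) {k l : ℤ}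
    {v w : (mapSpace X A).Vec L} (hv : (mapSpace X A).IsTan Y k v)
    (hw : (mapSpace X A).IsTan Y l w) (p : X) :
    GAlg.ev (chartCenter p) (ϖ (chartTest L p) (localPt Y p) k (localVec hv p) l (localVec hw p)) =
      ϖ (formTest d L) (Y.1 p) k (v p) l (w p) :=
  (ev_form2 Y hϖ hv hw p (chartCenter p)).trans (rep_self _ p)

theorem smoothApp_dSmooth {U : Opens (Eu d)} {φ : GAlg.Hom L.1 L'.1} {k : ℤ} {D : L.1 →ₗ[ℝ] L'.1}
    (hD : IsDer φ k D) (r : GAlg.smooth U (FormAlg d L.1)) :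
    GAlg.smoothApp U (coeffDer d k D) (GAlg.dSmooth r) =
      k.negOnePow • GAlg.dSmooth (GAlg.smoothApp U (coeffDer d k D) r) := by
  rw [GAlg.dSmooth_coeffDer hD, smul_smul, units_mul_self, one_smul]

/-- `form2_along` over the chart algebras at `p`, with `d` as the differentials and `D` acting on
coefficients, evaluated at the centre. Up to an exact term, contraction with the lifted de Rham
differential is the variation of the kinetic density. -/
theorem form2_dLift_vel (hα : IsForm1 n α) (hϖ : IsForm2 n ϖ) (hext : IsExtDeriv α ϖ)
    {φ : GAlg.Hom L.1 L'.1} {k : ℤ} {D : L.1 →ₗ[ℝ] L'.1} (hD : IsDer φ k D)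
    (Y : (mapSpace X A).Pt L) (p : X) :
    ϖ (formTest d L') (((mapSpace X A).map (S := L') φ Y).1 p) 1
        (dLift X L' ((mapSpace X A).map (S := L') φ Y) p) k
        ((mapSpace X A).vel (S := L') k D Y p) =
      (k - 1).negOnePow • deRham X (fun q => α (formTest d L')
        (((mapSpace X A).map (S := L') φ Y).1 q) k ((mapSpace X A).vel (S := L') k D Y q)) p +
      coeffDer d k D (α (formTest d L) (Y.1 p) 1 (dLift X L Y p)) := by
  let Y' := (mapSpace X A).map (S := L') φ Y
  let U := chartOpens p
  have h := form2_along (R := chartTest L p) (S := chartTest L' p) hα hϖ hext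
    (φ := GAlg.smoothMap U (coeffMap d φ)) (D := GAlg.smoothApp U (coeffDer d k D))
    (GAlg.smoothApp_isDer (coeffDer_isDer hD)) GAlg.dSmooth_isDer GAlg.dSmooth_isDer
    (fun r => (GAlg.dSmooth_coeffMap φ r).symm)
    (smoothApp_dSmooth hD) (localPt Y p)
  have e1 : (fun a => GAlg.dSmooth (GAlg.smoothMap U (coeffMap d φ) (localPt Y p a))) =
      localVec (dLift_isTan Y') p := by
    rw [localVec_dLift, localPt_map]
    rfl
  have h' : ϖ (chartTest L' p) (localPt Y' p) 1 (localVec (dLift_isTan Y') p) k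
      (localVec (vel_isTan Y hD) p) = (k - 1).negOnePow • GAlg.dSmooth
        (α (chartTest L' p) (localPt Y' p) k (localVec (vel_isTan Y hD) p)) +
      GAlg.smoothApp U (coeffDer d k D) (α (chartTest L p) (localPt Y p) 1
        (localVec (dLift_isTan Y) p)) := by
    rw [← e1, localVec_vel hD, localVec_dLift, show localPt Y' p = _ from localPt_map φ Y p]
    exact h
  have h'' := congrArg (GAlg.ev (chartCenter p)) h'
  rw [GAlg.Hom.map_add, GAlg.Hom.map_units] at h''
  refine (ev_form2_center hϖ Y' (dLift_isTan Y') (vel_isTan Y hD) p).symm.trans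
    (h''.trans (congrArg₂ _ (congrArg _ ?_) ?_))
  · exact ev_dSmooth_local (ev_form1 Y' hα (vel_isTan Y hD) p)
  · exact congrArg (coeffDer d k D) (ev_form1_center hα Y (dLift_isTan Y) p)

/-- Cartan's formula with both derivations equal to `d`, whose graded commutator is `2 d² = 0`. -/
theorem form2_dLift_dLift (hα : IsForm1 n α) (hϖ : IsForm2 n ϖ) (hext : IsExtDeriv α ϖ)
    (Y : (mapSpace X A).Pt L) (p : X) :
    ϖ (formTest d L) (Y.1 p) 1 (dLift X L Y p) 1 (dLift X L Y p) =
      deRham X (fun q => α (formTest d L) (Y.1 q) 1 (dLift X L Y q)) p +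
      deRham X (fun q => α (formTest d L) (Y.1 q) 1 (dLift X L Y q)) p := by
  let U := chartOpens p
  let δ : (chartTest L p).1 →ₗ[ℝ] (chartTest L p).1 :=
    (GAlg.dSmooth_isDer (U := U) (L := L.1)).toLin
  have h := hext (R := chartTest L p) (localPt Y p) δ δ GAlg.dSmooth_isDer GAlg.dSmooth_isDer
  have hc : (fun a => (δ ∘ₗ δ - ((1 : ℤ) * 1).negOnePow • (δ ∘ₗ δ)) (localPt Y p a)) =
      fun _ => 0 := by
    have : δ ∘ₗ δ = 0 := LinearMap.ext fun f => GAlg.dSmooth_dSmooth f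
    simp [this]
  have h0 : α (chartTest L p) (localPt Y p) (1 + 1) (fun _ => 0) = 0 :=
    hα.map_zero (X := spec A) (x := localPt Y p) IsDer.zero
  have h' : ϖ (chartTest L p) (localPt Y p) 1 (localVec (dLift_isTan Y) p) 1
      (localVec (dLift_isTan Y) p) = ((1 : ℤ) * (1 - 1)).negOnePow • (δ
        (α (chartTest L p) (localPt Y p) 1 (localVec (dLift_isTan Y) p)) - 0) -
      (1 : ℤ).negOnePow • δ
        (α (chartTest L p) (localPt Y p) 1 (localVec (dLift_isTan Y) p)) := by
    rw [localVec_dLift, ← h0, ← hc]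
    exact h
  rw [sub_zero, sub_self, mul_zero, Int.negOnePow_zero, one_smul, Int.negOnePow_one,
    Units.neg_smul, one_smul, sub_neg_eq_add] at h'
  have h'' := (congrArg (GAlg.ev (chartCenter p)) h').trans (GAlg.Hom.map_add _ _ _)
  have e := ev_dSmooth_local (ev_form1 Y hα (dLift_isTan Y) p)
  exact (ev_form2_center hϖ Y (dLift_isTan Y) (dLift_isTan Y) p).symm.trans
    (h''.trans (congrArg₂ _ e e))

theorem coeffDer_fn {f : ((spec A).prod (spec B)).Fn} (hf : IsNatural f)
    {φ : GAlg.Hom L.1 L'.1} {k : ℤ} {D : L.1 →ₗ[ℝ] L'.1} (hD : IsDer φ k D)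
    (x : GAlg.Hom A (formTest d L).1) (y : GAlg.Hom B (formTest d L).1)
    {z : ((spec A).prod (spec B)).Pt (formTest d L')} {v : A → (formTest d L').1}
    {w : B → (formTest d L').1} (hv : ((spec A).prod (spec B)).IsTan z k (v, w))
    (hz : ((coeffMap d φ).comp x, (coeffMap d φ).comp y) = z) (h₁ : ∀ a, coeffDer d k D (x a) = v a)
    (h₂ : ∀ b, coeffDer d k D (y b) = w b) :
    coeffDer d k D (f (formTest d L) (x, y)) = dir f z (v, w) hv :=
  (dir_eq (R := formTest d L) (S := formTest d L') (φ := coeffMap d φ) hf (coeffDer_isDer hD) hv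
    hz h₁ h₂).symm

theorem dLift_map (φ : GAlg.Hom L.1 L'.1) (Y : (mapSpace X A).Pt L) :
    dLift X L' ((mapSpace X A).map (S := L') φ Y) =
      (mapSpace X A).mapVec (S := L') φ (dLift X L Y) :=
  funext fun p => funext fun a => deRham_coeffMap (Y.2 a) φ p

end fields

/-! ### Hamiltonian vector fields on the target -/

section target

variable {A B : GAlg} {S : Test GAlg.IsSmooth}

/-- A function on a space, as a function on the product of the space with itself. -/
def fstFn (f : (spec A).Fn) : ((spec A).prod (spec A)).Fn := fun R z => f R z.1

theorem fstFn_natural {f : (spec A).Fn} {m : ℤ} (hf : IsFn m f) : IsNatural (fstFn f) :=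
  fun φ z => hf.natural φ z.1

/-- The components of a vector field. -/
def vfFn (Q : (spec A).VF) (a : A) : ((spec A).prod (spec A)).Fn := fun R z => Q R z.1 a

theorem vfFn_natural {Q : (spec A).VF} {m : ℤ} (hQ : IsVF m Q) (a : A) : IsNatural (vfFn Q a) :=
  fun φ z => congrFun (hQ.natural φ z.1) a

/-- The components of a vertical vector field. -/
def vertFn (V : VertVF (spec A) (spec B)) (b : B) : ((spec A).prod (spec B)).Fn :=
  fun R z => V R z.1 z.2 b

theorem vertFn_natural {V : VertVF (spec A) (spec B)} {m : ℤ} (hV : IsVF m (ver V)) (b : B) :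
    IsNatural (vertFn V b) :=
  fun φ z => congrFun (congrArg Prod.snd (hV.natural φ z)) b

/-- The Hamiltonian condition is tested on the family `z + εv` over `S[ε]`, whose velocity under the
`ε`-coefficient is the arbitrary tangent vector `v`. The next two lemmas use the same family with `v
= Q`. -/
theorem hamiltonian_dir {ϖ : (spec A).Form2} {Θ : (spec A).Fn} {Q : (spec A).VF}
    (h : IsHamiltonian ϖ Θ Q) {k : ℤ} {z : GAlg.Hom A S.1} {v : A → S.1} (hv : IsDer z k v) :
    ϖ S z 1 (Q S z) k v = dir (fstFn Θ) (S := S) (z, z) (v, v) ⟨hv, hv⟩ :=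
  h (R := sqTest S fun _ : Unit => k) (S := S) (GAlg.sqFst S.1 fun _ : Unit => k)
    (GAlg.sqSnd S.1 (fun _ : Unit => k) ()) (GAlg.sqMk z (fun _ => v) fun _ => hv)
    (GAlg.sqSnd_isDer (GAlg.Hom.id S.1) ())

theorem derives_dir {f g : (spec A).Fn} {Q : (spec A).VF} (h : Derives 1 Q f g)
    {z : GAlg.Hom A S.1} (hv : IsDer z 1 (Q S z)) :
    dir (fstFn f) (S := S) (z, z) (Q S z, Q S z) ⟨hv, hv⟩ = g S z :=
  h (R := sqTest S fun _ : Unit => (1 : ℤ)) (S := S) (GAlg.sqFst S.1 fun _ : Unit => (1 : ℤ))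
    (GAlg.sqSnd S.1 (fun _ : Unit => (1 : ℤ)) ()) (GAlg.sqMk z (fun _ => Q S z) fun _ => hv)
    (GAlg.sqSnd_isDer (GAlg.Hom.id S.1) ()) rfl

theorem sqZero_dir {Q : (spec A).VF} (h : SqZero Q) {z : GAlg.Hom A S.1} (hv : IsDer z 1 (Q S z))
    (a : A) : dir (vfFn Q a) (S := S) (z, z) (Q S z, Q S z) ⟨hv, hv⟩ = 0 :=
  congrFun (h (R := sqTest S fun _ : Unit => (1 : ℤ)) (S := S)
    (GAlg.sqFst S.1 fun _ : Unit => (1 : ℤ))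
    (GAlg.sqSnd S.1 (fun _ : Unit => (1 : ℤ)) ()) (GAlg.sqMk z (fun _ => Q S z) fun _ => hv)
    (GAlg.sqSnd_isDer (GAlg.Hom.id S.1) ()) rfl) a

end target

end PtSpace

end

noncomputable section

open FormAlg

namespace PtSpace

/-! ### Transgression of forms -/

section transgression

variable {d : ℕ} {X : ClosedOriented d} {A : GAlg} {n : ℤ} {α : (spec A).Form1}
  {ϖ : (spec A).Form2}

section densities

variable {L L' : Test GAlg.IsFinite} (Y : (mapSpace X A).Pt L)

variable (α) in
/-- The form on the source whose integral is the transgression of a one-form. -/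
def density1 (k : ℤ) (v : (mapSpace X A).Vec L) : X → FormAlg d L.1 :=
  fun p => α (formTest d L) (Y.1 p) k (v p)

variable (ϖ) in
/-- The form on the source whose integral is the transgression of a two-form. -/
def density2 (k : ℤ) (v : (mapSpace X A).Vec L) (l : ℤ) (w : (mapSpace X A).Vec L) :
    X → FormAlg d L.1 :=
  fun p => ϖ (formTest d L) (Y.1 p) k (v p) l (w p)

theorem trans1_eq (k : ℤ) (v : (mapSpace X A).Vec L) :
    trans1 X α L Y k v = ((k - 1) * d).negOnePow • fiberIntegral X (density1 α Y k v) := rfl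

theorem akszΩ_eq (k l : ℤ) (v w : (mapSpace X A).Vec L) :
    akszΩ X ϖ L Y k v l w = ((k + l - 1) * d).negOnePow •
      fiberIntegral X (density2 ϖ Y k v l w) := by
  rw [akszΩ, trans2, smul_smul, ← Int.negOnePow_add]
  exact congrArg₂ _ (negOnePow_congr (n := (k + l - 1) * d) (k := 0) (by ring)) rfl

variable {Y}
variable {k l : ℤ} {v v' w w' : (mapSpace X A).Vec L}

theorem density1_smooth (hα : IsForm1 n α) (hv : (mapSpace X A).IsTan Y k v) :
    SmoothForm X (density1 α Y k v) :=
  smoothForm_form1 Y hα hv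

theorem density1_mem (hα : IsForm1 n α) (hv : (mapSpace X A).IsTan Y k v) (p : X) :
    density1 α Y k v p ∈ (FormAlg d L.1).gr (n + k) :=
  hα.deg (R := formTest d L) (x := Y.1 p) (v := v p) (hv.1 p)

theorem density1_add (hα : IsForm1 n α) (hv : (mapSpace X A).IsTan Y k v)
    (hw : (mapSpace X A).IsTan Y k w) :
    density1 α Y k (v + w) = fun p => density1 α Y k v p + density1 α Y k w p :=
  funext fun p => hα.add (R := formTest d L) (x := Y.1 p) (v := v p) (w := w p) (hv.1 p) (hw.1 p)

theorem density1_smul (hα : IsForm1 n α) (hv : (mapSpace X A).IsTan Y k v) {j : ℤ} {r : L.1}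
    (hr : r ∈ L.1.gr j) : density1 α Y (j + k) ((mapSpace X A).smul r v) =
      fun p => coeffIncl d r * density1 α Y k v p :=
  funext fun p => hα.smul (R := formTest d L) (x := Y.1 p) (v := v p) (hv.1 p) (coeffIncl_mem hr)

theorem density1_map (hα : IsForm1 n α) (hv : (mapSpace X A).IsTan Y k v)
    (φ : GAlg.Hom L.1 L'.1) :
    density1 α ((mapSpace X A).map (S := L') φ Y) k ((mapSpace X A).mapVec (S := L') φ v) =
      fun p => coeffMap d φ (density1 α Y k v p) :=
  funext fun p => hα.natural (R := formTest d L) (S := formTest d L') (x := Y.1 p) (v := v p)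
    (coeffMap d φ) (hv.1 p)

theorem density2_smooth (hϖ : IsForm2 n ϖ) (hv : (mapSpace X A).IsTan Y k v)
    (hw : (mapSpace X A).IsTan Y l w) : SmoothForm X (density2 ϖ Y k v l w) :=
  smoothForm_form2 Y hϖ hv hw

theorem density2_mem (hϖ : IsForm2 n ϖ) (hv : (mapSpace X A).IsTan Y k v)
    (hw : (mapSpace X A).IsTan Y l w) (p : X) :
    density2 ϖ Y k v l w p ∈ (FormAlg d L.1).gr (n + k + l) :=
  hϖ.deg (R := formTest d L) (x := Y.1 p) (v := v p) (w := w p) (hv.1 p) (hw.1 p)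

theorem density2_symm (hϖ : IsForm2 n ϖ) (hv : (mapSpace X A).IsTan Y k v)
    (hw : (mapSpace X A).IsTan Y l w) : density2 ϖ Y k v l w =
      fun p => ((k - 1) * (l - 1)).negOnePow • density2 ϖ Y l w k v p :=
  funext fun p => hϖ.symm (R := formTest d L) (x := Y.1 p) (v := v p) (w := w p) (hv.1 p) (hw.1 p)

theorem density2_add (hϖ : IsForm2 n ϖ) (hv : (mapSpace X A).IsTan Y k v)
    (hw : (mapSpace X A).IsTan Y l w) (hw' : (mapSpace X A).IsTan Y l w') :
    density2 ϖ Y k v l (w + w') =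
      fun p => density2 ϖ Y k v l w p + density2 ϖ Y k v l w' p :=
  funext fun p => hϖ.add (R := formTest d L) (x := Y.1 p) (v := v p) (w := w p) (w' := w' p)
    (hv.1 p) (hw.1 p) (hw'.1 p)

theorem density2_smul (hϖ : IsForm2 n ϖ) (hv : (mapSpace X A).IsTan Y k v)
    (hw : (mapSpace X A).IsTan Y l w) {j : ℤ} {r : L.1} (hr : r ∈ L.1.gr j) :
    density2 ϖ Y k v (j + l) ((mapSpace X A).smul r w) =
      fun p => coeffIncl d r * density2 ϖ Y k v l w p :=
  funext fun p => hϖ.smul (R := formTest d L) (x := Y.1 p) (v := v p) (w := w p) (hv.1 p) (hw.1 p)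
    (coeffIncl_mem hr)

theorem density2_map (hϖ : IsForm2 n ϖ) (hv : (mapSpace X A).IsTan Y k v)
    (hw : (mapSpace X A).IsTan Y l w) (φ : GAlg.Hom L.1 L'.1) :
    density2 ϖ ((mapSpace X A).map (S := L') φ Y) k ((mapSpace X A).mapVec (S := L') φ v) l
      ((mapSpace X A).mapVec (S := L') φ w) = fun p => coeffMap d φ (density2 ϖ Y k v l w p) :=
  funext fun p => hϖ.natural (R := formTest d L) (S := formTest d L') (x := Y.1 p) (v := v p)
    (w := w p) (coeffMap d φ) (hv.1 p) (hw.1 p)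

end densities

theorem trans1_isForm1 (hα : IsForm1 n α) (hd : (d : ℤ) = n + 1) : IsForm1 (-1) (trans1 X α) where
  deg {L Y k v} hv := by
    have h := fiberIntegral_mem (density1_smooth hα hv) (density1_mem hα hv)
    rw [hd, show n + k - (n + 1) = -1 + k by ring] at h
    exact GAlg.units_smul_mem _ _ h
  add {L Y k v w} hv hw := by
    rw [trans1_eq, density1_add hα hv hw, fiberIntegral_add (density1_smooth hα hv)
      (density1_smooth hα hw), smul_add]
    rfl
  smul {L Y k v j r} hv hr := by
    rw [trans1_eq, density1_smul hα hv hr, fiberIntegral_coeffIncl (density1_smooth hα hv) hr,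
      smul_smul, trans1_eq, mul_smul_comm, ← Int.negOnePow_add]
    -- The sign `(-1)^{jd}` of taking `r` out of the integral cancels the change of the
    -- transgression sign as the degree goes from `k` to `j + k`.
    exact congrArg₂ _ (negOnePow_congr (k := j * d) (by ring)) rfl
  natural {L L'} φ {Y k v} hv := by
    rw [trans1_eq, density1_map hα hv, fiberIntegral_coeffMap (density1_smooth hα hv), trans1_eq,
      GAlg.Hom.map_units]

theorem akszΩ_isForm2 (hϖ : IsForm2 n ϖ) (hd : (d : ℤ) = n + 1) : IsForm2 (-1) (akszΩ X ϖ) where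
  deg {L Y k v l w} hv hw := by
    have h := fiberIntegral_mem (density2_smooth hϖ hv hw) (density2_mem hϖ hv hw)
    rw [hd, show n + k + l - (n + 1) = -1 + k + l by ring] at h
    rw [akszΩ_eq]
    exact GAlg.units_smul_mem _ _ h
  symm {L Y k v l w} hv hw := by
    rw [akszΩ_eq, akszΩ_eq, density2_symm hϖ hv hw, fiberIntegral_units (density2_smooth hϖ hw hv),
      smul_smul, smul_smul, add_comm l k, mul_comm]
  add {L Y k v l w w'} hv hw hw' := by
    rw [akszΩ_eq, akszΩ_eq, akszΩ_eq, density2_add hϖ hv hw hw',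
      fiberIntegral_add (density2_smooth hϖ hv hw) (density2_smooth hϖ hv hw'), smul_add]
  smul {L Y k v l w j r} hv hw hr := by
    rw [akszΩ_eq, akszΩ_eq, density2_smul hϖ hv hw hr,
      fiberIntegral_coeffIncl (density2_smooth hϖ hv hw) hr, smul_smul, mul_smul_comm,
      ← Int.negOnePow_add]
    exact congrArg₂ _ (negOnePow_congr (k := j * d) (by ring)) rfl
  natural {L L'} φ {Y k v l w} hv hw := by
    rw [akszΩ_eq, akszΩ_eq, density2_map hϖ hv hw, fiberIntegral_coeffMap (density2_smooth hϖ hv hw),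
      GAlg.Hom.map_units]

/-! ### Exactness of the BV form -/

theorem coeffMap_id (L : GAlg) : coeffMap d (GAlg.Hom.id L) = GAlg.Hom.id (FormAlg d L) :=
  hom_ext_mk fun _ _ _ _ _ _ => rfl

theorem map_id {L : Test GAlg.IsFinite} (Y : (mapSpace X A).Pt L) :
    (mapSpace X A).map (S := L) (GAlg.Hom.id L.1) Y = Y := by
  refine Subtype.ext (funext fun p => GAlg.Hom.ext fun a => ?_)
  exact congrArg (fun φ : GAlg.Hom (FormAlg d L.1) (FormAlg d L.1) => φ (Y.1 p a))
    (coeffMap_id L.1)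

theorem vel_isTan_id {L : Test GAlg.IsFinite} (Y : (mapSpace X A).Pt L) {k : ℤ}
    {D : L.1 →ₗ[ℝ] L.1} (hD : IsDer (GAlg.Hom.id L.1) k D) :
    (mapSpace X A).IsTan Y k ((mapSpace X A).vel (S := L) k D Y) := by
  have h := vel_isTan Y hD
  rwa [map_id] at h

/-- Makes the velocity under the bracket a tangent vector, so that the bracket term of Cartan's
formula has a smooth density. -/
theorem commutator_isDer {L : GAlg} {k l : ℤ} {D E : L →ₗ[ℝ] L}
    (hD : IsDer (GAlg.Hom.id L) k D) (hE : IsDer (GAlg.Hom.id L) l E) :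
    IsDer (GAlg.Hom.id L) (k + l) (D ∘ₗ E - (k * l).negOnePow • (E ∘ₗ D) : L →ₗ[ℝ] L) where
  map_add := map_add _
  map_smul := map_smul _
  map_gr {i a} ha := by
    rw [LinearMap.sub_apply]
    refine Submodule.sub_mem _ ?_ ?_
    · rw [add_assoc]; exact hD.map_gr (hE.map_gr ha)
    · rw [units_smul_eq_real, LinearMap.smul_apply]
      refine Submodule.smul_mem _ _ ?_
      rw [add_comm k l, add_assoc]; exact hE.map_gr (hD.map_gr ha)
  leibniz {i a} b ha := by
    have hid : ∀ x : L, GAlg.Hom.id L x = x := fun _ => rfl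
    have h1 : ∀ x, (D ∘ₗ E - (k * l).negOnePow • (E ∘ₗ D) : L →ₗ[ℝ] L) x =
        D (E x) - (k * l).negOnePow • E (D x) := fun x => by
      rw [LinearMap.sub_apply, units_smul_eq_real, units_smul_eq_real]; rfl
    rw [h1, h1, h1, hE.leibniz b ha, hD.leibniz b ha, map_add, map_add, map_units_smul,
      map_units_smul]
    simp only [hid]
    rw [hD.leibniz _ (hE.map_gr ha), hD.leibniz _ ha, hE.leibniz _ (hD.map_gr ha),
      hE.leibniz _ ha]
    simp only [hid]
    have e1 : ((k * l).negOnePow * (l * (k + i)).negOnePow : ℤˣ) = (l * i).negOnePow := by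
      rw [← Int.negOnePow_add]; exact negOnePow_congr (k := k * l) (by ring)
    have e2 : ((k * (l + i)).negOnePow : ℤˣ) = (k * l).negOnePow * (k * i).negOnePow := by
      rw [← Int.negOnePow_add]; exact congrArg _ (by ring)
    have e3 : (((k + l) * i).negOnePow : ℤˣ) = (k * i).negOnePow * (l * i).negOnePow := by
      rw [← Int.negOnePow_add]; exact congrArg _ (by ring)
    simp only [smul_add, smul_sub, mul_sub, sub_mul, smul_smul, mul_smul_comm, smul_mul_assoc, e1,
      e2, e3, mul_comm (l * i).negOnePow, mul_comm ((k * l).negOnePow) (k * i).negOnePow,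
      ← mul_assoc]
    rw [mul_right_comm (k * i).negOnePow (k * l).negOnePow]
    abel

/-- Exactness on the target with form-valued parameters; passing from derivations of coefficients to
derivations of forms respects graded commutators. Differences are written with the unit `-1` so that
integration can proceed by its rules for sums and unit multiples. -/
theorem density2_vel_vel (hext : IsExtDeriv α ϖ) {L : Test GAlg.IsFinite}
    (Y : (mapSpace X A).Pt L) {k l : ℤ} {D E : L.1 →ₗ[ℝ] L.1} (hD : IsDer (GAlg.Hom.id L.1) k D)
    (hE : IsDer (GAlg.Hom.id L.1) l E) (p : X) :
    density2 ϖ Y k ((mapSpace X A).vel (S := L) k D Y) l ((mapSpace X A).vel (S := L) l E Y) p =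
      (k * (l - 1)).negOnePow •
        (coeffDer d k D (density1 α Y l ((mapSpace X A).vel (S := L) l E Y) p) +
          (-1 : ℤˣ) • density1 α Y (k + l) ((mapSpace X A).vel (S := L) (k + l)
            (D ∘ₗ E - (k * l).negOnePow • (E ∘ₗ D)) Y) p) +
      (-1 : ℤˣ) • k.negOnePow •
        coeffDer d l E (density1 α Y k ((mapSpace X A).vel (S := L) k D Y) p) := by
  have hD' : IsDer (GAlg.Hom.id (FormAlg d L.1)) k (coeffDer d k D) := by
    rw [← coeffMap_id]; exact coeffDer_isDer hD
  have hE' : IsDer (GAlg.Hom.id (FormAlg d L.1)) l (coeffDer d l E) := by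
    rw [← coeffMap_id]; exact coeffDer_isDer hE
  have h := hext (R := formTest d L) (Y.1 p) (coeffDer d k D) (coeffDer d l E) hD' hE'
  have hc : ∀ x : FormAlg d L.1, (coeffDer d k D ∘ₗ coeffDer d l E -
      (k * l).negOnePow • (coeffDer d l E ∘ₗ coeffDer d k D)) x =
      coeffDer d (k + l) (D ∘ₗ E - (k * l).negOnePow • (E ∘ₗ D)) x := fun x => by
    rw [coeffDer_sub, coeffDer_units, ← coeffDer_comp, add_comm k l, ← coeffDer_comp,
      LinearMap.sub_apply, units_smul_eq_real, units_smul_eq_real]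
    rfl
  have hc' : (spec A).vel (R := formTest d L) (S := formTest d L) (k + l)
      (coeffDer d k D ∘ₗ coeffDer d l E -
        (k * l).negOnePow • (coeffDer d l E ∘ₗ coeffDer d k D)) (Y.1 p) =
      (mapSpace X A).vel (S := L) (k + l) (D ∘ₗ E - (k * l).negOnePow • (E ∘ₗ D)) Y p :=
    funext fun a => hc (Y.1 p a)
  rw [Units.neg_smul, one_smul, Units.neg_smul, one_smul, ← sub_eq_add_neg, ← sub_eq_add_neg]
  exact h.trans (congrArg₂ (· - ·) (congrArg _ (congrArg₂ (· - ·) rfl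
    (congrArg (α (formTest d L) (Y.1 p) (k + l)) hc'))) rfl)

/-- Taking derivations of degrees `k` and `l` out of the integral costs `(-1)^{kd}` and `(-1)^{ld}`.
The normalisation `(-1)^d` of the BV form is exactly what makes all three terms match the
transgression signs of `α`. -/
theorem akszΩ_exact (hα : IsForm1 n α) (hext : IsExtDeriv α ϖ) :
    IsExtDeriv (trans1 X α) (akszΩ X ϖ) := by
  intro L Y k l D E hD hE
  have hvD := vel_isTan_id Y hD
  have hvE := vel_isTan_id Y hE
  have hvC := vel_isTan_id Y (commutator_isDer hD hE)
  have h1 := density1_smooth hα hvE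
  have h2 := density1_smooth hα hvC
  have h3 := density1_smooth hα hvD
  have hp := funext (density2_vel_vel hext Y hD hE)
  rw [akszΩ_eq, hp, fiberIntegral_add (((h1.coeffDer k D).add (h2.units _)).units _)
    (((h3.coeffDer l E).units _).units _), fiberIntegral_units ((h1.coeffDer k D).add (h2.units _)),
    fiberIntegral_add (h1.coeffDer k D) (h2.units _), fiberIntegral_coeffDer h1,
    fiberIntegral_units h2, fiberIntegral_units ((h3.coeffDer l E).units _),
    fiberIntegral_units (h3.coeffDer l E), fiberIntegral_coeffDer h3, trans1_eq, trans1_eq,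
    trans1_eq, map_units_smul, map_units_smul]
  have e1 : (((l - 1) * d).negOnePow : ℤˣ) = ((k + l - 1) * d).negOnePow * (k * d).negOnePow := by
    rw [← Int.negOnePow_add]; exact negOnePow_congr (k := - (k * d)) (by ring)
  have e2 : (((k - 1) * d).negOnePow : ℤˣ) = ((k + l - 1) * d).negOnePow * (l * d).negOnePow := by
    rw [← Int.negOnePow_add]; exact negOnePow_congr (k := - (l * d)) (by ring)
  rw [e1, e2]
  simp only [smul_add, smul_sub, smul_smul, Units.neg_smul, one_smul, neg_mul, one_mul, mul_neg,
    ← sub_eq_add_neg, mul_one, smul_neg]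
  simp only [mul_left_comm, mul_comm, mul_assoc]

end transgression

end PtSpace

end

noncomputable section

open FormAlg MeasureTheory

/-! ### Extension by zero of forms supported in a chart -/

section extension

variable {d : ℕ} {X : ClosedOriented d} {L : GAlg} {x₀ : X}

/-- The derivative of the preferred chart at `x₀`. -/
def chartInv (x₀ p : X) : Eu d →L[ℝ] Eu d :=
  mfderiv 𝓘(ℝ, Eu d) 𝓘(ℝ, Eu d) (chartAt (Eu d) x₀) p

theorem chartInv_comp_chartDeriv {u : Eu d} (hu : u ∈ (chartAt (Eu d) x₀).target) :
    (chartInv x₀ ((chartAt (Eu d) x₀).symm u)).comp (chartDeriv x₀ u) =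
      ContinuousLinearMap.id ℝ (Eu d) :=
  (mdifferentiable_chart (I := 𝓘(ℝ, Eu d)) x₀).comp_symm_deriv hu

theorem chartDeriv_comp_chartInv {p : X} (hp : p ∈ (chartAt (Eu d) x₀).source) :
    (chartDeriv x₀ (chartAt (Eu d) x₀ p)).comp (chartInv x₀ p) =
      ContinuousLinearMap.id ℝ (Eu d) :=
  (mdifferentiable_chart (I := 𝓘(ℝ, Eu d)) x₀).symm_comp_deriv hp

theorem chartSign_ne_zero {u : Eu d} (hu : u ∈ (chartAt (Eu d) x₀).target) :
    chartSign X.sgn x₀ u ≠ 0 := by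
  have h : LinearMap.det (chartDeriv x₀ u : Eu d →ₗ[ℝ] Eu d) ≠ 0 := by
    intro h0
    have h1 := congrArg (fun T : Eu d →L[ℝ] Eu d => (T : Eu d →ₗ[ℝ] Eu d))
      (chartInv_comp_chartDeriv (X := X) hu)
    have h2 := LinearMap.det_comp (chartInv x₀ ((chartAt (Eu d) x₀).symm u) : Eu d →ₗ[ℝ] Eu d)
      (chartDeriv x₀ u : Eu d →ₗ[ℝ] Eu d)
    rw [h0, mul_zero] at h2
    have h3 : (LinearMap.id : Eu d →ₗ[ℝ] Eu d) =
      (chartInv x₀ ((chartAt (Eu d) x₀).symm u) : Eu d →ₗ[ℝ] Eu d) ∘ₗ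
        (chartDeriv x₀ u : Eu d →ₗ[ℝ] Eu d) := h1.symm
    rw [← h3, LinearMap.det_id] at h2
    exact one_ne_zero h2
  refine mul_ne_zero ?_ fun h' => h (Real.sign_eq_zero_iff.1 h')
  exact_mod_cast Units.ne_zero _

open Classical in
/-- The form with expression `G` in the chart at `x₀`, extended by zero. -/
def extendForm (x₀ : X) (G : Eu d → FormAlg d L) (p : X) : FormAlg d L :=
  if p ∈ (chartAt (Eu d) x₀).source then pullForm L (chartInv x₀ p) (G (chartAt (Eu d) x₀ p)) else 0

theorem extendForm_of_mem {G : Eu d → FormAlg d L} {p : X} (hp : p ∈ (chartAt (Eu d) x₀).source) :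
    extendForm x₀ G p = pullForm L (chartInv x₀ p) (G (chartAt (Eu d) x₀ p)) :=
  if_pos hp

theorem rep_extendForm {G : Eu d → FormAlg d L} {u : Eu d}
    (hu : u ∈ (chartAt (Eu d) x₀).target) : rep X (extendForm x₀ G) x₀ u = G u := by
  rw [rep, extendForm_of_mem ((chartAt (Eu d) x₀).map_target hu), (chartAt (Eu d) x₀).right_inv hu,
    ← pullForm_comp, chartInv_comp_chartDeriv hu, pullForm_id]

theorem extendForm_eq_zero {G : Eu d → FormAlg d L} {K : Set (Eu d)} (h0 : ∀ u, u ∉ K → G u = 0)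
    {p : X} (hp : p ∉ (chartAt (Eu d) x₀).symm '' K) : extendForm x₀ G p = 0 := by
  by_cases hs : p ∈ (chartAt (Eu d) x₀).source
  · rw [extendForm_of_mem hs, h0, GAlg.Hom.map_zero]
    exact fun h => hp ⟨_, h, (chartAt (Eu d) x₀).left_inv hs⟩
  · exact if_neg hs

theorem image_symm_compact {K : Set (Eu d)} (hK : IsCompact K)
    (hKt : K ⊆ (chartAt (Eu d) x₀).target) : IsCompact ((chartAt (Eu d) x₀).symm '' K) :=
  hK.image_of_continuousOn ((chartAt (Eu d) x₀).continuousOn_symm.mono hKt)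

theorem image_symm_subset {K : Set (Eu d)} (hKt : K ⊆ (chartAt (Eu d) x₀).target) :
    (chartAt (Eu d) x₀).symm '' K ⊆ (chartAt (Eu d) x₀).source := by
  rintro _ ⟨u, hu, rfl⟩
  exact (chartAt (Eu d) x₀).map_target (hKt hu)

/-- At a point outside the chart the form vanishes on a neighbourhood, because the image of the
compact set `K` is closed. -/
theorem smoothForm_extendForm [Module.Finite ℝ L] {G : Eu d → FormAlg d L} {K : Set (Eu d)}
    (hK : IsCompact K) (hKt : K ⊆ (chartAt (Eu d) x₀).target) (h0 : ∀ u, u ∉ K → G u = 0)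
    (hG : ∀ u ∈ (chartAt (Eu d) x₀).target, VSmoothAt G u) : SmoothForm X (extendForm x₀ G) := by
  refine smoothForm_iff.2 fun x₁ u hu => ?_
  by_cases hs : (chartAt (Eu d) x₁).symm u ∈ (chartAt (Eu d) x₀).source
  · have he := rep_pullMap_eventuallyEq (X := X) (S := X) contMDiff_id (extendForm x₀ G) hu
      (y₀ := x₀) hs
    rw [pullMap_id] at he
    have hg := contDiffAt_inCharts (X := X) (S := X) contMDiff_id hu hs
    have ht : inCharts (X := X) (S := X) id x₁ x₀ u ∈ (chartAt (Eu d) x₀).target :=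
      (chartAt (Eu d) x₀).map_source hs
    refine VSmoothAt.congr ?_ he
    refine vSmoothAt_pullForm (vSmoothAt_fderiv hg) (VSmoothAt.comp ?_ hg)
    refine (hG _ ht).congr ?_
    filter_upwards [(chartAt (Eu d) x₀).open_target.mem_nhds ht] with w hw
    exact rep_extendForm hw
  · refine (VSmoothAt.const (0 : FormAlg d L)).congr ?_
    have hc := (chartAt (Eu d) x₁).continuousOn_symm.continuousAt
      ((chartAt (Eu d) x₁).open_target.mem_nhds hu)
    have hK' := (image_symm_compact hK hKt).isClosed.isOpen_compl.mem_nhds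
      fun h => hs (image_symm_subset hKt h)
    filter_upwards [hc.preimage_mem_nhds hK'] with w hw
    exact rep_eq_zero (extendForm_eq_zero h0 hw)

end extension

/-- Fundamental lemma of the calculus of variations: vanishing almost everywhere, then everywhere by
continuity. -/
theorem eq_zero_of_setIntegral_eq_zero {d : ℕ} {U : Set (Eu d)} (hU : IsOpen U) {f : Eu d → ℝ}
    (hf : ContinuousOn f U) (h : ∀ c : Eu d → ℝ, ContDiff ℝ ∞ c → HasCompactSupport c →
      tsupport c ⊆ U → ∫ u in U, c u * f u = 0) : ∀ u ∈ U, f u = 0 := by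
  have hae := hU.ae_eq_zero_of_integral_contDiff_smul_eq_zero (μ := volume)
    (hf.locallyIntegrableOn hU.measurableSet) fun c hc hs hcU => by
      rw [← setIntegral_eq_integral_of_forall_compl_eq_zero (s := U) fun u hu => by
        rw [image_eq_zero_of_notMem_tsupport fun h => hu (hcU h), zero_smul]]
      exact h c hc hs hcU
  exact Measure.eqOn_open_of_ae_eq (μ := volume) (g := fun _ => 0)
    ((ae_restrict_iff' hU.measurableSet).2 hae) hU hf continuousOn_const

/-! ### Weak non-degeneracy of the BV form -/

namespace PtSpace

variable {d : ℕ} {X : ClosedOriented d} {A : GAlg} {n : ℤ} {ϖ : (spec A).Form2}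

section test

variable {L : Test GAlg.IsFinite} (Y : (mapSpace X A).Pt L) (x₀ : X)

/-- The vector `c η w` on the image of the chart at `x₀`, extended by zero. -/
def testVec (w : A → (chartTest L x₀).1) (η : FormAlg d L.1) (c : Eu d → ℝ) :
    (mapSpace X A).Vec L :=
  fun q a => extendForm x₀ (fun u => (c u • η) * GAlg.fn (w a) u) q

variable {Y x₀} {w : A → (chartTest L x₀).1} {η : FormAlg d L.1} {c : Eu d → ℝ} {j l : ℤ}

theorem testVec_eq_zero {q : X} (hq : q ∉ (chartAt (Eu d) x₀).symm '' tsupport c) :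
    testVec x₀ w η c q = fun _ => 0 :=
  funext fun _ => extendForm_eq_zero (K := tsupport c) (fun u hu => by
    rw [image_eq_zero_of_notMem_tsupport hu, zero_smul, zero_mul]) hq

/-- Inside the chart the vector is a form multiple of the derivation `w`, pulled back along the
chart; outside it is zero. -/
theorem testVec_isTan (hw : IsDer (localPt Y x₀) l w) (hη : η ∈ (FormAlg d L.1).gr j)
    (hc : ContDiff ℝ ∞ c) (hs : HasCompactSupport c)
    (hct : tsupport c ⊆ (chartAt (Eu d) x₀).target) :
    (mapSpace X A).IsTan Y (j + l) (testVec x₀ w η c) := by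
  refine ⟨fun q => ?_, fun a => smoothForm_extendForm hs hct (fun u hu => by
    rw [image_eq_zero_of_notMem_tsupport hu, zero_smul, zero_mul]) fun u hu => ?_⟩
  · by_cases hq : q ∈ (chartAt (Eu d) x₀).source
    · have hu := (chartAt (Eu d) x₀).map_source hq
      let u : chartOpens x₀ := ⟨chartAt (Eu d) x₀ q, hu⟩
      have h := ((hw.comp_hom (GAlg.ev u)).smul (Submodule.smul_mem _ (c u) hη)).comp_hom
        (pullForm L.1 (chartInv x₀ q))
      have e1 : (pullForm L.1 (chartInv x₀ q)).comp
          (GAlg.Hom.comp (GAlg.ev u) (localPt Y x₀)) = Y.1 q := by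
        rw [ev_localPt]
        refine GAlg.Hom.ext fun a => ?_
        change pullForm L.1 (chartInv x₀ q) (pullForm L.1 (chartDeriv x₀ (chartAt (Eu d) x₀ q))
          (Y.1 ((chartAt (Eu d) x₀).symm (chartAt (Eu d) x₀ q)) a)) = Y.1 q a
        rw [← pullForm_comp, chartDeriv_comp_chartInv hq, pullForm_id,
          (chartAt (Eu d) x₀).left_inv hq]
      have e2 : testVec x₀ w η c q = fun a =>
          pullForm L.1 (chartInv x₀ q) ((c u • η) * GAlg.ev u (w a)) := by
        funext a
        rw [testVec, extendForm_of_mem hq, GAlg.fn_eq (w a) hu]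
      rw [e2]
      exact (congrArg (fun z : GAlg.Hom A (FormAlg d L.1) => IsDer z (j + l) _) e1).mp h
    · rw [testVec_eq_zero fun h => hq (image_symm_subset hct h)]
      exact IsDer.zero
  · exact (VSmoothAt.smul hc.contDiffAt (VSmoothAt.const η)).mul (GAlg.fn_smooth (w a) hu)

/-- Linearity of the two-form over form-valued parameters takes the factor `c η` out, so the density
is an arbitrary cut-off multiple of the local pairing of `v` and `w`. -/
theorem rep_density2_testVec (hϖ : IsForm2 n ϖ) {k : ℤ} {v : (mapSpace X A).Vec L}
    (hv : (mapSpace X A).IsTan Y k v) (hw : IsDer (localPt Y x₀) l w)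
    (hη : η ∈ (FormAlg d L.1).gr j)
    (ht : (mapSpace X A).IsTan Y (j + l) (testVec x₀ w η c)) (u : chartOpens x₀) :
    rep X (density2 ϖ Y k v (j + l) (testVec x₀ w η c)) x₀ u =
      (c u • η) * GAlg.ev u (ϖ (chartTest L x₀) (localPt Y x₀) k (localVec hv x₀) l w) := by
  let q := (chartAt (Eu d) x₀).symm u
  have h₁ := hϖ.natural (R := formTest d L) (S := formTest d L) (pullForm L.1 (chartDeriv x₀ u))
    (x := Y.1 q) (hv.1 q) (ht.1 q)
  have h₂ := hϖ.natural (R := chartTest L x₀) (S := formTest d L) (GAlg.ev u)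
    (x := localPt Y x₀) (localVec_isDer hv x₀) hw
  let z : GAlg.Hom A (FormAlg d L.1) := GAlg.Hom.comp (GAlg.ev u) (localPt Y x₀)
  have h₃ := hϖ.smul (R := formTest d L) (x := z)
    (r := c u • η) ((localVec_isDer hv x₀).comp_hom (GAlg.ev u)) (hw.comp_hom (GAlg.ev u))
    (Submodule.smul_mem _ (c u) hη)
  refine h₁.symm.trans (Eq.trans ?_ (h₃.trans (congrArg ((c u • η) * ·) h₂)))
  have e1 : (spec A).map (R := formTest d L) (S := formTest d L) (pullForm L.1 (chartDeriv x₀ u))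
      (Y.1 q) = z := (ev_localPt Y x₀ u).symm
  have e2 : (spec A).mapVec (R := formTest d L) (S := formTest d L)
      (pullForm L.1 (chartDeriv x₀ u)) (testVec x₀ w η c q) =
      (spec A).smul (R := formTest d L) (c u • η)
        fun a => (GAlg.ev u (w a) : FormAlg d L.1) :=
    funext fun a => (rep_extendForm u.2).trans (congrArg (_ * ·) (GAlg.fn_eq (w a) u.2))
  exact congrArg₂ (fun z t => ϖ (formTest d L) z k _ (j + l) t) e1 e2

end test

/-- Non-degeneracy of the target is applied over the whole algebra of forms on a chart rather than
pointwise. Any derivation `w` along the local field, multiplied by a bump function and a constant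
form, extends by zero to a global tangent vector; orthogonality to all of these makes the local
pairing with `w` vanish. -/
theorem akszΩ_nondegenerate (hϖ : IsForm2 n ϖ) (hnd : Nondegenerate ϖ) :
    Nondegenerate (akszΩ X ϖ) := by
  intro L Y k v hv h
  funext p a
  have hloc : localVec hv p = fun _ => 0 := by
    refine hnd (R := chartTest L p) (localPt Y p) (localVec_isDer hv p) fun {l w} hw => ?_
    let g : GAlg.smooth (chartOpens p) (FormAlg d L.1) :=
      ϖ (chartTest L p) (localPt Y p) k (localVec hv p) l w
    refine GAlg.smooth_ext fun u => Eq.trans ?_ (GAlg.Hom.map_zero _).symm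
    by_contra hne
    obtain ⟨j, η, hη, htop⟩ := exists_topCoeff_ne_zero hne
    obtain ⟨m, hm⟩ : ∃ m : L.1 →ₗ[ℝ] ℝ, m (topCoeff d L.1 (η * GAlg.ev u g)) ≠ 0 := by
      by_contra! hall
      exact htop (vec_ext fun m => (hall m).trans (map_zero m).symm)
    let T : FormAlg d L.1 →ₗ[ℝ] ℝ := m ∘ₗ topCoeff d L.1 ∘ₗ LinearMap.mulLeft ℝ η
    -- Testing against all bump functions `c` shows that the orientation sign times `T(g)` vanishes
    -- on the chart, whereas `η` and `m` were chosen so that `T(g)` is non-zero at `u`.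
    have hz := eq_zero_of_setIntegral_eq_zero (chartAt (Eu d) p).open_target
      (f := fun u => chartSign X.sgn p u * T (GAlg.fn g u))
      ((X.sgn_locally_constant p).mul fun u hu =>
        ((GAlg.fn_smooth g hu).continuousAt T).continuousWithinAt) fun c hc hs hct => by
      have ht := testVec_isTan hw hη hc hs hct
      have h0 := h ht
      rw [akszΩ_eq, units_smul_eq_zero] at h0
      have h1 := lin_fiberIntegral_chart (density2_smooth hϖ hv ht) (image_symm_compact hs hct)
        (image_symm_subset hct) (fun q hq => by
          have : density2 ϖ Y k v (j + l) (testVec p w η c) q =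
            ϖ (formTest d L) (Y.1 q) k (v q) (j + l) (fun _ => 0) :=
              congrArg (ϖ (formTest d L) (Y.1 q) k (v q) (j + l)) (testVec_eq_zero hq)
          rw [this]
          exact hϖ.map_zero (X := spec A) (R := formTest d L) (x := Y.1 q) (hv.1 q) IsDer.zero) m
      rw [h0, map_zero] at h1
      rw [h1]
      refine setIntegral_congr_fun (chartAt (Eu d) p).open_target.measurableSet fun w' hw' => ?_
      have h2 := rep_density2_testVec (c := c) hϖ hv hw hη ht ⟨w', hw'⟩
      change c w' * (_ * T (GAlg.fn g w')) = chartSign X.sgn p w' *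
        m (topCoeff d L.1 (rep X (density2 ϖ Y k v (j + l) (testVec p w η c)) p w'))
      rw [h2, GAlg.fn_eq g hw', smul_mul_assoc, map_smul, map_smul, smul_eq_mul]
      change c w' * (_ * m (topCoeff d L.1 (η * GAlg.ev ⟨w', hw'⟩ g))) = _
      ring
    have h3 := hz u u.2
    rw [mul_eq_zero, GAlg.fn_eq g u.2] at h3
    exact h3.elim (chartSign_ne_zero u.2) hm
  exact (ev_localVec_center hv p a).symm.trans ((congrArg (GAlg.ev (chartCenter p))
    (congrFun hloc a)).trans (GAlg.Hom.map_zero _))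

theorem akszΩ_symplectic {α : (spec A).Form1} (h : IsExactSymplectic n ϖ α)
    (hd : (d : ℤ) = n + 1) : IsExactSymplectic (-1) (akszΩ X ϖ) (trans1 X α) where
  form2 := akszΩ_isForm2 h.form2 hd
  form1 := trans1_isForm1 h.form1 hd
  exact := akszΩ_exact h.form1 h.exact
  nondegenerate := akszΩ_nondegenerate h.form2 h.nondegenerate

end PtSpace

end

noncomputable section

open FormAlg

namespace PtSpace

/-! ### The AKSZ action -/

section aksz

variable {d : ℕ} {X : ClosedOriented d} {A B : GAlg} {n : ℤ} {α : (spec A).Form1}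
  {ϖ : (spec A).Form2} {L L' : Test GAlg.IsFinite}

theorem isTan_add {Y : (mapSpace X A).Pt L} {k : ℤ} {v w : (mapSpace X A).Vec L}
    (hv : (mapSpace X A).IsTan Y k v) (hw : (mapSpace X A).IsTan Y k w) :
    (mapSpace X A).IsTan Y k (v + w) :=
  ⟨fun p => (hv.1 p).add (hw.1 p), fun a => (hv.2 a).add (hw.2 a)⟩

theorem isTan_zero (Y : (mapSpace X A).Pt L) (k : ℤ) : (mapSpace X A).IsTan Y k 0 :=
  ⟨fun _ => IsDer.zero, fun _ => SmoothForm.zero⟩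

theorem density2_add_left (hϖ : IsForm2 n ϖ) {Y : (mapSpace X A).Pt L} {k l : ℤ}
    {v v' w : (mapSpace X A).Vec L} (hv : (mapSpace X A).IsTan Y k v)
    (hv' : (mapSpace X A).IsTan Y k v') (hw : (mapSpace X A).IsTan Y l w) :
    density2 ϖ Y k (v + v') l w =
      fun p => density2 ϖ Y k v l w p + density2 ϖ Y k v' l w p :=
  funext fun p => hϖ.add_left (X := spec A) (R := formTest d L) (x := Y.1 p) (v := v p)
    (v' := v' p) (w := w p) (hv.1 p) (hv'.1 p) ((isTan_add hv hv').1 p) (hw.1 p)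

variable (X) in
/-- The form on the source whose integral is the transgression of a function. -/
def densityFn (f : ((spec A).prod (spec B)).Fn) (x : (mapSpace X A).Pt L)
    (y : (mapSpace X B).Pt L) : X → FormAlg d L.1 :=
  fun p => f (formTest d L) (x.1 p, y.1 p)

theorem densityFn_smooth {f : ((spec A).prod (spec B)).Fn} (hf : IsNatural f)
    (x : (mapSpace X A).Pt L) (y : (mapSpace X B).Pt L) : SmoothForm X (densityFn X f x y) :=
  smoothForm_fn x y hf

theorem densityFn_map {f : ((spec A).prod (spec B)).Fn} (hf : IsNatural f)
    (x : (mapSpace X A).Pt L) (y : (mapSpace X B).Pt L) (φ : GAlg.Hom L.1 L'.1) :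
    densityFn X f ((mapSpace X A).map (S := L') φ x) ((mapSpace X B).map (S := L') φ y) =
      fun p => coeffMap d φ (densityFn X f x y p) :=
  funext fun p => hf (R := formTest d L) (S := formTest d L') (coeffMap d φ) (x.1 p, y.1 p)

/-- The derivative of `densityFn` in the direction of a pair of tangent vectors. -/
def densityDir (f : ((spec A).prod (spec B)).Fn) {x : (mapSpace X A).Pt L}
    {y : (mapSpace X B).Pt L} {k : ℤ} {v : (mapSpace X A).Vec L} {w : (mapSpace X B).Vec L}
    (hv : (mapSpace X A).IsTan x k v) (hw : (mapSpace X B).IsTan y k w) : X → FormAlg d L.1 :=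
  fun p => dir f (S := formTest d L) (x.1 p, y.1 p) (v p, w p) ⟨hv.1 p, hw.1 p⟩

section densityDir

variable {f : ((spec A).prod (spec B)).Fn} {x : (mapSpace X A).Pt L} {y : (mapSpace X B).Pt L}
  {k : ℤ} {v v' : (mapSpace X A).Vec L} {w w' : (mapSpace X B).Vec L}

theorem densityDir_smooth (hf : IsNatural f) (hv : (mapSpace X A).IsTan x k v)
    (hw : (mapSpace X B).IsTan y k w) : SmoothForm X (densityDir f hv hw) :=
  smoothForm_dir x y hf hv hw

theorem deRham_densityFn (hf : IsNatural f) (x : (mapSpace X A).Pt L) (y : (mapSpace X B).Pt L) :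
    deRham X (densityFn X f x y) = densityDir f (dLift_isTan x) (dLift_isTan y) :=
  funext fun p => deRham_fn x y hf p

theorem densityDir_add (hf : IsNatural f) (hv : (mapSpace X A).IsTan x k v)
    (hv' : (mapSpace X A).IsTan x k v') (hw : (mapSpace X B).IsTan y k w)
    (hw' : (mapSpace X B).IsTan y k w') (p : X) :
    densityDir f (isTan_add hv hv') (isTan_add hw hw') p =
      densityDir f hv hw p + densityDir f hv' hw' p :=
  dir_add (S := formTest d L) (z := (x.1 p, y.1 p)) (v := (v p, w p)) (w := (v' p, w' p)) hf
    ⟨hv.1 p, hw.1 p⟩ ⟨hv'.1 p, hw'.1 p⟩ ⟨(isTan_add hv hv').1 p, (isTan_add hw hw').1 p⟩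

theorem densityDir_congr (hv : (mapSpace X A).IsTan x k v) (hv' : (mapSpace X A).IsTan x k v')
    (hw : (mapSpace X B).IsTan y k w) (hw' : (mapSpace X B).IsTan y k w') (h : v = v')
    (h' : w = w') : densityDir f hv hw = densityDir f hv' hw' := by
  subst h h'
  rfl

theorem coeffDer_densityFn (hf : IsNatural f) {φ : GAlg.Hom L.1 L'.1} {k : ℤ}
    {D : L.1 →ₗ[ℝ] L'.1} (hD : IsDer φ k D) {x : (mapSpace X A).Pt L} (y : (mapSpace X B).Pt L)
    {x' : (mapSpace X A).Pt L'} {v : (mapSpace X A).Vec L'} {w : (mapSpace X B).Vec L'}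
    (hx : (mapSpace X A).map (S := L') φ x = x') (hv : (mapSpace X A).IsTan x' k v)
    (hw : (mapSpace X B).IsTan ((mapSpace X B).map (S := L') φ y) k w)
    (h : (mapSpace X A).vel (S := L') k D x = v) (h' : (mapSpace X B).vel (S := L') k D y = w)
    (p : X) : coeffDer d k D (densityFn X f x y p) = densityDir f hv hw p := by
  subst hx
  exact coeffDer_fn hf hD (x.1 p) (y.1 p) _ rfl (fun a => congrFun (congrFun h p) a)
    fun b => congrFun (congrFun h' p) b

end densityDir

theorem kinetic_eq (Y : (mapSpace X A).Pt L) :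
    kinetic X α L Y = fiberIntegral X (density1 α Y 1 (dLift X L Y)) := by
  rw [kinetic, trans1_eq, sub_self, zero_mul, Int.negOnePow_zero, one_smul]

theorem kinetic_mem (hα : IsForm1 n α) (hd : (d : ℤ) = n + 1) (Y : (mapSpace X A).Pt L) :
    kinetic X α L Y ∈ L.1.gr 0 := by
  have h := (trans1_isForm1 (X := X) hα hd).deg (dLift_isTan Y)
  rwa [show (-1 : ℤ) + 1 = 0 by norm_num] at h

theorem kinetic_map (hα : IsForm1 n α) (hd : (d : ℤ) = n + 1) (Y : (mapSpace X A).Pt L)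
    (φ : GAlg.Hom L.1 L'.1) :
    kinetic X α L' ((mapSpace X A).map (S := L') φ Y) = φ (kinetic X α L Y) := by
  rw [kinetic, dLift_map]
  exact (trans1_isForm1 (X := X) hα hd).natural φ (dLift_isTan Y)

/-- The contraction of the BV form with `d^lifted + u` is exact if this holds for `u`. -/
theorem akszΩ_dLift_add (hα : IsForm1 n α) (hϖ : IsForm2 n ϖ) (hext : IsExtDeriv α ϖ)
    {φ : GAlg.Hom L.1 L'.1} {k : ℤ} {D : L.1 →ₗ[ℝ] L'.1} (hD : IsDer φ k D)
    (Y : (mapSpace X A).Pt L) {u : (mapSpace X A).Vec L'}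
    (hu : (mapSpace X A).IsTan ((mapSpace X A).map φ Y) 1 u) {θ : X → FormAlg d L.1}
    (hθ : SmoothForm X θ)
    (h : ∀ p, density2 ϖ ((mapSpace X A).map (S := L') φ Y) 1 u k
      ((mapSpace X A).vel (S := L') k D Y) p = coeffDer d k D (θ p)) :
    akszΩ X ϖ L' ((mapSpace X A).map φ Y) 1 (dLift X L' ((mapSpace X A).map φ Y) + u) k
      ((mapSpace X A).vel (S := L') k D Y) = D (kinetic X α L Y + fiberIntegral X θ) := by
  let Y' := (mapSpace X A).map (S := L') φ Y
  have hv := vel_isTan Y hD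
  have hk := density1_smooth hα (dLift_isTan Y)
  have hdR := smoothForm_deRham (density1_smooth hα hv)
  have h1 : density2 ϖ Y' 1 (dLift X L' Y' + u) k ((mapSpace X A).vel (S := L') k D Y) =
      fun p => (k - 1).negOnePow •
        deRham X (density1 α Y' k ((mapSpace X A).vel (S := L') k D Y)) p +
      coeffDer d k D (density1 α Y 1 (dLift X L Y) p) + coeffDer d k D (θ p) := by
    rw [density2_add_left hϖ (dLift_isTan Y') hu hv]
    funext p
    rw [h p]
    exact congrArg (· + _) (form2_dLift_vel hα hϖ hext hD Y p)
  -- On vectors of degrees `1` and `k` the BV form carries the sign `(-1)^{kd}`, which cancels that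
  -- of taking `D` out of the integral; the de Rham exact term is removed by Stokes' theorem.
  have e : ((1 + k - 1) * (d : ℤ)) = k * d := by ring
  rw [akszΩ_eq, h1, fiberIntegral_add ((hdR.units _).add (hk.coeffDer k D)) (hθ.coeffDer k D),
    fiberIntegral_add (hdR.units _) (hk.coeffDer k D), fiberIntegral_units hdR,
    fiberIntegral_deRham (density1_smooth hα hv), fiberIntegral_coeffDer hk,
    fiberIntegral_coeffDer hθ, smul_zero, zero_add, smul_add, smul_smul, smul_smul, e,
    units_mul_self, one_smul, one_smul, map_add, kinetic_eq]

/-- The square of `d^lifted + u` with respect to the BV form. -/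
theorem akszΩ_self (hα : IsForm1 n α) (hϖ : IsForm2 n ϖ) (hext : IsExtDeriv α ϖ)
    (Y : (mapSpace X A).Pt L) {u : (mapSpace X A).Vec L} (hu : (mapSpace X A).IsTan Y 1 u) :
    akszΩ X ϖ L Y 1 (dLift X L Y + u) 1 (dLift X L Y + u) = (d : ℤ).negOnePow •
      fiberIntegral X fun p => density2 ϖ Y 1 u 1 (dLift X L Y) p +
        density2 ϖ Y 1 u 1 (dLift X L Y) p + density2 ϖ Y 1 u 1 u p := by
  have hdL := dLift_isTan Y
  have hdu := isTan_add hdL hu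
  have h1 : density2 ϖ Y 1 (dLift X L Y + u) 1 (dLift X L Y + u) = fun p =>
      (deRham X (density1 α Y 1 (dLift X L Y)) p + deRham X (density1 α Y 1 (dLift X L Y)) p) +
      (density2 ϖ Y 1 u 1 (dLift X L Y) p +
        density2 ϖ Y 1 u 1 (dLift X L Y) p + density2 ϖ Y 1 u 1 u p) := by
    -- Contractions with vectors of degree one have total degree zero and hence commute, which
    -- doubles the cross term.
    have hs : density2 ϖ Y 1 (dLift X L Y) 1 u = density2 ϖ Y 1 u 1 (dLift X L Y) := by
      rw [density2_symm hϖ hdL hu]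
      simp
    rw [density2_add hϖ hdu hdL hu]
    funext p
    rw [density2_add_left hϖ hdL hu hdL, density2_add_left hϖ hdL hu hu, hs]
    have h := form2_dLift_dLift hα hϖ hext Y p
    have h' : density2 ϖ Y 1 (dLift X L Y) 1 (dLift X L Y) p =
      deRham X (density1 α Y 1 (dLift X L Y)) p + deRham X (density1 α Y 1 (dLift X L Y)) p := h
    simp only [h']
    abel
  have hα1 := density1_smooth hα hdL
  have hud := density2_smooth hϖ hu hdL
  have e : ((1 + 1 - 1) * (d : ℤ)) = d := by ring
  rw [akszΩ_eq, h1, fiberIntegral_add ((smoothForm_deRham hα1).add (smoothForm_deRham hα1))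
    ((hud.add hud).add (density2_smooth hϖ hu hu)), fiberIntegral_add (smoothForm_deRham hα1)
    (smoothForm_deRham hα1), fiberIntegral_deRham hα1, add_zero, zero_add, e]

/-! ### The AKSZ vector field, its Hamiltonian and the master equation -/

variable {Q : (spec A).VF} {Θ : (spec A).Fn}

theorem targetLift_isTan (hQ : IsVF 1 Q) (Y : (mapSpace X A).Pt L) :
    (mapSpace X A).IsTan Y 1 (targetLift X Q L Y) :=
  ⟨fun p => hQ.tangent (formTest d L) (Y.1 p), fun a => smoothForm_fn Y Y (vfFn_natural hQ a)⟩

theorem akszQ_isVF (hQ : IsVF 1 Q) : IsVF 1 (akszQ X Q) where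
  tangent _ Y := isTan_add (dLift_isTan Y) (targetLift_isTan hQ Y)
  natural {L L'} φ Y := by
    funext p a
    have h1 := congrFun (congrFun (dLift_map φ Y) p) a
    have h2 := congrFun (hQ.natural (R := formTest d L) (S := formTest d L') (coeffMap d φ)
      (Y.1 p)) a
    exact (congrArg₂ (fun s t : FormAlg d L'.1 => s + t) h1 h2).trans (GAlg.Hom.map_add (coeffMap d φ) _ _).symm

theorem coeffDer_dLift {φ : GAlg.Hom L.1 L'.1} {D : L.1 →ₗ[ℝ] L'.1} (hD : IsDer φ 1 D)
    (Y : (mapSpace X A).Pt L) (p : X) (a : A) :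
    coeffDer d 1 D (dLift X L Y p a) = -deRham X (fun q => coeffDer d 1 D (Y.1 q a)) p := by
  rw [deRham_coeffDer (Y.2 a) hD, Int.negOnePow_one, Units.neg_smul, one_smul, neg_neg]
  rfl

theorem deRham_dLift_add (Y : (mapSpace X A).Pt L) (a : A) {F : X → FormAlg d L.1}
    (hF : SmoothForm X F) (p : X) :
    deRham X (fun q => dLift X L Y q a + F q) p = deRham X F p := by
  have h := deRham_add (F := fun q => dLift X L Y q a) (smoothForm_deRham (Y.2 a)) hF p
  rw [h]
  have h0 : deRham X (fun q => dLift X L Y q a) p = 0 := deRham_deRham (Y.2 a) p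
  rw [h0, zero_add]

/-- Let the velocity be `DY = dY' + Q(Y')`, with `Y'` the field after the change of parameters. Then
`D(dY) = -d(DY) = -d(Q(Y'))`. Moreover `D(Q(Y))` is the derivative of `Q` along `dY' + Q(Y')`: its
first part is `d(Q(Y'))` and its second part vanishes by `Q² = 0`. -/
theorem akszQ_sqZero (hQ : IsVF 1 Q) (hsq : SqZero Q) : SqZero (akszQ X Q) := by
  intro L L' φ D Y hD hvel
  let Y' := (mapSpace X A).map (S := L') φ Y
  funext p a
  have hdT := dLift_isTan Y'
  have hQT := targetLift_isTan hQ Y'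
  have hnat : IsNatural (vfFn Q a) := vfFn_natural hQ a
  have hv : ∀ q, coeffDer d 1 D (Y.1 q a) =
      dLift X L' Y' q a + densityFn X (vfFn Q a) Y' Y' q := fun q =>
    congrFun (congrFun hvel q) a
  have h1 : coeffDer d 1 D (dLift X L Y p a) = -deRham X (densityFn X (vfFn Q a) Y' Y') p := by
    rw [coeffDer_dLift hD, funext hv, deRham_dLift_add Y' a (densityFn_smooth hnat Y' Y') p]
  have h2 : densityDir (vfFn Q a) hQT hQT p = 0 :=
    sqZero_dir (S := formTest d L') hsq (hQT.1 p) a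
  have h3 : coeffDer d 1 D (densityFn X (vfFn Q a) Y Y p) =
      deRham X (densityFn X (vfFn Q a) Y' Y') p := by
    rw [coeffDer_densityFn hnat hD Y rfl (isTan_add hdT hQT) (isTan_add hdT hQT) hvel hvel,
      densityDir_add hnat hdT hQT hdT hQT, h2, add_zero, deRham_densityFn hnat]
  change coeffDer d 1 D (dLift X L Y p a + densityFn X (vfFn Q a) Y Y p) = 0
  rw [map_add, h1, h3, neg_add_cancel]

theorem akszS_isFn (hα : IsForm1 n α) (hΘ : IsFn (n + 1) Θ) (hd : (d : ℤ) = n + 1) :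
    IsFn 0 (akszS X α Θ) where
  deg L Y := by
    refine Submodule.add_mem _ (kinetic_mem hα hd Y) ?_
    have h := fiberIntegral_mem (densityFn_smooth (fstFn_natural hΘ) Y Y) (m := n + 1)
      fun p => hΘ.deg (formTest d L) (Y.1 p)
    rw [hd, sub_self] at h
    exact h
  natural {L L'} φ Y := by
    rw [akszS, akszS, GAlg.Hom.map_add, kinetic_map hα hd]
    refine congrArg _ ?_
    have h := fiberIntegral_coeffMap (densityFn_smooth (fstFn_natural hΘ) Y Y) φ
    rw [← densityFn_map (fstFn_natural hΘ)] at h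
    exact h

theorem akszS_hamiltonian (hα : IsForm1 n α) (hϖ : IsForm2 n ϖ) (hext : IsExtDeriv α ϖ)
    (hQ : IsVF 1 Q) (hΘ : IsFn (n + 1) Θ) (hH : IsHamiltonian ϖ Θ Q) :
    IsHamiltonian (akszΩ X ϖ) (akszS X α Θ) (akszQ X Q) := by
  intro L L' φ k D Y hD
  exact akszΩ_dLift_add hα hϖ hext hD Y (targetLift_isTan hQ _)
    (densityFn_smooth (fstFn_natural hΘ) Y Y) fun p =>
      hH (R := formTest d L) (S := formTest d L') (coeffMap d φ) (coeffDer d k D) (Y.1 p)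
        (coeffDer_isDer hD)

theorem aksz_isBVTheory (h : IsHamQManifold n Q ϖ α Θ) (hd : (d : ℤ) = n + 1) :
    IsBVTheory (akszQ X Q) (akszΩ X ϖ) (trans1 X α) (akszS X α Θ) := by
  have hα := h.symplectic.form1
  have hϖ := h.symplectic.form2
  have hext : IsExtDeriv α ϖ := h.symplectic.exact
  have hham : IsHamiltonian (akszΩ X ϖ) (akszS X α Θ) (akszQ X Q) :=
    akszS_hamiltonian hα hϖ hext h.vf h.fn h.hamiltonian
  refine ⟨akszQ_isVF h.vf, akszQ_sqZero h.vf h.sq_zero, akszΩ_symplectic h.symplectic hd,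
    akszS_isFn hα h.fn hd, hham, fun {L L'} φ D Y hD hvel => ?_⟩
  let Y' := (mapSpace X A).map (S := L') φ Y
  have hQT := targetLift_isTan h.vf Y'
  have hnat : IsNatural (fstFn Θ) := fstFn_natural h.fn
  -- Since the velocity of the family is `Q_X`, the derivative of the action equals `Ω(Q_X, Q_X)`.
  -- By `akszΩ_self` this is the integral of twice `d(Θ(Y'))` plus `QΘ = 0`.
  have h1 := hham φ D Y hD
  rw [hvel] at h1
  rw [← h1]
  have hdT := (dLift_isTan Y').1
  have h2 : density2 ϖ Y' 1 (targetLift X Q L' Y') 1 (dLift X L' Y') =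
      deRham X (densityFn X (fstFn Θ) Y' Y') := funext fun p =>
    (hamiltonian_dir h.hamiltonian (hdT p)).trans (deRham_fn Y' Y' hnat p).symm
  have h3 : density2 ϖ Y' 1 (targetLift X Q L' Y') 1 (targetLift X Q L' Y') = fun _ => 0 :=
    funext fun p => (hamiltonian_dir h.hamiltonian (hQT.1 p)).trans
      (derives_dir (S := formTest d L') (Q := Q) (z := Y'.1 p)
        (g := fun _ _ => 0) h.master (hQT.1 p))
  have h4 := akszΩ_self hα hϖ hext Y' hQT
  have hf := densityFn_smooth hnat Y' Y'
  have hfd := smoothForm_deRham hf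
  rw [h2, h3] at h4
  simp only [add_zero] at h4
  rw [fiberIntegral_add hfd hfd, fiberIntegral_deRham hf, add_zero, smul_zero] at h4
  exact h4

end aksz

end PtSpace

end

noncomputable section

open FormAlg

namespace PtSpace

/-! ### Hamiltonian `Q`-bundles on the target -/

section target

variable {A B : GAlg} {S : Test GAlg.IsSmooth} {V : VertVF (spec A) (spec B)}

theorem vertHamiltonian_dir {ϖ : (spec B).Form2} {Θ : ((spec A).prod (spec B)).Fn}
    (h : IsVertHamiltonian ϖ Θ V) {k : ℤ} {x : GAlg.Hom A S.1} {y : GAlg.Hom B S.1}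
    {w : B → S.1} (h0 : IsDer x k fun _ => 0) (hw : IsDer y k w) :
    ϖ S y 1 (V S x y) k w = dir Θ (S := S) (x, y) (fun _ => 0, w) ⟨h0, hw⟩ :=
  h (R := sqTest S fun _ : Unit => k) (S := S) (GAlg.sqFst S.1 fun _ : Unit => k)
    (GAlg.sqSnd S.1 (fun _ : Unit => k) ()) (GAlg.sqMk x (fun _ _ => 0) fun _ => h0)
    (GAlg.sqMk y (fun _ => w) fun _ => hw) (GAlg.sqSnd_isDer (GAlg.Hom.id S.1) ()) rfl

theorem derives_dir_prod {f g : ((spec A).prod (spec B)).Fn} {W : ((spec A).prod (spec B)).VF}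
    (h : Derives 1 W f g) {z : ((spec A).prod (spec B)).Pt S}
    {v : ((spec A).prod (spec B)).Vec S} (hW : W S z = v)
    (hv : ((spec A).prod (spec B)).IsTan z 1 v) : dir f z v hv = g S z :=
  h (R := sqTest S fun _ : Unit => (1 : ℤ)) (S := S) (GAlg.sqFst S.1 fun _ : Unit => (1 : ℤ))
    (GAlg.sqSnd S.1 (fun _ : Unit => (1 : ℤ)) ()) (thicken z v hv)
    (GAlg.sqSnd_isDer (GAlg.Hom.id S.1) ()) hW.symm

/-- Fibre component of the square-zero condition for the total vector field; the base component is
the condition for `Q`. -/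
theorem sqZero_dir_prod {Q : (spec A).VF}
    (h : SqZero (fun R z => hor Q R z + ver V R z : ((spec A).prod (spec B)).VF))
    {x : GAlg.Hom A S.1} {y : GAlg.Hom B S.1} (hv : IsDer x 1 (Q S x)) (hw : IsDer y 1 (V S x y))
    (b : B) : dir (vertFn V b) (S := S) (x, y) (Q S x, V S x y) ⟨hv, hw⟩ = 0 := by
  have e : (hor Q S (x, y) + ver V S (x, y) : ((spec A).prod (spec B)).Vec S) =
      (Q S x, V S x y) := Prod.ext (add_zero _) (zero_add _)
  have h' := congrFun (congrArg Prod.snd (h (R := sqTest S fun _ : Unit => (1 : ℤ)) (S := S)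
    (GAlg.sqFst S.1 fun _ : Unit => (1 : ℤ))
    (GAlg.sqSnd S.1 (fun _ : Unit => (1 : ℤ)) ()) (thicken (x, y) (Q S x, V S x y) ⟨hv, hw⟩)
    (GAlg.sqSnd_isDer (GAlg.Hom.id S.1) ()) e.symm)) b
  refine Eq.trans (congrArg (GAlg.sqSnd S.1 (fun _ : Unit => (1 : ℤ)) ()) ?_) h'
  exact (zero_add _).symm

end target

/-! ### Pull-back of ambient fields -/

section pull

variable {d e : ℕ} {γ : ClosedOriented d} {S : ClosedOriented e} {i : γ → S} {A : GAlg}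
  {L L' : Test GAlg.IsFinite}

/-- The pull-back of an ambient field, as a field. -/
def pullPt (hi : ContMDiff 𝓘(ℝ, Eu d) 𝓘(ℝ, Eu e) ∞ i) (x : (mapSpace S A).Pt L) :
    (mapSpace γ A).Pt L :=
  ⟨fun p => (pullForm L.1 (mfderiv 𝓘(ℝ, Eu d) 𝓘(ℝ, Eu e) i p)).comp (x.1 (i p)), fun a =>
    smoothForm_pullMap hi (F := fun q => x.1 q a) (x.2 a)⟩

variable (i) in
/-- The pull-back of a family of vectors at an ambient field. -/
def pullVec (v : (mapSpace S A).Vec L) : (mapSpace γ A).Vec L :=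
  fun p a => pullMap i (fun q => v q a) p

variable (hi : ContMDiff 𝓘(ℝ, Eu d) 𝓘(ℝ, Eu e) ∞ i)

theorem pullPt_map (φ : GAlg.Hom L.1 L'.1) (x : (mapSpace S A).Pt L) :
    pullPt hi ((mapSpace S A).map (S := L') φ x) =
      (mapSpace γ A).map (S := L') φ (pullPt hi x) :=
  Subtype.ext (funext fun _ => GAlg.Hom.ext fun _ => pullForm_coeffMap φ _ _)

theorem pullVec_vel (k : ℤ) (D : L.1 →ₗ[ℝ] L'.1) (x : (mapSpace S A).Pt L) :
    pullVec i ((mapSpace S A).vel (S := L') k D x) =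
      (mapSpace γ A).vel (S := L') k D (pullPt hi x) :=
  funext fun _ => funext fun _ => pullForm_coeffDer k D _ _

theorem pullVec_zero : pullVec i (0 : (mapSpace S A).Vec L) = 0 :=
  funext fun _ => funext fun _ => GAlg.Hom.map_zero _

/-- The de Rham part is compatible with pull-back because `d` is natural, the target part because
`Q` is natural under pull-back of forms. Consequently the auxiliary theory depends on the ambient
field only through a field on `γ`. -/
theorem pullVec_akszQ {Q : (spec A).VF} (hQ : IsVF 1 Q) (x : (mapSpace S A).Pt L) :
    pullVec i (akszQ S Q L x) = akszQ γ Q L (pullPt hi x) := by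
  funext p a
  have h1 : pullMap i (deRham S fun q => x.1 q a) p = dLift γ L (pullPt hi x) p a :=
    (deRham_pullMap hi (x.2 a) p).symm
  have h2 := congrFun (hQ.natural (R := formTest e L) (S := formTest d L)
    (pullForm L.1 (mfderiv 𝓘(ℝ, Eu d) 𝓘(ℝ, Eu e) i p)) (x.1 (i p))) a
  exact (GAlg.Hom.map_add (pullForm L.1 (mfderiv 𝓘(ℝ, Eu d) 𝓘(ℝ, Eu e) i p)) _ _).trans
    (congrArg₂ (fun s t : FormAlg d L.1 => s + t) h1 h2.symm)

end pull

/-! ### The auxiliary theory -/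

section aux

variable {d e : ℕ} {γ : ClosedOriented d} {S : ClosedOriented e} {i : γ → S} {A B : GAlg}
  {L L' : Test GAlg.IsFinite} {n : ℤ} {Q : (spec A).VF} {V : VertVF (spec A) (spec B)}
  {ϖ : (spec B).Form2} {α : (spec B).Form1} {Θ : ((spec A).prod (spec B)).Fn}

theorem auxTarget_isTan (hi : ContMDiff 𝓘(ℝ, Eu d) 𝓘(ℝ, Eu e) ∞ i)
    (hV : IsVF 1 (ver V)) (x : (mapSpace S A).Pt L) (y : (mapSpace γ B).Pt L) :
    (mapSpace γ B).IsTan y 1 (auxTarget γ i V L x y) :=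
  ⟨fun p => (hV.tangent (formTest d L) ((pullPt hi x).1 p, y.1 p)).2,
    fun b => smoothForm_fn (pullPt hi x) y (vertFn_natural hV b)⟩

theorem auxVF_isVF (hi : ContMDiff 𝓘(ℝ, Eu d) 𝓘(ℝ, Eu e) ∞ i)
    (hV : IsVF 1 (ver V)) : IsVF 1 (ver (auxVF γ i V)) where
  tangent _ z := ⟨isTan_zero z.1 1, isTan_add (dLift_isTan z.2) (auxTarget_isTan hi hV z.1 z.2)⟩
  natural {L L'} φ z := by
    refine Prod.ext (funext fun p => funext fun a => (GAlg.Hom.map_zero (coeffMap e φ)).symm)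
      (funext fun p => funext fun b => ?_)
    have h1 := congrFun (congrFun (dLift_map φ z.2) p) b
    have hnat : IsNatural (vertFn V b) := vertFn_natural hV b
    have h2 := congrFun (densityFn_map hnat (pullPt hi z.1) z.2 φ) p
    rw [← pullPt_map hi] at h2
    exact (congrArg₂ (fun s t : FormAlg d L'.1 => s + t) h1 h2).trans
      (GAlg.Hom.map_add (coeffMap d φ) _ _).symm

/-- The cancellation of `akszQ_sqZero`, for the pair of pulled-back ambient field and auxiliary
field: the vertical vector field is differentiated along both velocities, and the term without `d`
vanishes by the square-zero condition for the total vector field on the target. -/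
theorem auxVF_sqZero (hi : ContMDiff 𝓘(ℝ, Eu d) 𝓘(ℝ, Eu e) ∞ i)
    (hQ : IsVF 1 Q) (hQQ : SqZero Q) (hV : IsVF 1 (ver V))
    (hsq : SqZero (fun R z => hor Q R z + ver V R z : ((spec A).prod (spec B)).VF)) :
    SqZero (fun R z => hor (akszQ S Q) R z + ver (auxVF γ i V) R z :
      ((mapSpace S A).prod (mapSpace γ B)).VF) := by
  intro L L' φ D z hD hvel
  obtain ⟨x, y⟩ := z
  let x' := pullPt hi ((mapSpace S A).map (S := L') φ x)
  let y' := (mapSpace γ B).map (S := L') φ y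
  have hx : (mapSpace S A).vel (S := L') 1 D x =
      akszQ S Q L' ((mapSpace S A).map (S := L') φ x) :=
    (congrArg Prod.fst hvel).trans (add_zero _)
  have hy : (mapSpace γ B).vel (S := L') 1 D y =
      auxVF γ i V L' ((mapSpace S A).map (S := L') φ x) y' :=
    (congrArg Prod.snd hvel).trans (zero_add _)
  have hx' : (mapSpace γ A).vel (S := L') 1 D (pullPt hi x) = akszQ γ Q L' x' := by
    rw [← pullVec_vel, hx, pullVec_akszQ hi hQ]
  have hT := auxTarget_isTan hi hV ((mapSpace S A).map (S := L') φ x) y'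
  refine Prod.ext ?_ (funext fun p => funext fun b => ?_)
  · refine Eq.trans (congrArg ((mapSpace S A).velVec 1 D) (add_zero (akszQ S Q L x))) ?_
    exact akszQ_sqZero hQ hQQ φ D x hD hx
  have hnat : IsNatural (vertFn V b) := vertFn_natural hV b
  have hdx := dLift_isTan x'
  have hdy := dLift_isTan y'
  have hQT := targetLift_isTan hQ x'
  have hv : ∀ q, coeffDer d 1 D (y.1 q b) =
      dLift γ L' y' q b + densityFn γ (vertFn V b) x' y' q := fun q =>
    congrFun (congrFun hy q) b
  have h1 : coeffDer d 1 D (dLift γ L y p b) = -deRham γ (densityFn γ (vertFn V b) x' y') p := by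
    rw [coeffDer_dLift hD, funext hv, deRham_dLift_add y' b (densityFn_smooth hnat x' y') p]
  have h2 : densityDir (vertFn V b) hQT hT p = 0 :=
    sqZero_dir_prod (S := formTest d L') hsq (hQT.1 p) (hT.1 p) b
  have h3 : coeffDer d 1 D (densityFn γ (vertFn V b) (pullPt hi x) y p) =
      deRham γ (densityFn γ (vertFn V b) x' y') p := by
    rw [coeffDer_densityFn hnat hD y (pullPt_map hi φ x).symm (isTan_add hdx hQT) (isTan_add hdy hT) hx' hy,
      densityDir_add hnat hdx hQT hdy hT, h2, add_zero, deRham_densityFn hnat]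
  change coeffDer d 1 D (0 + (dLift γ L y p b + densityFn γ (vertFn V b) (pullPt hi x) y p)) = 0
  rw [zero_add, map_add, h1, h3, neg_add_cancel]

theorem auxS_eq (hi : ContMDiff 𝓘(ℝ, Eu d) 𝓘(ℝ, Eu e) ∞ i)
    (x : (mapSpace S A).Pt L) (y : (mapSpace γ B).Pt L) :
    auxS γ i α Θ L (x, y) = kinetic γ α L y + fiberIntegral γ (densityFn γ Θ (pullPt hi x) y) :=
  rfl

theorem auxS_isFn (hi : ContMDiff 𝓘(ℝ, Eu d) 𝓘(ℝ, Eu e) ∞ i)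
    (hα : IsForm1 n α) (hΘ : IsFn (n + 1) Θ) (hd : (d : ℤ) = n + 1) :
    IsFn 0 (auxS (S := S) γ i α Θ) where
  deg L z := by
    refine Submodule.add_mem _ (kinetic_mem hα hd z.2) ?_
    have hnat : IsNatural Θ := hΘ.natural
    have h := fiberIntegral_mem (densityFn_smooth hnat (pullPt hi z.1) z.2) (m := n + 1)
      fun p => hΘ.deg (formTest d L) ((pullPt hi z.1).1 p, z.2.1 p)
    rw [hd, sub_self] at h
    exact h
  natural {L L'} φ z := by
    have hnat : IsNatural Θ := hΘ.natural
    have h := fiberIntegral_coeffMap (densityFn_smooth hnat (pullPt hi z.1) z.2) φ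
    rw [← densityFn_map hnat, ← pullPt_map hi] at h
    exact (congrArg₂ (fun s t : L'.1 => s + t) (kinetic_map hα hd z.2 φ) h).trans
      (GAlg.Hom.map_add φ _ _).symm

theorem density2_auxTarget (hi : ContMDiff 𝓘(ℝ, Eu d) 𝓘(ℝ, Eu e) ∞ i)
    (hH : IsVertHamiltonian ϖ Θ V) (x : (mapSpace S A).Pt L)
    (y : (mapSpace γ B).Pt L) {k : ℤ} {w : (mapSpace γ B).Vec L}
    (hw : (mapSpace γ B).IsTan y k w) :
    density2 ϖ y 1 (auxTarget γ i V L x y) k w =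
      densityDir Θ (isTan_zero (pullPt hi x) k) hw :=
  funext fun p => vertHamiltonian_dir (S := formTest d L) hH (x := (pullPt hi x).1 p)
    IsDer.zero (hw.1 p)

/-- If the ambient field has zero velocity, so has its pull-back. Hence only vertical derivatives of
`Θ` occur, and these are contractions with the vertical vector field. -/
theorem auxS_hamiltonian (hi : ContMDiff 𝓘(ℝ, Eu d) 𝓘(ℝ, Eu e) ∞ i)
    (hα : IsForm1 n α) (hϖ : IsForm2 n ϖ) (hext : IsExtDeriv α ϖ)
    (hV : IsVF 1 (ver V)) (hΘ : IsFn (n + 1) Θ) (hH : IsVertHamiltonian ϖ Θ V) :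
    IsVertHamiltonian (akszΩ γ ϖ) (auxS γ i α Θ) (auxVF (S := S) γ i V) := by
  intro L L' φ k D x y hD hx
  have hnat : IsNatural Θ := hΘ.natural
  refine akszΩ_dLift_add hα hϖ hext hD y (auxTarget_isTan hi hV _ _)
    (densityFn_smooth hnat (pullPt hi x) y) fun p => ?_
  have hx' : (mapSpace γ A).vel (S := L') k D (pullPt hi x) = 0 := by
    rw [← pullVec_vel, hx, pullVec_zero]
  rw [density2_auxTarget hi hH _ _ (vel_isTan y hD)]
  exact (coeffDer_densityFn hnat hD y (pullPt_map hi φ x).symm (isTan_zero _ k) (vel_isTan y hD)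
    hx' rfl p).symm

/-- By `akszΩ_dLift_add` without target contribution, the variation of the kinetic term is the
contraction of the BV form with the lifted differential and the velocity. Horizontal derivatives
therefore do not see the kinetic term. -/
theorem kinetic_of_vel_eq_zero (hα : IsForm1 n α) (hϖ : IsForm2 n ϖ) (hext : IsExtDeriv α ϖ)
    (hd : (d : ℤ) = n + 1) {φ : GAlg.Hom L.1 L'.1} {k : ℤ} {D : L.1 →ₗ[ℝ] L'.1} (hD : IsDer φ k D)
    (y : (mapSpace γ B).Pt L) (hy : (mapSpace γ B).vel (S := L') k D y = 0) :
    D (kinetic γ α L y) = 0 := by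
  let y' := (mapSpace γ B).map (S := L') φ y
  have h0 := isTan_zero y' 1
  have hk := isTan_zero y' k
  have h := akszΩ_dLift_add hα hϖ hext hD y h0 SmoothForm.zero fun p => by
    rw [hy, map_zero]
    exact hϖ.map_zero (X := spec B) (R := formTest d L') (x := y'.1 p) (h0.1 p) (hk.1 p)
  rw [hy, fiberIntegral_zero, add_zero, add_zero] at h
  rw [← h]
  exact (akszΩ_isForm2 hϖ hd).map_zero (dLift_isTan y') hk

theorem aux_master (hi : ContMDiff 𝓘(ℝ, Eu d) 𝓘(ℝ, Eu e) ∞ i)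
    (hQ : IsVF 1 Q) (h : IsTrivialHamQBundle n Q V ϖ α Θ) (hd : (d : ℤ) = n + 1) :
    ∃ QΘ ΘΘ : ((mapSpace S A).prod (mapSpace γ B)).Fn,
      Derives 1 (hor (akszQ S Q)) (auxS γ i α Θ) QΘ ∧
      Derives 1 (ver (auxVF γ i V)) (auxS γ i α Θ) ΘΘ ∧
      ∀ R z, QΘ R z + (1 / 2 : ℝ) • ΘΘ R z = 0 := by
  have hα := h.symplectic.form1
  have hϖ := h.symplectic.form2
  have hext : IsExtDeriv α ϖ := h.symplectic.exact
  have hnat : IsNatural Θ := h.fn.natural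
  -- Horizontally only the integral of `Θ` varies, and `(-1)^d` is the sign of taking an odd
  -- derivation out of the integral. Vertically the derivative is `Ω(A_γ, A_γ)`, because `A_γ` is
  -- Hamiltonian.
  refine ⟨fun L z => (d : ℤ).negOnePow • fiberIntegral γ (densityDir Θ
    ((akszQ_isVF hQ).tangent L (pullPt hi z.1)) (isTan_zero z.2 1)),
    fun L z => akszΩ γ ϖ L z.2 1 (auxVF γ i V L z.1 z.2) 1 (auxVF γ i V L z.1 z.2),
    fun {L L'} φ D z hD hvel => ?_, fun {L L'} φ D z hD hvel => ?_, fun L z => ?_⟩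
  · obtain ⟨x, y⟩ := z
    have hx : (mapSpace S A).vel (S := L') 1 D x =
      akszQ S Q L' ((mapSpace S A).map (S := L') φ x) := congrArg Prod.fst hvel
    have hy : (mapSpace γ B).vel (S := L') 1 D y = 0 := congrArg Prod.snd hvel
    have hx' : (mapSpace γ A).vel (S := L') 1 D (pullPt hi x) =
        akszQ γ Q L' (pullPt hi ((mapSpace S A).map (S := L') φ x)) := by
      rw [← pullVec_vel, hx, pullVec_akszQ hi hQ]
    have hf := densityFn_smooth hnat (pullPt hi x) y
    have hT := (akszQ_isVF hQ).tangent L' (pullPt hi ((mapSpace S A).map (S := L') φ x))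
    have h1 := fiberIntegral_coeffDer hf 1 D
    have h2 : (fun p => coeffDer d 1 D (densityFn γ Θ (pullPt hi x) y p)) =
        densityDir Θ hT (isTan_zero ((mapSpace γ B).map (S := L') φ y) 1) :=
      funext (coeffDer_densityFn hnat hD y (pullPt_map hi φ x).symm hT (isTan_zero _ 1) hx' hy)
    rw [h2, one_mul] at h1
    rw [auxS_eq hi, map_add, kinetic_of_vel_eq_zero hα hϖ hext hd hD y hy, zero_add]
    refine Eq.trans ?_ (congrArg (fun s : L'.1 => (d : ℤ).negOnePow • s) h1).symm
    rw [smul_smul, units_mul_self, one_smul]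
  · obtain ⟨x, y⟩ := z
    have hx : (mapSpace S A).vel (S := L') 1 D x = 0 := congrArg Prod.fst hvel
    have hy : (mapSpace γ B).vel (S := L') 1 D y = auxVF γ i V L'
      ((mapSpace S A).map (S := L') φ x) ((mapSpace γ B).map (S := L') φ y) :=
      congrArg Prod.snd hvel
    have h1 := auxS_hamiltonian hi hα hϖ hext h.vert_vf h.fn h.hamiltonian φ D x y hD hx
    rw [hy] at h1
    exact h1.symm
  · obtain ⟨x, y⟩ := z
    have hdx := dLift_isTan (pullPt hi x)
    have hdy := dLift_isTan y
    have hQT := targetLift_isTan hQ (pullPt hi x)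
    have hT := auxTarget_isTan hi h.vert_vf x y
    have h0x := isTan_zero (pullPt hi x) 1
    have h0y := isTan_zero y 1
    obtain ⟨QΘ, ΘΘ, hQΘ, hΘΘ, hm⟩ := h.master
    -- The master equation of the target at a point over form-valued parameters, with both
    -- derivatives rewritten as directional derivatives of `Θ`.
    have hmaster : ∀ p, densityDir Θ hQT h0y p + (1 / 2 : ℝ) • densityDir Θ h0x hT p = 0 := by
      intro p
      have hQ' : densityDir Θ hQT h0y p = QΘ (formTest d L) ((pullPt hi x).1 p, y.1 p) :=
        derives_dir_prod (S := formTest d L) (W := hor Q)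
          (z := ((pullPt hi x).1 p, y.1 p)) hQΘ rfl ⟨hQT.1 p, h0y.1 p⟩
      have hV' : densityDir Θ h0x hT p = ΘΘ (formTest d L) ((pullPt hi x).1 p, y.1 p) :=
        derives_dir_prod (S := formTest d L) (W := ver V)
          (z := ((pullPt hi x).1 p, y.1 p)) hΘΘ rfl ⟨h0x.1 p, hT.1 p⟩
      rw [hQ', hV']
      exact hm (formTest d L) ((pullPt hi x).1 p, y.1 p)
    have h1 := akszΩ_self hα hϖ hext y hT
    rw [density2_auxTarget hi h.hamiltonian x y hdy,
      density2_auxTarget hi h.hamiltonian x y hT] at h1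
    have s1 := densityDir_smooth hnat h0x hdy
    have s2 := densityDir_smooth hnat h0x hT
    have s3 := (s1.add s1).add s2
    have s4 := densityDir_smooth hnat (isTan_add hdx hQT) h0y
    -- Write `∂Θ` for the directional derivative. Additivity gives `∂Θ(dx + Q, 0) + ½ (2 ∂Θ(0, dy) +
    -- ∂Θ(0, V)) = ∂Θ(dx, dy) + (QΘ + ½ VΘ)`. The last bracket is zero by `hmaster`, and `∂Θ(dx, dy)
    -- = d(Θ(x, y))` integrates to zero.
    have h2 : (fun p => densityDir Θ (isTan_add hdx hQT) h0y p + (1 / 2 : ℝ) •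
        (densityDir Θ h0x hdy p + densityDir Θ h0x hdy p + densityDir Θ h0x hT p)) =
        deRham γ (densityFn γ Θ (pullPt hi x) y) := by
      funext p
      have e1 : densityDir Θ (isTan_add hdx hQT) h0y p =
          densityDir Θ hdx h0y p + densityDir Θ hQT h0y p :=
        (congrFun (densityDir_congr _ _ _ _ rfl (add_zero _).symm) p).trans
          (densityDir_add hnat hdx hQT h0y h0y p)
      have e2 : densityDir Θ hdx hdy p = densityDir Θ hdx h0y p + densityDir Θ h0x hdy p :=
        (congrFun (densityDir_congr _ _ _ _ (add_zero _).symm (zero_add _).symm) p).trans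
          (densityDir_add hnat hdx h0x h0y hdy p)
      rw [deRham_densityFn hnat, e1, e2, eq_neg_of_add_eq_zero_left (hmaster p)]
      module
    have h3 := fiberIntegral_add s4 (s3.smul (1 / 2))
    rw [h2, fiberIntegral_deRham (densityFn_smooth hnat _ _), fiberIntegral_smul s3] at h3
    change (d : ℤ).negOnePow • fiberIntegral γ (densityDir Θ (isTan_add hdx hQT) h0y) +
      (1 / 2 : ℝ) • akszΩ γ ϖ L y 1 (dLift γ L y + auxTarget γ i V L x y) 1
        (dLift γ L y + auxTarget γ i V L x y) = 0
    rw [h1, smul_comm (1 / 2 : ℝ), ← smul_add, ← h3, smul_zero]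

theorem aux_isTrivialHamQBundle (hi : ContMDiff 𝓘(ℝ, Eu d) 𝓘(ℝ, Eu e) ∞ i)
    (h : IsTrivialHamQBundle n Q V ϖ α Θ) (hd : (d : ℤ) = n + 1) :
    IsTrivialHamQBundle (-1) (akszQ S Q) (auxVF γ i V) (akszΩ γ ϖ) (trans1 γ α)
      (auxS γ i α Θ) where
  base_vf := akszQ_isVF h.base_vf
  base_sq_zero := akszQ_sqZero h.base_vf h.base_sq_zero
  vert_vf := auxVF_isVF hi h.vert_vf
  sq_zero := auxVF_sqZero hi h.base_vf h.base_sq_zero h.vert_vf h.sq_zero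
  symplectic := akszΩ_symplectic h.symplectic hd
  fn := auxS_isFn hi h.symplectic.form1 h.fn hd
  hamiltonian := auxS_hamiltonian hi h.symplectic.form1 h.symplectic.form2 h.symplectic.exact
    h.vert_vf h.fn h.hamiltonian
  master := aux_master hi h.base_vf h hd

end aux

end PtSpace

end

/-! ### The ambient theory together with its pre-observable -/

theorem proposition3 (M N : GradedManifold) (n n' : ℤ)
    (Q : (spec M.functions).VF) (ϖ : (spec M.functions).Form2) (α : (spec M.functions).Form1)
    (Θ : (spec M.functions).Fn) (hM : IsHamQManifold n Q ϖ α Θ)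
    (A : VertVF (spec M.functions) (spec N.functions)) (ϖ' : (spec N.functions).Form2)
    (α' : (spec N.functions).Form1) (Θ' : ((spec M.functions).prod (spec N.functions)).Fn)
    (hE : IsTrivialHamQBundle n' Q A ϖ' α' Θ')
    {e d : ℕ} (S : ClosedOriented e) (γ : ClosedOriented d)
    (he : (e : ℤ) = n + 1) (hd : (d : ℤ) = n' + 1)
    (i : γ → S) (hi : ContMDiff 𝓘(ℝ, Eu d) 𝓘(ℝ, Eu e) ∞ i) :
    IsPreObservable (akszQ S Q) (akszΩ S ϖ) (trans1 S α) (akszS S α Θ)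
      (auxVF γ i A) (akszΩ γ ϖ') (trans1 γ α') (auxS γ i α' Θ') :=
  ⟨aksz_isBVTheory hM he, aux_isTrivialHamQBundle hi hE hd⟩
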